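/- **Setting.** Let $b,d>0$, $-\xi<d$, $0<\underline k<\overline k$, $R>0$, and let $x_j=-b+jh$, $y_s=-b+sh$ $(0\le j,s\le N+1)$, $h=2b/(N+1)$, be a uniform grid in $[-b,b]^2$. A node is *interior* if $|x_j|,|y_s|<b$ and *lateral* otherwise. Semidiscrete functions are complex valued functions of $(x_j,y_s,z)$ or of $(x_j,y_s,z,k)$ with $z\in(-\xi,d)$, $k\in(\underline k,\overline k)$; $\Omega_h$ denotes the set of the points $(x_j,y_s,z)$. Put $$\|f\|^2_{H^{m,h}}=\sum_{j,s}\sum_{r=0}^m h^2\int_{-\xi}^d|\partial_z^rf|^2dz,\qquad \|f\|^2_{H^h_m}=\int_{\underline k}^{\overline k}\|f(\cdot,k)\|^2_{H^{m,h}}dk,$$ and let $\|c\|^2_{L_2^h}=\sum h^2\int_{-\xi}^d|c|^2dz$, the sum being over the interior nodes. A function *has boundary data* $(\phi_0,\phi_1)$ if $f=\phi_0$, $f_z=\phi_1$ at $z=-\xi$ at the interior nodes and $f=0$ at $z=d$ and at the lateral nodes. $H_0^{2,h}\subset H^{2,h}$ and $H^h_{0,2}\subset H^h_2$ are the subspaces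 with boundary data $(0,0)$ (for a.e. $k$), regarded as real Hilbert spaces; $B(R)=\{p\in H^h_{0,2}:\|p\|_{H_2^h}<R\}$. At interior nodes let $\Delta^hu=u_{zz}+u^h_{xx}+u^h_{yy}$ with the standard second differences and $\nabla^hu=(\partial^h_xu,\partial^h_yu,\partial_zu)$ with central differences; $a\cdot b=\sum a_mb_m$. For functions $V(\mathbf x)$, $q(\mathbf x,k)$ put $v(\cdot,k)=V-\int_k^{\overline k}q(\cdot,\kappa)\,d\kappa$ and $$L^h_V(q)=\Delta^hq+2k\,\nabla^hv\cdot\big(k\nabla^hq+\nabla^hv\big)+2i\,(kq_z+v_z).$$ The coefficient reconstructed from $(V,q)$ at a fixed $k\in[\underline k,\overline k]$ is $c=-(\Delta^hv+k^2\nabla^hv\cdot\nabla^hv)$ or, if $v$ is normalized by the incident wave $e^{ikz}$, $c=1-(\Delta^hv+k^2\nabla^hv\cdot\nabla^hv+2ikv_z)$; the theorem holds for each of the two formulas and each such $k$. **Exact solution.** $V_*\in H^{2,h}$ satisfies $\Delta^hV_*=0$ with boundary data $(\psi_{0*},\psi_{1*})$; $q_*\in H_2^h$ satisfies $L^h_{V_*}(q_*)=0$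 with boundary data $(\phi_{0*},\phi_{1*})$; $c_*$ is the coefficient given by $(V_*,q_*)$; $Q_*\in H^{2,h}$ and $F_*\in H_3^h$ have the boundary data $(\psi_{0*},\psi_{1*})$ and $(\phi_{0*},\phi_{1*})$; $p_*=q_*-F_*$. **Noisy data.** $Q\in H^{2,h}$ and $F\in H_3^h$ have boundary data $(\psi_0,\psi_1)$ and $(\phi_0,\phi_1)$, and $\|Q-Q_*\|_{H^{2,h}}<\delta$, $\|F-F_*\|_{H_3^h}<\delta$. For $\mu(\delta)=\ln\delta^{-1/(2(d+\xi))}$ let $V=W_{\min}+Q$, where $W_{\min}$ is the minimizer over $W\in H_0^{2,h}$ of $e^{2\mu d}\sum h^2\int_{-\xi}^d|\Delta^h(W+Q)|^2e^{-2\mu z}dz$ (sum over interior nodes). Let $$J_\lambda(p)=e^{2\lambda d}\sum h^2\int_{\underline k}^{\overline k}\!\int_{-\xi}^d|L^h_V(p+F)|^2e^{-2\lambda z}\,dz\,d\kappa,\qquad p\in H^h_{0,2}.$$ **Theorem 7.6.** There are numbers $\lambda_1>1$, $C_1,C_2>0$, $\gamma_0(\lambda)\in(0,1)$ and $\theta(\lambda,\gamma)\in(0,1)$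 for $0<\gamma<\gamma_0(\lambda)$, depending only on $\Omega_h,R,\underline k,\overline k$ and on upper bounds for $\|F_*\|_{H^h_3}$ and $\|V_*\|_{H^{2,h}}$ (and on $\lambda$, $\gamma$ where indicated), such that the following holds for all $\delta\in(0,e^{-4(d+\xi)\lambda_1})$ and all data as above with $p_*\in B(R)$. The minimizer $W_{\min}$ exists and is unique; $J_\lambda$ has a Fréchet derivative $J_\lambda'(p)\in H^h_{0,2}$ at every $p$, and for $\lambda\ge\lambda_1$ $$J_\lambda(p+r)-J_\lambda(p)-J_\lambda'(p)(r)\ge C_1\|r\|^2_{H_2^h}\qquad\text{for all }p,\,p+r\in\overline{B(R)}.$$ Let $\lambda=\lambda(\delta)=\ln\delta^{-1/(4(d+\xi))}$. Then $\lambda>\lambda_1$, the functional $J_\lambda$ has a unique minimizer $p_{\min}$ on $\overline{B(R)}$, and $$\|p_*-p_{\min}\|_{H_2^h}\le C_2\delta^{1/4},\qquad\|c_*-c_{\min}\|_{L_2^h}\le C_2\delta^{1/4},$$ where $c_{\min}$ is reconstructed from $(V,p_{\min}+F)$. Moreover, let $\gamma\in(0,\gamma_0(\lambda))$, $\theta=\theta(\lambda,\gamma)$,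 $p_0\in B(R)$ and $p_n=P_{\overline B}(p_{n-1}-\gamma J'_\lambda(p_{n-1}))$ with the projection $P_{\overline B}$ of $H^h_{0,2}$ onto $\overline{B(R)}$, and let $c_n$ be reconstructed from $(V,p_n+F)$. Then for $n=1,2,\dots$ $$\|p_{\min}-p_n\|_{H_2^h}\le\theta^n\|p_{\min}-p_0\|_{H_2^h},$$ $$\|p_*-p_n\|_{H_2^h}\le C_2\delta^{1/4}+\theta^n\|p_{\min}-p_0\|_{H_2^h},\qquad \|c_*-c_n\|_{L_2^h}\le C_2\delta^{1/4}+C_2\theta^n\|p_{\min}-p_0\|_{H_2^h}.$$ -/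

import Mathlib

open MeasureTheory

noncomputable section

namespace Convexification

/-- The geometry: the box `|x|, |y| < b`, `-ξ < z < d`, the interval `[kmin, kmax]` of wave numbers,
and a uniform grid in `(x, y)` with `N` interior nodes in each direction. -/
structure Config where
  b : ℝ
  ξ : ℝ
  d : ℝ
  kmin : ℝ
  kmax : ℝ
  N : ℕ
  b_pos : 0 < b
  d_pos : 0 < d
  ξ_lt : -ξ < d
  kmin_pos : 0 < kmin
  k_lt : kmin < kmax

namespace Config

variable (D : Config)

/-- The grid step: the nodes are `x_j = -b + j h`, `y_s = -b + s h`, `0 ≤ j, s ≤ N + 1`. -/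
def h : ℝ := 2 * D.b / (D.N + 1)

/-- Nodes of the closed square `|x|, |y| ≤ b`. -/
abbrev Node : Type := Fin (D.N + 2) × Fin (D.N + 2)

/-- Indices of the interior nodes `|x|, |y| < b`; `(j, s)` stands for the node `(j + 1, s + 1)`. -/
abbrev Inner : Type := Fin D.N × Fin D.N

variable {D}

/-- The node itself and its four neighbours. -/
def ctr (i : D.Inner) : D.Node := (i.1.succ.castSucc, i.2.succ.castSucc)
def xPlus (i : D.Inner) : D.Node := (i.1.succ.succ, i.2.succ.castSucc)
def xMinus (i : D.Inner) : D.Node := (i.1.castSucc.castSucc, i.2.succ.castSucc)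
def yPlus (i : D.Inner) : D.Node := (i.1.succ.castSucc, i.2.succ.succ)
def yMinus (i : D.Inner) : D.Node := (i.1.succ.castSucc, i.2.castSucc.castSucc)

/-- Nodes with `|x| = b` or `|y| = b`. -/
def IsLateral (n : D.Node) : Prop :=
  n.1 = 0 ∨ n.1 = Fin.last _ ∨ n.2 = 0 ∨ n.2 = Fin.last _

variable (D)

/-- Lebesgue measure on `(-ξ, d)`. -/
def zMeas : Measure ℝ := volume.restrict (Set.Ioo (-D.ξ) D.d)

/-- Lebesgue measure on the interval of wave numbers. -/
def kMeas : Measure ℝ := volume.restrict (Set.Ioo D.kmin D.kmax)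

/-- The one-point parameter space: functions without dependence on `k` are functions of `((), z)`. -/
def unitMeas : Measure Unit := Measure.dirac ()

instance : IsFiniteMeasure D.zMeas := by unfold zMeas; infer_instance
instance : IsFiniteMeasure D.kMeas := by unfold kMeas; infer_instance
instance : IsFiniteMeasure unitMeas := by unfold unitMeas; infer_instance

variable {K : Type} [MeasurableSpace K]

/-- The measure `h² dν(κ) dz`. -/
def cylMeas (ν : Measure K) : Measure (K × ℝ) :=
  ENNReal.ofReal (D.h ^ 2) • ν.prod D.zMeas

/-- Families `f (n, r)`, for a node `n` and `0 ≤ r ≤ m`, of elements of `L²`; the entry `(n, r)` is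
to be `∂_z^r f` at the node `n`. The norm is
`‖f‖² = ∑_n ∑_r h² ∫∫ |f (n, r)|² dz dν`. -/
abbrev Jet (m : ℕ) (ν : Measure K) : Type :=
  PiLp 2 (fun _ : D.Node × Fin (m + 1) => Lp ℂ 2 (D.cylMeas ν))

/-- For almost every `κ`, the function `f(κ, ·)` is absolutely continuous on `[-ξ, d]` (after a
change on a null set), has the derivative `g(κ, ·)` and takes the value `a κ` at the point `z₀`. -/
def HasTrace (ν : Measure K) (f g : K × ℝ → ℂ) (z₀ : ℝ) (a : K → ℂ) : Prop :=
  ∀ᵐ κ ∂ν, ∀ᵐ z ∂D.zMeas, f (κ, z) = a κ + ∫ t in z₀..z, g (κ, t)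

/-- `g` is the `z`-derivative of `f`. -/
def IsZDeriv (ν : Measure K) (f g : K × ℝ → ℂ) : Prop :=
  ∃ a : K → ℂ, D.HasTrace ν f g (-D.ξ) a

section Closure

variable {D} {ν : Measure K}

theorem h_pos : 0 < D.h := by
  have := D.b_pos
  unfold h
  positivity

theorem ae_slice {p : K × ℝ → Prop} (hp : ∀ᵐ w ∂D.cylMeas ν, p w) :
    ∀ᵐ κ ∂ν, ∀ᵐ z ∂D.zMeas, p (κ, z) := by
  have hc : ENNReal.ofReal (D.h ^ 2) ≠ 0 := by
    have := h_pos (D := D)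
    simpa using by positivity
  have h1 : ∀ᵐ w ∂ν.prod D.zMeas, p w := by
    rwa [cylMeas, Measure.ae_ennreal_smul_measure_iff hc] at hp
  exact Measure.ae_ae_of_ae_prod h1

theorem integrable_slice [IsFiniteMeasure ν] (f : Lp ℂ 2 (D.cylMeas ν)) :
    ∀ᵐ κ ∂ν, Integrable (fun z => f (κ, z)) D.zMeas := by
  have hc : ENNReal.ofReal (D.h ^ 2) ≠ 0 := by
    have := h_pos (D := D)
    simpa using by positivity
  have : IsFiniteMeasure (D.cylMeas ν) := by
    unfold cylMeas
    exact (ν.prod D.zMeas).smul_finite ENNReal.ofReal_ne_top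
  have h1 : Integrable f (D.cylMeas ν) := (Lp.memLp f).integrable (by norm_num)
  have h2 : Integrable f (ν.prod D.zMeas) :=
    (integrable_smul_measure hc ENNReal.ofReal_ne_top).1 h1
  exact h2.prod_right_ae

theorem restrict_le {z₀ z : ℝ} (h₀ : z₀ ∈ Set.Icc (-D.ξ) D.d) (hz : z ∈ Set.Ioo (-D.ξ) D.d) :
    volume.restrict (Set.uIoc z₀ z) ≤ D.zMeas := by
  rw [zMeas, restrict_Ioo_eq_restrict_Ioc]
  apply Measure.restrict_mono _ le_rfl
  intro t ht
  rw [Set.mem_uIoc] at ht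
  obtain ⟨a1, a2⟩ := h₀
  obtain ⟨b1, b2⟩ := hz
  rcases ht with ⟨c1, c2⟩ | ⟨c1, c2⟩ <;> constructor <;> linarith

theorem zMem : ∀ᵐ z ∂D.zMeas, z ∈ Set.Ioo (-D.ξ) D.d :=
  ae_restrict_mem measurableSet_Ioo

theorem HasTrace.zero (z₀ : ℝ) (h₀ : z₀ ∈ Set.Icc (-D.ξ) D.d) :
    D.HasTrace ν (0 : Lp ℂ 2 (D.cylMeas ν)) (0 : Lp ℂ 2 (D.cylMeas ν)) z₀ 0 := by
  have h1 := ae_slice (D := D) (ν := ν) (Lp.coeFn_zero ℂ 2 (D.cylMeas ν))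
  filter_upwards [h1] with κ h1
  filter_upwards [h1, zMem] with z h2 hz
  rw [h2]
  have : ∫ t in z₀..z, (0 : Lp ℂ 2 (D.cylMeas ν)) (κ, t) = ∫ t in z₀..z, (0 : ℂ) :=
    intervalIntegral.integral_congr_ae_restrict
      (ae_mono (restrict_le h₀ hz) h1)
  rw [this]
  simp

theorem HasTrace.add [IsFiniteMeasure ν] {f g f' g' : Lp ℂ 2 (D.cylMeas ν)} {z₀ : ℝ}
    (h₀ : z₀ ∈ Set.Icc (-D.ξ) D.d) {a a' : K → ℂ}
    (h1 : D.HasTrace ν f g z₀ a) (h2 : D.HasTrace ν f' g' z₀ a') :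
    D.HasTrace ν (f + f' : Lp ℂ 2 (D.cylMeas ν)) (g + g' : Lp ℂ 2 (D.cylMeas ν)) z₀ (a + a') := by
  filter_upwards [h1, h2, ae_slice (Lp.coeFn_add f f'), ae_slice (Lp.coeFn_add g g'),
    integrable_slice g, integrable_slice g'] with κ h1 h2 h3 h4 i1 i2
  filter_upwards [h1, h2, h3, zMem] with z h1 h2 h3 hz
  have e : ∫ t in z₀..z, (g + g' : Lp ℂ 2 (D.cylMeas ν)) (κ, t)
      = ∫ t in z₀..z, (g (κ, t) + g' (κ, t)) :=
    intervalIntegral.integral_congr_ae_restrict (ae_mono (restrict_le h₀ hz) h4)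
  rw [h3, e, intervalIntegral.integral_add, Pi.add_apply, h1, h2, Pi.add_apply]
  · ring
  · rw [intervalIntegrable_iff]
    exact i1.mono_measure (restrict_le h₀ hz)
  · rw [intervalIntegrable_iff]
    exact i2.mono_measure (restrict_le h₀ hz)

theorem HasTrace.smul {f g : Lp ℂ 2 (D.cylMeas ν)} {z₀ : ℝ}
    (h₀ : z₀ ∈ Set.Icc (-D.ξ) D.d) {a : K → ℂ} (c : ℝ)
    (h1 : D.HasTrace ν f g z₀ a) :
    D.HasTrace ν (c • f : Lp ℂ 2 (D.cylMeas ν)) (c • g : Lp ℂ 2 (D.cylMeas ν)) z₀ (c • a) := by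
  filter_upwards [h1, ae_slice (Lp.coeFn_smul c f), ae_slice (Lp.coeFn_smul c g)] with κ h1 h3 h4
  filter_upwards [h1, h3, zMem] with z h1 h3 hz
  have e : ∫ t in z₀..z, (c • g : Lp ℂ 2 (D.cylMeas ν)) (κ, t)
      = ∫ t in z₀..z, (c • g (κ, t)) :=
    intervalIntegral.integral_congr_ae_restrict (ae_mono (restrict_le h₀ hz) h4)
  rw [h3, e, intervalIntegral.integral_smul, Pi.smul_apply, h1, Pi.smul_apply, smul_add]

theorem left_mem : -D.ξ ∈ Set.Icc (-D.ξ) D.d := ⟨le_rfl, D.ξ_lt.le⟩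
theorem right_mem : D.d ∈ Set.Icc (-D.ξ) D.d := ⟨D.ξ_lt.le, le_rfl⟩

end Closure

/-- Semidiscrete functions with `z`-derivatives up to the order `m` in `L²`. With `ν = unitMeas` this
is `H^{m,h}(Ω_h)`, with `ν = kMeas` it is `H_m^h`. -/
def H (m : ℕ) (ν : Measure K) [IsFiniteMeasure ν] : Submodule ℝ (D.Jet m ν) where
  carrier := {f | ∀ n : D.Node, ∀ r : Fin m, D.IsZDeriv ν (f (n, r.castSucc)) (f (n, r.succ))}
  zero_mem' := fun _ _ => ⟨0, HasTrace.zero _ left_mem⟩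
  add_mem' := fun hf hg n r => by
    obtain ⟨a, ha⟩ := hf n r
    obtain ⟨a', ha'⟩ := hg n r
    exact ⟨a + a', HasTrace.add left_mem ha ha'⟩
  smul_mem' := fun c _ hf n r => by
    obtain ⟨a, ha⟩ := hf n r
    exact ⟨c • a, HasTrace.smul left_mem c ha⟩

variable {D}

/-- The boundary conditions `f = φ₀`, `f_z = φ₁` on `Γ = {|x|, |y| < b, z = -ξ}` and `f = 0` on the
rest of the boundary of the box, that is, at `z = d` and at the lateral nodes. -/
structure HasBC {ν : Measure K} (f : D.Jet 2 ν) (φ₀ φ₁ : D.Inner → K → ℂ) : Prop where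
  lateral : ∀ n : D.Node, IsLateral n → f (n, 0) = 0
  bottom : ∀ i : D.Inner, D.HasTrace ν (f (ctr i, 0)) (f (ctr i, 1)) (-D.ξ) (φ₀ i)
  bottom_z : ∀ i : D.Inner, D.HasTrace ν (f (ctr i, 1)) (f (ctr i, 2)) (-D.ξ) (φ₁ i)
  top : ∀ i : D.Inner, D.HasTrace ν (f (ctr i, 0)) (f (ctr i, 1)) D.d 0

variable (D)

/-- The subspace of functions with zero boundary data: `H_0^{2,h}(Ω_h)` for `ν = unitMeas` and
`H_{0,2}^h` for `ν = kMeas`. -/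
def H0 (ν : Measure K) [IsFiniteMeasure ν] : Submodule ℝ (D.Jet 2 ν) where
  carrier := {f | f ∈ D.H 2 ν ∧ HasBC f 0 0}
  zero_mem' := ⟨(D.H 2 ν).zero_mem, fun _ _ => rfl, fun _ => HasTrace.zero _ left_mem,
    fun _ => HasTrace.zero _ left_mem, fun _ => HasTrace.zero _ right_mem⟩
  add_mem' := fun {f g} hf hg => by
    refine ⟨(D.H 2 ν).add_mem hf.1 hg.1, fun n hn => ?_, fun i => ?_, fun i => ?_, fun i => ?_⟩
    · rw [PiLp.add_apply, hf.2.lateral n hn, hg.2.lateral n hn, add_zero]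
    · simpa using HasTrace.add left_mem (hf.2.bottom i) (hg.2.bottom i)
    · simpa using HasTrace.add left_mem (hf.2.bottom_z i) (hg.2.bottom_z i)
    · simpa using HasTrace.add right_mem (hf.2.top i) (hg.2.top i)
  smul_mem' := fun c f hf => by
    refine ⟨(D.H 2 ν).smul_mem c hf.1, fun n hn => ?_, fun i => ?_, fun i => ?_, fun i => ?_⟩
    · rw [PiLp.smul_apply, hf.2.lateral n hn, smul_zero]
    · simpa using HasTrace.smul left_mem c (hf.2.bottom i)
    · simpa using HasTrace.smul left_mem c (hf.2.bottom_z i)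
    · simpa using HasTrace.smul right_mem c (hf.2.top i)

variable {D}

/-- The inclusion of functions with three derivatives into those with two. -/
def trunc {ν : Measure K} (F : D.Jet 3 ν) : D.Jet 2 ν :=
  WithLp.toLp 2 fun p => F (p.1, p.2.castSucc)

/-- `Δ^h u = u_zz + u_xx^h + u_yy^h` at an interior node. -/
def lapH {ν : Measure K} (u : D.Jet 2 ν) (i : D.Inner) (w : K × ℝ) : ℂ :=
  u (ctr i, 2) w
    + (u (xMinus i, 0) w - 2 * u (ctr i, 0) w + u (xPlus i, 0) w) / (D.h : ℂ) ^ 2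
    + (u (yMinus i, 0) w - 2 * u (ctr i, 0) w + u (yPlus i, 0) w) / (D.h : ℂ) ^ 2

/-- `∇^h u = (∂_x^h u, ∂_y^h u, ∂_z u)` at an interior node. -/
def gradH {ν : Measure K} (u : D.Jet 2 ν) (i : D.Inner) (w : K × ℝ) : Fin 3 → ℂ :=
  ![(u (xPlus i, 0) w - u (xMinus i, 0) w) / (2 * (D.h : ℂ)),
    (u (yPlus i, 0) w - u (yMinus i, 0) w) / (2 * (D.h : ℂ)),
    u (ctr i, 1) w]

/-- `Δ^h v` for `v(·, k) = V - ∫_k^{kmax} q(·, κ) dκ`. -/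
def lapV (V : D.Jet 2 unitMeas) (q : D.Jet 2 D.kMeas) (i : D.Inner) (k z : ℝ) : ℂ :=
  lapH V i ((), z) - ∫ κ in k..D.kmax, lapH q i (κ, z)

/-- `∇^h v` for `v(·, k) = V - ∫_k^{kmax} q(·, κ) dκ`. -/
def gradV (V : D.Jet 2 unitMeas) (q : D.Jet 2 D.kMeas) (i : D.Inner) (k z : ℝ) : Fin 3 → ℂ :=
  fun m => gradH V i ((), z) m - ∫ κ in k..D.kmax, gradH q i (κ, z) m

/-- The integro-differential operator with the tail function `V`, at `w = (k, z)`: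
`L^h(q) = Δ^h q + 2k ∇^h v · (k ∇^h q + ∇^h v) + 2i (k q_z + v_z)`, `v = V - ∫_k^{kmax} q dκ`,
where `a · b = ∑ a_m b_m` without complex conjugation. -/
def Lh (V : D.Jet 2 unitMeas) (q : D.Jet 2 D.kMeas) (i : D.Inner) (w : ℝ × ℝ) : ℂ :=
  lapH q i w
    + 2 * (w.1 : ℂ) *
      (gradV V q i w.1 w.2 ⬝ᵥ ((w.1 : ℂ) • gradH q i w + gradV V q i w.1 w.2))
    + 2 * Complex.I * ((w.1 : ℂ) * gradH q i w 2 + gradV V q i w.1 w.2 2)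

/-- The Carleman weight function. -/
def cwf (lam z : ℝ) : ℝ := Real.exp (-2 * lam * z)

/-- `I_μ(W) = e^{2μd} ∑ h² ∫ |Δ^h (W + Q)|² φ_μ dz`. -/
def tailCost (Q : D.Jet 2 unitMeas) (mu : ℝ) (W : D.H0 unitMeas) : ℝ :=
  Real.exp (2 * mu * D.d) *
    ∑ i : D.Inner, ∫ w, ‖lapH ((W : D.Jet 2 unitMeas) + Q) i w‖ ^ 2 * cwf mu w.2
      ∂D.cylMeas unitMeas

/-- `J_λ(p) = e^{2λd} ∑ h² ∫∫ |L^h(p + F)|² φ_λ dz dκ`. -/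
def cost (V : D.Jet 2 unitMeas) (F : D.Jet 3 D.kMeas) (lam : ℝ) (p : D.H0 D.kMeas) : ℝ :=
  Real.exp (2 * lam * D.d) *
    ∑ i : D.Inner, ∫ w, ‖Lh V ((p : D.Jet 2 D.kMeas) + trunc F) i w‖ ^ 2 * cwf lam w.2
      ∂D.cylMeas D.kMeas

/-- `V` is an `H^{2,h}` solution of `Δ^h V = 0` with the Cauchy data `ψ₀, ψ₁` on `Γ` and zero data on
the rest of the boundary. -/
structure IsTail (V : D.Jet 2 unitMeas) (ψ₀ ψ₁ : D.Inner → Unit → ℂ) : Prop where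
  mem : V ∈ D.H 2 unitMeas
  bc : HasBC V ψ₀ ψ₁
  eq : ∀ i : D.Inner, ∀ᵐ w ∂D.cylMeas unitMeas, lapH V i w = 0

/-- `q` is an `H_2^h` solution of `L^h(q) = 0`, with the tail function `V`, with the Cauchy data
`φ₀, φ₁` on `Γ` and zero data on the rest of the boundary. -/
structure IsField (V : D.Jet 2 unitMeas) (q : D.Jet 2 D.kMeas) (φ₀ φ₁ : D.Inner → ℝ → ℂ) :
    Prop where
  mem : q ∈ D.H 2 D.kMeas
  bc : HasBC q φ₀ φ₁
  eq : ∀ i : D.Inner, ∀ᵐ w ∂D.cylMeas D.kMeas, Lh V q i w = 0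

/-- The two formulas for the coefficient in terms of `v`: for `v = k⁻² log u` with the total wave `u`,
and for `v = k⁻² log (u / e^{ikz})`. -/
inductive Rule where
  | total : Rule
  | ratio : Rule

/-- The coefficient computed from `v(·, k) = V - ∫_k^{kmax} q(·, κ) dκ`:
`c = -(Δ^h v + k² ∇^h v · ∇^h v)` or `c = 1 - (Δ^h v + k² ∇^h v · ∇^h v + 2ik v_z)`. -/
def coeff (V : D.Jet 2 unitMeas) (q : D.Jet 2 D.kMeas) (k : ℝ) (i : D.Inner) (z : ℝ) : Rule → ℂ
  | .total => -(lapV V q i k z + (k : ℂ) ^ 2 * (gradV V q i k z ⬝ᵥ gradV V q i k z))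
  | .ratio => 1 - (lapV V q i k z + (k : ℂ) ^ 2 * (gradV V q i k z ⬝ᵥ gradV V q i k z)
      + 2 * Complex.I * (k : ℂ) * gradV V q i k z 2)

/-- The norm of `L_2^h(Ω_h)`, `∞` if the function is not square integrable. -/
def l2h (c : D.Inner → ℝ → ℂ) : ENNReal :=
  (∑ i : D.Inner, ENNReal.ofReal (D.h ^ 2) * ∫⁻ z, ‖c i z‖ₑ ^ 2 ∂D.zMeas) ^ (1 / 2 : ℝ)

end Config

/-- `x` is the unique minimizer of `f` on `S`. -/
def IsUniqueMinOn {X : Type} (f : X → ℝ) (S : Set X) (x : X) : Prop :=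
  x ∈ S ∧ ∀ y ∈ S, y ≠ x → f x < f y

/-- `x` is the projection of `y` on `S`. -/
def IsProjection {X : Type} [NormedAddCommGroup X] (S : Set X) (y x : X) : Prop :=
  x ∈ S ∧ ∀ w ∈ S, ‖y - x‖ ≤ ‖y - w‖

end Convexification

end

/-! The grid step is fixed, so differences in x and y are bounded operators and only the order in z
matters: both Δ^h and L^h are u_zz plus terms of lower order in z. A function in `H0` has zero
Cauchy data at z = -ξ, hence u_z and u are iterated integrals of u_zz from that end. Against the
weight e^{λ(d-z)}, which decreases away from that end, every integration gains a factor of order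
λ^{-1/2} by Cauchy–Schwarz (`enorm_wt_mul_integral_sq_le`, `norm_carl_le_of_hasTrace`). For large λ
the weighted norm of u_zz therefore absorbs all lower order terms. The weight is at least 1, so that
norm also controls the unweighted norm of u (`norm_sq_le_topNorm`).

L^h is a quadratic polynomial `opL` in the pair (V, q). The components of ∇^h v are bounded
functions, by the Sobolev inequality in z and integration over the wave numbers; this makes the
quadratic part a bounded bilinear map into L². The second order Taylor remainder of the functional
has the exact form given in `costP_add`: a sum of squares of the weighted increments of `opL`, plus
inner products of `opL` with the quadratic term of the perturbation r. An increment is r_zz plus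
lower order terms. In the inner product both weights are moved onto the quadratic term, one on each
of its factors, so it is of size eps² times the square of the weighted norm of r_zz, with a constant
independent of λ (`abs_inner_carl_quad_le`). Absorption then gives strong convexity on the ball
(`le_costP_remainder`).

Strong convexity yields a unique minimizer with quadratic growth (`exists_isUniqueMinOn`). The error
estimates come from evaluating the growth at the exact solution, where the functional is at most
e^{2λ(d+ξ)} times the squared data error. For the tail, e^{2μ(d+ξ)} = δ^{-1} and the data error is
δ, so the cost is of order δ and the error of V of order δ^{1/2} (`exists_tail`). For the field,
e^{2λ(d+ξ)} = δ^{-1/2} and the data error is δ^{1/2}, so the cost is of order δ^{1/2} and the error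
of p of order δ^{1/4} (`norm_sub_minimizer_le`).

The projection method contracts because of the lower Taylor bound and a crude upper one
(`norm_sq_projection_step_le`, `gradient_projection_le`). The coefficient is a locally Lipschitz
function of (V, q) in L² (`l2h_coeff_sub_le`), so it inherits all these rates. -/

namespace Convexification

open scoped ENNReal

/-! ### Integral inequalities and measurability of parametric integrals. -/

section Abstract

variable {α : Type*} [MeasurableSpace α]

/-- Cauchy–Schwarz for the lower integral, squared. -/
theorem sq_lintegral_mul_le (μ : Measure α) {f g : α → ℝ≥0∞} (hf : AEMeasurable f μ)
    (hg : AEMeasurable g μ) :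
    (∫⁻ a, f a * g a ∂μ) ^ 2 ≤ (∫⁻ a, f a ^ 2 ∂μ) * ∫⁻ a, g a ^ 2 ∂μ := by
  have h := ENNReal.lintegral_mul_le_Lp_mul_Lq μ Real.HolderConjugate.two_two hf hg
  simp only [Pi.mul_apply, ENNReal.rpow_two] at h
  calc (∫⁻ a, f a * g a ∂μ) ^ 2
      ≤ ((∫⁻ a, f a ^ 2 ∂μ) ^ (1 / 2 : ℝ) * (∫⁻ a, g a ^ 2 ∂μ) ^ (1 / 2 : ℝ)) ^ 2 := by gcongr
    _ = _ := by
      rw [mul_pow, ← ENNReal.rpow_two, ← ENNReal.rpow_two, ← ENNReal.rpow_mul,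
        ← ENNReal.rpow_mul]
      norm_num

/-- The interval integral of a jointly measurable function depends measurably on the parameter. -/
theorem stronglyMeasurable_intervalIntegral {f : α × ℝ → ℂ} (hf : StronglyMeasurable f)
    {a b : α → ℝ} (ha : Measurable a) (hb : Measurable b) :
    StronglyMeasurable fun w => ∫ t in a w..b w, f (w, t) := by
  have key : ∀ {a b : α → ℝ}, Measurable a → Measurable b →
      StronglyMeasurable fun w => ∫ t in Set.Ioc (a w) (b w), f (w, t) := by
    intro a b ha hb
    have hs : MeasurableSet {p : α × ℝ | a p.1 < p.2 ∧ p.2 ≤ b p.1} :=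
      (measurableSet_lt (ha.comp measurable_fst) measurable_snd).inter
        (measurableSet_le measurable_snd (hb.comp measurable_fst))
    have h1 := (hf.indicator hs).integral_prod_right' (ν := (volume : Measure ℝ))
    convert h1 using 2 with w
    rw [← integral_indicator measurableSet_Ioc]
    rfl
  simp only [intervalIntegral]
  exact (key ha hb).sub (key hb ha)

theorem enorm_intervalIntegral_le {f : ℝ → ℂ} {a b : ℝ} :
    ‖∫ t in a..b, f t‖ₑ ≤ ∫⁻ t in Set.uIoc a b, ‖f t‖ₑ := by
  have h : ‖∫ t in a..b, f t‖ₑ = ‖∫ t in Set.uIoc a b, f t‖ₑ := by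
    rw [← ofReal_norm, ← ofReal_norm, intervalIntegral.norm_intervalIntegral_eq f a b volume]
  rw [h]
  exact enorm_integral_le_lintegral_enorm _

end Abstract

/-! ### Slices of the measure on the cylinder. -/

namespace Config

variable {D : Config} {K : Type} [MeasurableSpace K] {ν : Measure K}

/-- The length of the interval `(-ξ, d)`. -/
noncomputable def len (D : Config) : ℝ := D.d + D.ξ

theorem len_pos : 0 < D.len := by
  have := D.ξ_lt
  unfold len
  linarith

theorem zMeas_univ : D.zMeas Set.univ = ENNReal.ofReal D.len := by
  simp [zMeas, len, sub_neg_eq_add]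

theorem kMeas_univ : D.kMeas Set.univ = ENNReal.ofReal (D.kmax - D.kmin) := by
  simp [kMeas]

theorem h_sq_ne_zero : ENNReal.ofReal (D.h ^ 2) ≠ 0 := by
  have := h_pos (D := D)
  simpa using by positivity

instance [IsFiniteMeasure ν] : IsFiniteMeasure (D.cylMeas ν) := by
  unfold cylMeas
  exact (ν.prod D.zMeas).smul_finite ENNReal.ofReal_ne_top

theorem ae_cyl_iff {p : K × ℝ → Prop} :
    (∀ᵐ w ∂D.cylMeas ν, p w) ↔ ∀ᵐ w ∂ν.prod D.zMeas, p w := by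
  rw [cylMeas, Measure.ae_ennreal_smul_measure_iff h_sq_ne_zero]

theorem ae_cyl_of_ae_ae {p : K × ℝ → Prop} (hm : MeasurableSet {w | p w})
    (h : ∀ᵐ κ ∂ν, ∀ᵐ z ∂D.zMeas, p (κ, z)) : ∀ᵐ w ∂D.cylMeas ν, p w :=
  ae_cyl_iff.2 ((Measure.ae_prod_iff_ae_ae hm).2 h)

/-- Fubini with the exceptional set on the z side. Needed because v is evaluated at every single k,
not only at almost every one. -/
theorem ae_slice_swap [SFinite ν] {p : K × ℝ → Prop} (hp : ∀ᵐ w ∂D.cylMeas ν, p w) :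
    ∀ᵐ z ∂D.zMeas, ∀ᵐ κ ∂ν, p (κ, z) := by
  have h1 := ae_cyl_iff.1 hp
  rw [← Measure.prod_swap] at h1
  exact Measure.ae_ae_of_ae_prod (ae_of_ae_map measurable_swap.aemeasurable h1)

theorem ae_cyl_snd [SFinite ν] {p : ℝ → Prop} (h : ∀ᵐ z ∂D.zMeas, p z) :
    ∀ᵐ w ∂D.cylMeas ν, p w.2 := by
  rw [ae_cyl_iff]
  exact Measure.quasiMeasurePreserving_snd.ae h

theorem ae_cyl_fst [SFinite ν] {p : K → Prop} (h : ∀ᵐ κ ∂ν, p κ) :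
    ∀ᵐ w ∂D.cylMeas ν, p w.1 := by
  rw [ae_cyl_iff]
  exact Measure.quasiMeasurePreserving_fst.ae h

theorem lintegral_cyl [SFinite ν] {f : K × ℝ → ℝ≥0∞} (hf : Measurable f) :
    ∫⁻ w, f w ∂D.cylMeas ν
      = ENNReal.ofReal (D.h ^ 2) * ∫⁻ κ, ∫⁻ z, f (κ, z) ∂D.zMeas ∂ν := by
  rw [cylMeas, lintegral_smul_measure, lintegral_prod _ hf.aemeasurable, smul_eq_mul]

theorem measurable_enorm_sq (f : Lp ℂ 2 (D.cylMeas ν)) : Measurable fun w => ‖f w‖ₑ ^ 2 :=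
  (Lp.stronglyMeasurable f).enorm.pow_const 2

theorem enorm_sq_eq_lintegral (f : Lp ℂ 2 (D.cylMeas ν)) :
    ‖f‖ₑ ^ 2 = ∫⁻ w, ‖f w‖ₑ ^ 2 ∂D.cylMeas ν := by
  rw [Lp.enorm_def, eLpNorm_eq_lintegral_rpow_enorm_toReal (by norm_num) (by norm_num),
    ← ENNReal.rpow_natCast, ← ENNReal.rpow_mul]
  norm_num

theorem enorm_sq_eq [SFinite ν] (f : Lp ℂ 2 (D.cylMeas ν)) :
    ‖f‖ₑ ^ 2 = ENNReal.ofReal (D.h ^ 2) * ∫⁻ κ, ∫⁻ z, ‖f (κ, z)‖ₑ ^ 2 ∂D.zMeas ∂ν := by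
  rw [enorm_sq_eq_lintegral, lintegral_cyl (measurable_enorm_sq f)]

theorem lintegral_lintegral_eq [SFinite ν] (f : Lp ℂ 2 (D.cylMeas ν)) :
    ∫⁻ κ, ∫⁻ z, ‖f (κ, z)‖ₑ ^ 2 ∂D.zMeas ∂ν = (ENNReal.ofReal (D.h ^ 2))⁻¹ * ‖f‖ₑ ^ 2 := by
  rw [enorm_sq_eq, ← mul_assoc, ENNReal.inv_mul_cancel h_sq_ne_zero ENNReal.ofReal_ne_top,
    one_mul]

theorem measurable_slice_lintegral (f : Lp ℂ 2 (D.cylMeas ν)) :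
    Measurable fun κ => ∫⁻ z, ‖f (κ, z)‖ₑ ^ 2 ∂D.zMeas :=
  (measurable_enorm_sq f).lintegral_prod_right'

theorem stronglyMeasurable_slice (f : Lp ℂ 2 (D.cylMeas ν)) (κ : K) :
    StronglyMeasurable fun z => f (κ, z) :=
  (Lp.stronglyMeasurable f).comp_measurable measurable_prodMk_left

theorem stronglyMeasurable_slice_swap (f : Lp ℂ 2 (D.cylMeas ν)) (z : ℝ) :
    StronglyMeasurable fun κ => f (κ, z) :=
  (Lp.stronglyMeasurable f).comp_measurable measurable_prodMk_right

/-! ### The Carleman weight -/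

/-- The factor `e^{λ (d - z)}`, the square root of `e^{2λd} e^{-2λz}`. -/
noncomputable def wt (D : Config) (lam : ℝ) (z : ℝ) : ℂ := (Real.exp (lam * (D.d - z)) : ℝ)

theorem measurable_wt (lam : ℝ) : Measurable (D.wt lam) := by
  unfold wt
  fun_prop

theorem norm_wt (lam z : ℝ) : ‖D.wt lam z‖ = Real.exp (lam * (D.d - z)) := by
  rw [wt, Complex.norm_real, Real.norm_eq_abs, abs_of_pos (Real.exp_pos _)]

theorem norm_wt_le (lam : ℝ) {z : ℝ} (hz : z ∈ Set.Ioo (-D.ξ) D.d) :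
    ‖D.wt lam z‖ ≤ Real.exp (|lam| * D.len) := by
  rw [norm_wt, Real.exp_le_exp]
  have h1 : 0 ≤ D.d - z := by linarith [hz.2]
  have h2 : D.d - z ≤ D.len := by unfold len; linarith [hz.1]
  calc lam * (D.d - z) ≤ |lam| * (D.d - z) := mul_le_mul_of_nonneg_right (le_abs_self _) h1
    _ ≤ _ := mul_le_mul_of_nonneg_left h2 (abs_nonneg _)

theorem one_le_norm_wt {lam : ℝ} (hl : 0 ≤ lam) {z : ℝ} (hz : z ∈ Set.Ioo (-D.ξ) D.d) :
    1 ≤ ‖D.wt lam z‖ := by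
  rw [norm_wt]
  exact Real.one_le_exp (mul_nonneg hl (by linarith [hz.2]))

/-- Source of the gain in λ: the primitive of e^{2λ(t-z)} is at most 1/(2λ) at t = z, however long
the interval below z is. -/
theorem lintegral_exp_le {lam : ℝ} (hl : 0 < lam) (a z : ℝ) :
    ∫⁻ t in Set.Ioc a z, ENNReal.ofReal (Real.exp (lam * (t - z))) ^ 2
      ≤ ENNReal.ofReal (1 / (2 * lam)) := by
  rcases le_total z a with h | h
  · simp [Set.Ioc_eq_empty_of_le h]
  have e : ∀ t, ENNReal.ofReal (Real.exp (lam * (t - z))) ^ 2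
      = ENNReal.ofReal (Real.exp (2 * lam * t + -(2 * lam * z))) := by
    intro t
    rw [← ENNReal.ofReal_pow (Real.exp_pos _).le, ← Real.exp_nat_mul]
    congr 2
    push_cast
    ring
  simp_rw [e]
  have hi : IntervalIntegrable (fun t => Real.exp (2 * lam * t + -(2 * lam * z))) volume a z :=
    (by fun_prop : Continuous fun t => Real.exp (2 * lam * t + -(2 * lam * z))).intervalIntegrable _ _
  rw [← ofReal_integral_eq_lintegral_ofReal
    ((intervalIntegrable_iff_integrableOn_Ioc_of_le h).1 hi)
    (Filter.Eventually.of_forall fun t => (Real.exp_pos _).le),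
    ← intervalIntegral.integral_of_le h]
  apply ENNReal.ofReal_le_ofReal
  rw [intervalIntegral.integral_comp_mul_add (fun x => Real.exp x) (by positivity), integral_exp,
    smul_eq_mul, add_neg_cancel, Real.exp_zero, inv_eq_one_div]
  have := Real.exp_pos (2 * lam * a + -(2 * lam * z))
  have : 0 < 1 / (2 * lam) := by positivity
  nlinarith

/-- The Carleman estimate for one integration, at a point. -/
theorem enorm_wt_mul_integral_sq_le {lam : ℝ} (hl : 0 < lam) {g : ℝ → ℂ}
    (hg : StronglyMeasurable g) {z : ℝ} (hz : z ∈ Set.Ioo (-D.ξ) D.d) :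
    ‖D.wt lam z * ∫ t in -D.ξ..z, g t‖ₑ ^ 2
      ≤ ENNReal.ofReal (1 / (2 * lam)) * ∫⁻ t, ‖D.wt lam t * g t‖ₑ ^ 2 ∂D.zMeas := by
  have hsub := restrict_le (left_mem (D := D)) hz
  rw [Set.uIoc_of_le hz.1.le] at hsub
  -- Moving the weight from z back to t ≤ z costs the kernel e^{λ(t-z)} ≤ 1, whose square has
  -- integral at most 1/(2λ).
  have e : ∀ t, D.wt lam z * g t
      = ((Real.exp (lam * (t - z)) : ℝ) : ℂ) * (D.wt lam t * g t) := by
    intro t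
    rw [wt, wt, ← mul_assoc, ← Complex.ofReal_mul, ← Real.exp_add]
    congr 4
    ring
  have hm : Measurable fun t => ‖D.wt lam t * g t‖ₑ :=
    ((measurable_wt lam).mul hg.measurable).enorm
  have h1 : ‖D.wt lam z * ∫ t in -D.ξ..z, g t‖ₑ
      ≤ ∫⁻ t in Set.Ioc (-D.ξ) z,
        ENNReal.ofReal (Real.exp (lam * (t - z))) * ‖D.wt lam t * g t‖ₑ := by
    rw [← intervalIntegral.integral_const_mul]
    refine enorm_intervalIntegral_le.trans ?_
    rw [Set.uIoc_of_le hz.1.le]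
    refine lintegral_mono fun t => ?_
    rw [e t, enorm_mul, ← ofReal_norm (_ : ℂ), Complex.norm_real, Real.norm_eq_abs,
      abs_of_pos (Real.exp_pos _)]
  calc _ ≤ (∫⁻ t in Set.Ioc (-D.ξ) z,
        ENNReal.ofReal (Real.exp (lam * (t - z))) * ‖D.wt lam t * g t‖ₑ) ^ 2 := by gcongr
    _ ≤ _ := sq_lintegral_mul_le _ (by fun_prop) hm.aemeasurable
    _ ≤ _ := mul_le_mul' (lintegral_exp_le hl _ _) (lintegral_mono' hsub le_rfl)

theorem enorm_intervalIntegral_sq_le {g : ℝ → ℂ} (hg : StronglyMeasurable g) {z₀ z : ℝ}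
    (h₀ : z₀ ∈ Set.Icc (-D.ξ) D.d) (hz : z ∈ Set.Ioo (-D.ξ) D.d) :
    ‖∫ t in z₀..z, g t‖ₑ ^ 2 ≤ ENNReal.ofReal D.len * ∫⁻ t, ‖g t‖ₑ ^ 2 ∂D.zMeas := by
  have h1 : ‖∫ t in z₀..z, g t‖ₑ ≤ ∫⁻ t, 1 * ‖g t‖ₑ ∂D.zMeas := by
    simpa using enorm_intervalIntegral_le.trans (lintegral_mono' (restrict_le h₀ hz) le_rfl)
  calc _ ≤ (∫⁻ t, 1 * ‖g t‖ₑ ∂D.zMeas) ^ 2 := by gcongr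
    _ ≤ _ := sq_lintegral_mul_le _ (by fun_prop) hg.enorm.aemeasurable
    _ = _ := by simp [zMeas_univ]

/-! ### Volterra operators -/

theorem stronglyMeasurable_volterra (z₀ : ℝ) (g : Lp ℂ 2 (D.cylMeas ν)) :
    StronglyMeasurable fun w : K × ℝ => ∫ t in z₀..w.2, g (w.1, t) :=
  stronglyMeasurable_intervalIntegral
    (f := fun p : (K × ℝ) × ℝ => g (p.1.1, p.2))
    ((Lp.stronglyMeasurable g).comp_measurable (by fun_prop)) measurable_const measurable_snd

theorem lintegral_volterra_le [SFinite ν] {z₀ : ℝ} (h₀ : z₀ ∈ Set.Icc (-D.ξ) D.d)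
    (g : Lp ℂ 2 (D.cylMeas ν)) :
    ∫⁻ w, ‖∫ t in z₀..w.2, g (w.1, t)‖ₑ ^ 2 ∂D.cylMeas ν ≤ (ENNReal.ofReal D.len * ‖g‖ₑ) ^ 2 := by
  rw [lintegral_cyl ((stronglyMeasurable_volterra z₀ g).enorm.pow_const 2)]
  calc _ ≤ ENNReal.ofReal (D.h ^ 2) * ∫⁻ κ, ∫⁻ z, ENNReal.ofReal D.len *
        ∫⁻ t, ‖g (κ, t)‖ₑ ^ 2 ∂D.zMeas ∂D.zMeas ∂ν := by
        refine mul_le_mul' le_rfl (lintegral_mono fun κ => ?_)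
        refine lintegral_mono_ae ?_
        filter_upwards [zMem] with z hz
        exact enorm_intervalIntegral_sq_le (stronglyMeasurable_slice g κ) h₀ hz
    _ = _ := by
        simp_rw [lintegral_const, zMeas_univ]
        rw [lintegral_mul_const _ ((measurable_slice_lintegral g).const_mul _),
          lintegral_const_mul _ (measurable_slice_lintegral g), mul_pow, enorm_sq_eq]
        ring

theorem memLp_two_of_lintegral {μ : Measure (K × ℝ)} {f : K × ℝ → ℂ}
    (hf : AEStronglyMeasurable f μ) (h : ∫⁻ w, ‖f w‖ₑ ^ 2 ∂μ < ∞) : MemLp f 2 μ := by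
  refine ⟨hf, ?_⟩
  rw [eLpNorm_lt_top_iff_lintegral_rpow_enorm_lt_top (by norm_num) (by norm_num)]
  simpa using h

variable [IsFiniteMeasure ν]

theorem memLp_volterra {z₀ : ℝ} (h₀ : z₀ ∈ Set.Icc (-D.ξ) D.d) (g : Lp ℂ 2 (D.cylMeas ν)) :
    MemLp (fun w : K × ℝ => ∫ t in z₀..w.2, g (w.1, t)) 2 (D.cylMeas ν) :=
  memLp_two_of_lintegral (stronglyMeasurable_volterra z₀ g).aestronglyMeasurable
    ((lintegral_volterra_le h₀ g).trans_lt (by finiteness))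

/-- Turns a slicewise trace condition into an identity between elements of L². This gives the
linearity of `volterra` and, later, the closedness of `H0`. -/
theorem hasTrace_zero_iff {z₀ : ℝ} (h₀ : z₀ ∈ Set.Icc (-D.ξ) D.d)
    (f g : Lp ℂ 2 (D.cylMeas ν)) :
    D.HasTrace ν f g z₀ 0 ↔ (memLp_volterra h₀ g).toLp = f := by
  have hm : MeasurableSet {w : K × ℝ | f w = ∫ t in z₀..w.2, g (w.1, t)} :=
    (Lp.stronglyMeasurable f).measurableSet_eq_fun (stronglyMeasurable_volterra z₀ g)
  rw [Lp.ext_iff]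
  constructor
  · intro h
    have := ae_cyl_of_ae_ae (ν := ν) hm (by simpa [HasTrace] using h)
    filter_upwards [this, (memLp_volterra h₀ g).coeFn_toLp] with w h1 h2
    rw [h1, h2]
  · intro h
    have h' := ae_slice (h.symm.trans (memLp_volterra h₀ g).coeFn_toLp)
    simpa [HasTrace] using h'

/-- The operator `g ↦ ∫_{z₀}^z g dt`. -/
noncomputable def volterra (z₀ : ℝ) (h₀ : z₀ ∈ Set.Icc (-D.ξ) D.d) :
    Lp ℂ 2 (D.cylMeas ν) →L[ℝ] Lp ℂ 2 (D.cylMeas ν) :=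
  LinearMap.mkContinuous
    { toFun := fun g => (memLp_volterra h₀ g).toLp
      map_add' := fun g g' => by
        rw [← hasTrace_zero_iff h₀]
        simpa using HasTrace.add h₀ ((hasTrace_zero_iff h₀ _ g).2 rfl)
          ((hasTrace_zero_iff h₀ _ g').2 rfl)
      map_smul' := fun c g => by
        rw [← hasTrace_zero_iff h₀]
        simpa using HasTrace.smul h₀ c ((hasTrace_zero_iff h₀ _ g).2 rfl) }
    D.len (fun g => by
      have h1 : ‖(memLp_volterra h₀ g).toLp‖ₑ ^ 2 ≤ (ENNReal.ofReal D.len * ‖g‖ₑ) ^ 2 := by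
        rw [enorm_sq_eq_lintegral]
        refine le_trans (le_of_eq (lintegral_congr_ae ?_)) (lintegral_volterra_le h₀ g)
        filter_upwards [(memLp_volterra h₀ g).coeFn_toLp] with w hw
        rw [hw]
      have h2 := (ENNReal.pow_right_strictMono two_ne_zero).le_iff_le.1 h1
      rw [← ofReal_norm, ← ofReal_norm, ← ENNReal.ofReal_mul len_pos.le] at h2
      exact (ENNReal.ofReal_le_ofReal_iff
        (mul_nonneg len_pos.le (norm_nonneg _))).1 h2)

theorem hasTrace_zero_iff_volterra {z₀ : ℝ} (h₀ : z₀ ∈ Set.Icc (-D.ξ) D.d)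
    (f g : Lp ℂ 2 (D.cylMeas ν)) :
    D.HasTrace ν f g z₀ 0 ↔ volterra z₀ h₀ g = f :=
  hasTrace_zero_iff h₀ f g

theorem intervalIntegrable_of_zMeas {g : ℝ → ℂ} (hg : Integrable g D.zMeas) :
    IntervalIntegrable g volume (-D.ξ) D.d := by
  rw [intervalIntegrable_iff_integrableOn_Ioo_of_le D.ξ_lt.le]
  exact hg

/-- The derivative of the zero function vanishes. -/
theorem IsZDeriv.eq_zero {g : Lp ℂ 2 (D.cylMeas ν)}
    (h : D.IsZDeriv ν (0 : Lp ℂ 2 (D.cylMeas ν)) g) : g = 0 := by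
  obtain ⟨a, ha⟩ := h
  rw [Lp.ext_iff]
  have h0 := Lp.coeFn_zero ℂ 2 (D.cylMeas ν)
  suffices hs : ∀ᵐ w ∂D.cylMeas ν, g w = 0 by
    filter_upwards [hs, h0] with w h1 h2
    rw [h1, h2, Pi.zero_apply]
  refine ae_cyl_of_ae_ae ((Lp.stronglyMeasurable g).measurableSet_eq_fun
    stronglyMeasurable_const) ?_
  filter_upwards [ha, ae_slice h0, integrable_slice g] with κ h1 h2 hi
  have hii := intervalIntegrable_of_zMeas hi
  have hc : ContinuousOn (fun z => ∫ t in -D.ξ..z, g (κ, t)) (Set.Ioo (-D.ξ) D.d) :=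
    (intervalIntegral.continuousOn_primitive_interval
      (by rw [Set.uIcc_of_le D.ξ_lt.le]
          exact (intervalIntegrable_iff_integrableOn_Icc_of_le D.ξ_lt.le).1 hii)).mono
      (fun z hz => by rw [Set.uIcc_of_le D.ξ_lt.le]; exact Set.Ioo_subset_Icc_self hz)
  -- The trace identity gives this only almost everywhere; continuity of the primitive extends it to
  -- the open interval.
  have hconst : ∀ z ∈ Set.Ioo (-D.ξ) D.d, ∫ t in -D.ξ..z, g (κ, t) = -a κ := by
    refine Measure.eqOn_open_of_ae_eq (μ := volume) ?_ isOpen_Ioo hc continuousOn_const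
    change ∀ᵐ z ∂D.zMeas, _
    filter_upwards [h1, h2] with z h3 h4
    rw [h4] at h3
    simp only [Pi.zero_apply] at h3
    linear_combination -h3
  -- Lebesgue differentiation recovers g as the derivative of a primitive that is constant.
  have hd := hii.ae_hasDerivAt_integral
  have hd' : ∀ᵐ z ∂D.zMeas, z ∈ Set.uIcc (-D.ξ) D.d → ∀ c ∈ Set.uIcc (-D.ξ) D.d,
      HasDerivAt (fun x => ∫ t in c..x, g (κ, t)) (g (κ, z)) z := ae_restrict_of_ae hd
  filter_upwards [hd', zMem] with z h3 hz
  have h4 := h3 (by rw [Set.uIcc_of_le D.ξ_lt.le]; exact Set.Ioo_subset_Icc_self hz) (-D.ξ)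
    Set.left_mem_uIcc
  have h5 : HasDerivAt (fun _ : ℝ => -a κ) (g (κ, z)) z :=
    h4.congr_of_eventuallyEq (by
      filter_upwards [isOpen_Ioo.mem_nhds hz] with y hy using (hconst y hy).symm)
  exact h5.unique (hasDerivAt_const z _)

end Config

end Convexification

namespace Convexification

open scoped ENNReal

theorem norm_le_sqrt_mul_of_enorm_sq_le {E F : Type*} [NormedAddCommGroup E]
    [NormedAddCommGroup F] {x : E} {y : F} {c : ℝ} (hc : 0 ≤ c)
    (h : ‖x‖ₑ ^ 2 ≤ ENNReal.ofReal c * ‖y‖ₑ ^ 2) : ‖x‖ ≤ √c * ‖y‖ := by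
  rw [← ofReal_norm, ← ofReal_norm, ← ENNReal.ofReal_pow (norm_nonneg _),
    ← ENNReal.ofReal_pow (norm_nonneg _), ← ENNReal.ofReal_mul hc,
    ENNReal.ofReal_le_ofReal_iff (by positivity)] at h
  refine abs_le_of_sq_le_sq' ?_ (by positivity) |>.2
  rwa [mul_pow, Real.sq_sqrt hc]

theorem ENNReal_add_sq_le (a b : ℝ≥0∞) : (a + b) ^ 2 ≤ 2 * (a ^ 2 + b ^ 2) := by
  rcases eq_or_ne a ∞ with rfl | ha
  · simp
  rcases eq_or_ne b ∞ with rfl | hb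
  · simp
  lift a to NNReal using ha
  lift b to NNReal using hb
  have h : (a + b) ^ 2 ≤ 2 * (a ^ 2 + b ^ 2) := by
    rw [← NNReal.coe_le_coe]
    push_cast
    exact add_sq_le
  exact_mod_cast h

/-! ### Multiplication by bounded functions. -/

section Multiplication

variable {α : Type*} [MeasurableSpace α] {μ : Measure α}

/-- Multiplication of a function in `L^q` by a bounded function. -/
noncomputable def mulLp (μ : Measure α) (q : ℝ≥0∞) [Fact (1 ≤ q)] :
    Lp ℂ ∞ μ →L[ℝ] Lp ℂ q μ →L[ℝ] Lp ℂ q μ :=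
  (ContinuousLinearMap.mul ℝ ℂ).holderL μ ∞ q q

variable {q : ℝ≥0∞} [Fact (1 ≤ q)]

theorem mulLp_coe (f : Lp ℂ ∞ μ) (g : Lp ℂ q μ) : mulLp μ q f g =ᵐ[μ] fun x => f x * g x :=
  (ContinuousLinearMap.mul ℝ ℂ).coeFn_holder f g

theorem norm_mulLp_le (f : Lp ℂ ∞ μ) (g : Lp ℂ q μ) : ‖mulLp μ q f g‖ ≤ ‖f‖ * ‖g‖ := by
  refine ((ContinuousLinearMap.mul ℝ ℂ).norm_holder_apply_apply_le f g).trans ?_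
  have := ContinuousLinearMap.opNorm_mul_le ℝ ℂ
  calc _ ≤ 1 * ‖f‖ * ‖g‖ := by gcongr
    _ = _ := by ring

/-- Together with `mulLp_comm` this lets the weight be placed on either factor of a product. -/
theorem mulLp_mulLp (f g : Lp ℂ ∞ μ) (u : Lp ℂ q μ) :
    mulLp μ q f (mulLp μ q g u) = mulLp μ q (mulLp μ ∞ f g) u := by
  rw [Lp.ext_iff]
  filter_upwards [mulLp_coe f (mulLp μ q g u), mulLp_coe g u,
    mulLp_coe (mulLp μ ∞ f g) u, mulLp_coe f g] with x h1 h2 h3 h4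
  rw [h1, h2, h3, h4, mul_assoc]

theorem mulLp_comm (f g : Lp ℂ ∞ μ) (u : Lp ℂ q μ) :
    mulLp μ q f (mulLp μ q g u) = mulLp μ q g (mulLp μ q f u) := by
  rw [Lp.ext_iff]
  filter_upwards [mulLp_coe f (mulLp μ q g u), mulLp_coe g u,
    mulLp_coe g (mulLp μ q f u), mulLp_coe f u] with x h1 h2 h3 h4
  rw [h1, h2, h3, h4, mul_left_comm]

end Multiplication

/-! ### Weighted and Sobolev estimates in the variable z. -/

namespace Config

variable {D : Config} {K : Type} [MeasurableSpace K] {ν : Measure K} [IsFiniteMeasure ν]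

theorem wt_bound (ν : Measure K) [IsFiniteMeasure ν] (lam : ℝ) :
    ∀ᵐ w ∂D.cylMeas ν, ‖D.wt lam w.2‖ ≤ Real.exp (|lam| * D.len) := by
  filter_upwards [ae_cyl_snd (ν := ν) (zMem (D := D))] with w hw using norm_wt_le lam hw

theorem memLp_wt (ν : Measure K) [IsFiniteMeasure ν] (lam : ℝ) :
    MemLp (fun w : K × ℝ => D.wt lam w.2) ∞ (D.cylMeas ν) :=
  memLp_top_of_bound ((measurable_wt lam).comp measurable_snd).aestronglyMeasurable _
    (wt_bound ν lam)

/-- The weight `e^{λ (d - z)}` as a bounded function. -/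
noncomputable def wtInf (D : Config) (ν : Measure K) [IsFiniteMeasure ν] (lam : ℝ) :
    Lp ℂ ∞ (D.cylMeas ν) :=
  (memLp_wt ν lam).toLp

theorem norm_toLp_top_le {μ : Measure (K × ℝ)} {f : K × ℝ → ℂ} (hf : MemLp f ∞ μ) {C : ℝ}
    (hC : 0 ≤ C) (h : ∀ᵐ w ∂μ, ‖f w‖ ≤ C) : ‖hf.toLp f‖ ≤ C := by
  rw [Lp.norm_toLp, eLpNorm_exponent_top]
  exact ENNReal.toReal_le_of_le_ofReal hC (eLpNormEssSup_le_of_ae_bound h)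

theorem norm_wtInf_le (lam : ℝ) : ‖D.wtInf ν lam‖ ≤ Real.exp (|lam| * D.len) :=
  norm_toLp_top_le _ (Real.exp_pos _).le (wt_bound ν lam)

/-- Multiplication by the weight `e^{λ (d - z)}`. -/
noncomputable def carl (D : Config) (ν : Measure K) [IsFiniteMeasure ν] (q : ℝ≥0∞) [Fact (1 ≤ q)]
    (lam : ℝ) : Lp ℂ q (D.cylMeas ν) →L[ℝ] Lp ℂ q (D.cylMeas ν) :=
  mulLp (D.cylMeas ν) q (D.wtInf ν lam)

section

variable {q : ℝ≥0∞} [Fact (1 ≤ q)]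

theorem carl_coe (lam : ℝ) (f : Lp ℂ q (D.cylMeas ν)) :
    ∀ᵐ w ∂D.cylMeas ν, D.carl ν q lam f w = D.wt lam w.2 * f w := by
  filter_upwards [mulLp_coe (D.wtInf ν lam) f, (memLp_wt (D := D) ν lam).coeFn_toLp] with w h1 h2
  rw [carl, h1, wtInf, h2]

theorem norm_carl_le (lam : ℝ) (f : Lp ℂ q (D.cylMeas ν)) :
    ‖D.carl ν q lam f‖ ≤ Real.exp (|lam| * D.len) * ‖f‖ :=
  (norm_mulLp_le _ _).trans (mul_le_mul_of_nonneg_right (norm_wtInf_le lam) (norm_nonneg _))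

/-- The normalizing factor e^{2λd} of the functionals makes the weight at least 1 for z < d, so
weighted bounds imply unweighted ones. -/
theorem norm_le_norm_carl {lam : ℝ} (hl : 0 ≤ lam) (f : Lp ℂ q (D.cylMeas ν)) :
    ‖f‖ ≤ ‖D.carl ν q lam f‖ := by
  refine Lp.norm_le_norm_of_ae_le ?_
  filter_upwards [carl_coe lam f, ae_cyl_snd (ν := ν) (zMem (D := D))] with w h1 h2
  rw [h1, norm_mul]
  exact le_mul_of_one_le_left (norm_nonneg _) (one_le_norm_wt hl h2)

end

/-- The weight is real. Hence in an inner product both copies of it can be put on the same side. -/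
theorem inner_carl (lam : ℝ) (f g : Lp ℂ 2 (D.cylMeas ν)) :
    inner ℝ (D.carl ν 2 lam f) g = inner ℝ f (D.carl ν 2 lam g) := by
  rw [L2.inner_def, L2.inner_def]
  refine integral_congr_ae ?_
  filter_upwards [carl_coe lam f, carl_coe lam g] with w h1 h2
  simp only [h1, h2, Complex.inner, wt, map_mul, Complex.conj_ofReal]
  congr 1
  ring

/-- The Carleman estimate for one integration in `z`. -/
theorem carl_slice_le {f g : Lp ℂ 2 (D.cylMeas ν)} (h : D.HasTrace ν f g (-D.ξ) 0)
    {lam : ℝ} (hl : 0 < lam) :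
    ∀ᵐ κ ∂ν, ∀ᵐ z ∂D.zMeas, ‖D.carl ν 2 lam f (κ, z)‖ₑ ^ 2
      ≤ ENNReal.ofReal (1 / (2 * lam)) * ∫⁻ t, ‖D.carl ν 2 lam g (κ, t)‖ₑ ^ 2 ∂D.zMeas := by
  filter_upwards [h, ae_slice (carl_coe lam f), ae_slice (carl_coe lam g)] with κ h1 h2 h3
  have e : ∫⁻ t, ‖D.carl ν 2 lam g (κ, t)‖ₑ ^ 2 ∂D.zMeas
      = ∫⁻ t, ‖D.wt lam t * g (κ, t)‖ₑ ^ 2 ∂D.zMeas := by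
    refine lintegral_congr_ae ?_
    filter_upwards [h3] with t ht
    rw [ht]
  filter_upwards [h1, h2, zMem] with z h4 h5 hz
  rw [h5, h4, e, Pi.zero_apply, zero_add]
  exact enorm_wt_mul_integral_sq_le hl (stronglyMeasurable_slice g κ) hz

/-- A bound for `f` uniform in `z` gives a bound in `L²`. -/
theorem enorm_sq_le_of_slice {f : Lp ℂ 2 (D.cylMeas ν)} {σ : K → ℝ≥0∞}
    (h : ∀ᵐ κ ∂ν, ∀ᵐ z ∂D.zMeas, ‖f (κ, z)‖ₑ ^ 2 ≤ σ κ) :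
    ‖f‖ₑ ^ 2 ≤ ENNReal.ofReal (D.h ^ 2) * ∫⁻ κ, σ κ * ENNReal.ofReal D.len ∂ν := by
  rw [enorm_sq_eq]
  refine mul_le_mul' le_rfl (lintegral_mono_ae ?_)
  filter_upwards [h] with κ hκ
  refine (lintegral_mono_ae hκ).trans ?_
  rw [lintegral_const, zMeas_univ]

/-- The bound of `carl_slice_le` does not depend on z, so integrating it over z costs only the
length of the interval. -/
theorem norm_carl_le_of_hasTrace {f g : Lp ℂ 2 (D.cylMeas ν)} (h : D.HasTrace ν f g (-D.ξ) 0)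
    {lam : ℝ} (hl : 0 < lam) :
    ‖D.carl ν 2 lam f‖ ≤ √(D.len / (2 * lam)) * ‖D.carl ν 2 lam g‖ := by
  have hlen := len_pos (D := D)
  refine norm_le_sqrt_mul_of_enorm_sq_le (by positivity)
    ((enorm_sq_le_of_slice (carl_slice_le h hl)).trans (le_of_eq ?_))
  rw [lintegral_mul_const _ ((measurable_slice_lintegral _).const_mul _),
    lintegral_const_mul _ (measurable_slice_lintegral _), enorm_sq_eq (D.carl ν 2 lam g),
    div_eq_mul_one_div D.len, ENNReal.ofReal_mul hlen.le]
  ring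

/-- The Sobolev inequality on the interval `(-ξ, d)`. -/
theorem sobolev_slice {f g : Lp ℂ 2 (D.cylMeas ν)} (h : D.IsZDeriv ν f g) :
    ∀ᵐ κ ∂ν, ∀ᵐ z ∂D.zMeas, ‖f (κ, z)‖ₑ ^ 2
      ≤ ENNReal.ofReal (2 / D.len) * (∫⁻ t, ‖f (κ, t)‖ₑ ^ 2 ∂D.zMeas)
        + ENNReal.ofReal (2 * D.len) * ∫⁻ t, ‖g (κ, t)‖ₑ ^ 2 ∂D.zMeas := by
  have hlen := len_pos (D := D)
  obtain ⟨a, ha⟩ := h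
  filter_upwards [ha, integrable_slice g] with κ h1 hi
  have hii := intervalIntegrable_of_zMeas hi
  have hsub : ∀ z ∈ Set.Ioo (-D.ξ) D.d,
      IntervalIntegrable (fun t => g (κ, t)) volume (-D.ξ) z := fun z hz =>
    hii.mono_set (by
      rw [Set.uIcc_of_le hz.1.le, Set.uIcc_of_le D.ξ_lt.le]
      exact Set.Icc_subset_Icc_right hz.2.le)
  filter_upwards [h1, zMem] with z hz hzm
  set S := ∫⁻ t, ‖f (κ, t)‖ₑ ^ 2 ∂D.zMeas
  set T := ∫⁻ t, ‖g (κ, t)‖ₑ ^ 2 ∂D.zMeas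
  -- The value at z is compared with the value at an arbitrary t. Averaging over t then removes the
  -- unknown trace.
  have hpt : ∀ᵐ t ∂D.zMeas, ‖f (κ, z)‖ₑ ^ 2
      ≤ 2 * ‖f (κ, t)‖ₑ ^ 2 + 2 * (ENNReal.ofReal D.len * T) := by
    filter_upwards [h1, zMem] with t ht htm
    have e : f (κ, z) = f (κ, t) + ∫ s in t..z, g (κ, s) := by
      rw [hz, ht, add_assoc,
        intervalIntegral.integral_add_adjacent_intervals (hsub t htm)
          ((hsub t htm).symm.trans (hsub z hzm))]
    calc ‖f (κ, z)‖ₑ ^ 2 ≤ (‖f (κ, t)‖ₑ + ‖∫ s in t..z, g (κ, s)‖ₑ) ^ 2 := by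
          rw [e]
          gcongr
          exact enorm_add_le _ _
      _ ≤ 2 * (‖f (κ, t)‖ₑ ^ 2 + ‖∫ s in t..z, g (κ, s)‖ₑ ^ 2) := ENNReal_add_sq_le _ _
      _ ≤ _ := by
          rw [mul_add]
          gcongr
          exact enorm_intervalIntegral_sq_le (stronglyMeasurable_slice g κ)
            (Set.Ioo_subset_Icc_self htm) hzm
  have hint := lintegral_mono_ae hpt
  have hmeas : Measurable fun t => ‖f (κ, t)‖ₑ ^ 2 :=
    (stronglyMeasurable_slice f κ).enorm.pow_const 2
  rw [lintegral_add_right _ measurable_const, lintegral_const_mul _ hmeas, lintegral_const,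
    lintegral_const, zMeas_univ] at hint
  have hl0 : ENNReal.ofReal D.len ≠ 0 := by simpa using hlen
  rw [ENNReal.ofReal_div_of_pos hlen, ENNReal.ofReal_mul zero_le_two, ENNReal.ofReal_ofNat]
  calc ‖f (κ, z)‖ₑ ^ 2
      = (‖f (κ, z)‖ₑ ^ 2 * ENNReal.ofReal D.len) * (ENNReal.ofReal D.len)⁻¹ := by
        rw [mul_assoc, ENNReal.mul_inv_cancel hl0 ENNReal.ofReal_ne_top, mul_one]
    _ ≤ (2 * S + 2 * (ENNReal.ofReal D.len * T) * ENNReal.ofReal D.len)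
        * (ENNReal.ofReal D.len)⁻¹ := by gcongr
    _ = 2 / ENNReal.ofReal D.len * S + 2 * (ENNReal.ofReal D.len * T)
        * (ENNReal.ofReal D.len * (ENNReal.ofReal D.len)⁻¹) := by
        rw [div_eq_mul_inv]
        ring
    _ = _ := by
        rw [ENNReal.mul_inv_cancel hl0 ENNReal.ofReal_ne_top]
        ring

/-! ### Integration over the wave numbers -/

theorem enorm_integral_k_sq_le (f : Lp ℂ 2 (D.cylMeas D.kMeas)) {k : ℝ}
    (hk : k ∈ Set.Icc D.kmin D.kmax) (z : ℝ) :
    ‖∫ κ in k..D.kmax, f (κ, z)‖ₑ ^ 2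
      ≤ ENNReal.ofReal (D.kmax - D.kmin) * ∫⁻ κ, ‖f (κ, z)‖ₑ ^ 2 ∂D.kMeas := by
  have hsub : volume.restrict (Set.uIoc k D.kmax) ≤ D.kMeas := by
    rw [kMeas, restrict_Ioo_eq_restrict_Ioc, Set.uIoc_of_le hk.2]
    exact Measure.restrict_mono (Set.Ioc_subset_Ioc_left hk.1) le_rfl
  have h1 : ‖∫ κ in k..D.kmax, f (κ, z)‖ₑ ≤ ∫⁻ κ, 1 * ‖f (κ, z)‖ₑ ∂D.kMeas := by
    simpa using enorm_intervalIntegral_le.trans (lintegral_mono' hsub le_rfl)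
  calc _ ≤ (∫⁻ κ, 1 * ‖f (κ, z)‖ₑ ∂D.kMeas) ^ 2 := by gcongr
    _ ≤ _ := sq_lintegral_mul_le _ (by fun_prop) (stronglyMeasurable_slice_swap f z).enorm.aemeasurable
    _ = _ := by simp [kMeas_univ]

/-- A slice bound uniform in z survives Cauchy–Schwarz in κ. The result is uniform in z and in k,
with one null set of z serving all k. -/
theorem enorm_integral_k_sq_le_of_slice {f : Lp ℂ 2 (D.cylMeas D.kMeas)} {σ : ℝ → ℝ≥0∞}
    (hσ : Measurable σ) (h : ∀ᵐ κ ∂D.kMeas, ∀ᵐ z ∂D.zMeas, ‖f (κ, z)‖ₑ ^ 2 ≤ σ κ) :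
    ∀ᵐ z ∂D.zMeas, ∀ k ∈ Set.Icc D.kmin D.kmax, ‖∫ κ in k..D.kmax, f (κ, z)‖ₑ ^ 2
      ≤ ENNReal.ofReal (D.kmax - D.kmin) * ∫⁻ κ, σ κ ∂D.kMeas := by
  have h1 := ae_slice_swap (ae_cyl_of_ae_ae
    (measurableSet_le (measurable_enorm_sq f) (hσ.comp measurable_fst)) h)
  filter_upwards [h1] with z hz k hk
  exact (enorm_integral_k_sq_le f hk z).trans (mul_le_mul' le_rfl (lintegral_mono_ae hz))

/-- A uniform bound, not one in L²: the weighted ∇^h v is a factor in products and has to be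
controlled as a bounded function without losing the gain λ^{-1/2}. -/
theorem norm_integral_k_carl_le {f g : Lp ℂ 2 (D.cylMeas D.kMeas)}
    (h : D.HasTrace D.kMeas f g (-D.ξ) 0) {lam : ℝ} (hl : 0 < lam) :
    ∀ᵐ z ∂D.zMeas, ∀ k ∈ Set.Icc D.kmin D.kmax,
      ‖∫ κ in k..D.kmax, D.carl D.kMeas 2 lam f (κ, z)‖
        ≤ √((D.kmax - D.kmin) / D.h ^ 2 / (2 * lam)) * ‖D.carl D.kMeas 2 lam g‖ := by
  have hh := h_pos (D := D)
  have hK : 0 < D.kmax - D.kmin := sub_pos.2 D.k_lt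
  filter_upwards [enorm_integral_k_sq_le_of_slice
    ((measurable_slice_lintegral _).const_mul _) (carl_slice_le h hl)] with z hz k hk
  refine norm_le_sqrt_mul_of_enorm_sq_le (by positivity) ((hz k hk).trans (le_of_eq ?_))
  rw [lintegral_const_mul _ (measurable_slice_lintegral _), lintegral_lintegral_eq,
    div_eq_mul_one_div (_ / _), div_eq_mul_inv (_ - _), ENNReal.ofReal_mul (by positivity),
    ENNReal.ofReal_mul hK.le, ENNReal.ofReal_inv_of_pos (by positivity)]
  ring

theorem norm_le_mul_add_of_enorm_sq_le {E F G : Type*} [NormedAddCommGroup E]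
    [NormedAddCommGroup F] [NormedAddCommGroup G] {x : E} {y : F} {z : G} {c c' : ℝ} (hc : 0 ≤ c)
    (hc' : 0 ≤ c') (h : ‖x‖ₑ ^ 2 ≤ ENNReal.ofReal c * ‖y‖ₑ ^ 2 + ENNReal.ofReal c' * ‖z‖ₑ ^ 2) :
    ‖x‖ ≤ √c * ‖y‖ + √c' * ‖z‖ := by
  rw [← ofReal_norm, ← ofReal_norm, ← ofReal_norm, ← ENNReal.ofReal_pow (norm_nonneg _),
    ← ENNReal.ofReal_pow (norm_nonneg _), ← ENNReal.ofReal_pow (norm_nonneg _),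
    ← ENNReal.ofReal_mul hc, ← ENNReal.ofReal_mul hc', ← ENNReal.ofReal_add (by positivity)
      (by positivity), ENNReal.ofReal_le_ofReal_iff (by positivity)] at h
  refine abs_le_of_sq_le_sq' ?_ (by positivity) |>.2
  have h1 : 0 ≤ (√c * ‖y‖) * (√c' * ‖z‖) := by positivity
  rw [add_sq, mul_pow, mul_pow, Real.sq_sqrt hc, Real.sq_sqrt hc']
  linarith

/-- The constant of the Sobolev inequalities. -/
noncomputable def sobC (D : Config) : ℝ :=
  √((D.kmax - D.kmin + 1) * (2 / D.len) / D.h ^ 2)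
    + √((D.kmax - D.kmin + 1) * (2 * D.len) / D.h ^ 2)

theorem sobC_nonneg : 0 ≤ D.sobC := by
  unfold sobC
  positivity

/-- The parameter c is `kmax - kmin` for integrals of q over the wave numbers and 1 for V, which
does not depend on k; `sobC` covers both. The inverse of h² undoes the grid factor of `cylMeas`. -/
theorem norm_le_sobC {E F G : Type*} [NormedAddCommGroup E]
    [NormedAddCommGroup F] [NormedAddCommGroup G] {x : E} {y : F} {z : G} {c : ℝ}
    (hc' : c ≤ D.kmax - D.kmin + 1)
    (h : ‖x‖ₑ ^ 2 ≤ ENNReal.ofReal c *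
      (ENNReal.ofReal (2 / D.len) * ((ENNReal.ofReal (D.h ^ 2))⁻¹ * ‖y‖ₑ ^ 2)
        + ENNReal.ofReal (2 * D.len) * ((ENNReal.ofReal (D.h ^ 2))⁻¹ * ‖z‖ₑ ^ 2))) :
    ‖x‖ ≤ D.sobC * (‖y‖ + ‖z‖) := by
  have hlen := len_pos (D := D)
  have hh := h_pos (D := D)
  have hK : 0 < D.kmax - D.kmin := sub_pos.2 D.k_lt
  have h1 := norm_le_mul_add_of_enorm_sq_le (x := x) (y := y) (z := z)
    (c := (D.kmax - D.kmin + 1) * (2 / D.len) / D.h ^ 2)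
    (c' := (D.kmax - D.kmin + 1) * (2 * D.len) / D.h ^ 2)
    (by positivity) (by positivity) (h.trans (by
      have e : ∀ b : ℝ, 0 ≤ b → ENNReal.ofReal ((D.kmax - D.kmin + 1) * b / D.h ^ 2)
          = ENNReal.ofReal (D.kmax - D.kmin + 1) *
            (ENNReal.ofReal b * (ENNReal.ofReal (D.h ^ 2))⁻¹) := fun b hb => by
        rw [div_eq_mul_inv, ENNReal.ofReal_mul (by positivity), ENNReal.ofReal_mul (by positivity),
          ENNReal.ofReal_inv_of_pos (by positivity), mul_assoc]
      rw [e _ (by positivity), e _ (by positivity), mul_add]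
      simp only [mul_assoc]
      gcongr))
  unfold sobC
  refine h1.trans ?_
  have a1 := mul_nonneg (Real.sqrt_nonneg ((D.kmax - D.kmin + 1) * (2 / D.len) / D.h ^ 2))
    (norm_nonneg z)
  have a2 := mul_nonneg (Real.sqrt_nonneg ((D.kmax - D.kmin + 1) * (2 * D.len) / D.h ^ 2))
    (norm_nonneg y)
  linear_combination a1 + a2

theorem norm_integral_k_le {f g : Lp ℂ 2 (D.cylMeas D.kMeas)} (h : D.IsZDeriv D.kMeas f g) :
    ∀ᵐ z ∂D.zMeas, ∀ k ∈ Set.Icc D.kmin D.kmax,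
      ‖∫ κ in k..D.kmax, f (κ, z)‖ ≤ D.sobC * (‖f‖ + ‖g‖) := by
  have hK : 0 < D.kmax - D.kmin := sub_pos.2 D.k_lt
  filter_upwards [enorm_integral_k_sq_le_of_slice
    (((measurable_slice_lintegral _).const_mul _).add ((measurable_slice_lintegral _).const_mul _))
    (sobolev_slice h)] with z hz k hk
  refine norm_le_sobC (c := D.kmax - D.kmin) (by linarith) ((hz k hk).trans (le_of_eq ?_))
  simp only [Pi.add_apply]
  rw [lintegral_add_left ((measurable_slice_lintegral _).const_mul _),
    lintegral_const_mul _ (measurable_slice_lintegral _),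
    lintegral_const_mul _ (measurable_slice_lintegral _), lintegral_lintegral_eq,
    lintegral_lintegral_eq]

theorem ae_unit {p : Unit → Prop} (h : ∀ᵐ κ ∂unitMeas, p κ) : p () := by
  simpa [unitMeas, ae_dirac_eq] using h

theorem lintegral_unit (u : Lp ℂ 2 (D.cylMeas unitMeas)) :
    ∫⁻ z, ‖u ((), z)‖ₑ ^ 2 ∂D.zMeas = (ENNReal.ofReal (D.h ^ 2))⁻¹ * ‖u‖ₑ ^ 2 := by
  rw [← lintegral_lintegral_eq]
  exact (lintegral_dirac () fun κ : Unit => ∫⁻ z, ‖u (κ, z)‖ₑ ^ 2 ∂D.zMeas).symm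

theorem norm_unit_le {f g : Lp ℂ 2 (D.cylMeas unitMeas)} (h : D.IsZDeriv unitMeas f g) :
    ∀ᵐ z ∂D.zMeas, ‖f ((), z)‖ ≤ D.sobC * (‖f‖ + ‖g‖) := by
  have hK : 0 < D.kmax - D.kmin := sub_pos.2 D.k_lt
  filter_upwards [ae_unit (sobolev_slice h)] with z hz
  refine norm_le_sobC (c := 1) (by linarith) ?_
  rw [ENNReal.ofReal_one, one_mul]
  rwa [lintegral_unit, lintegral_unit] at hz

end Config

end Convexification

namespace Convexification

open scoped ENNReal

/-! ### Difference operators on jets. -/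

namespace Config

variable {D : Config} {K : Type} [MeasurableSpace K] {ν : Measure K}

theorem node_cases (n : D.Node) : IsLateral n ∨ ∃ i : D.Inner, n = ctr i := by
  by_cases hn : IsLateral n
  · exact Or.inl hn
  right
  have key : ∀ a : Fin (D.N + 2), a ≠ 0 → a ≠ Fin.last _ →
      ∃ j : Fin D.N, a = j.succ.castSucc := by
    intro a h0 h1
    obtain ⟨b, rfl⟩ := Fin.exists_castSucc_eq.2 h1
    have hb : b ≠ 0 := by
      rintro rfl
      exact h0 rfl
    obtain ⟨j, rfl⟩ := Fin.exists_succ_eq.2 hb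
    exact ⟨j, rfl⟩
  simp only [IsLateral, not_or] at hn
  obtain ⟨j, hj⟩ := key n.1 hn.1 hn.2.1
  obtain ⟨s, hs⟩ := key n.2 hn.2.2.1 hn.2.2.2
  exact ⟨(j, s), Prod.ext hj hs⟩

/-- The component `∂_z^r u` at a node. -/
noncomputable def ev {m : ℕ} (ν : Measure K) (n : D.Node) (r : Fin (m + 1)) :
    D.Jet m ν →L[ℝ] Lp ℂ 2 (D.cylMeas ν) :=
  PiLp.proj 2 (fun _ : D.Node × Fin (m + 1) => Lp ℂ 2 (D.cylMeas ν)) (n, r)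

@[simp]
theorem ev_apply {m : ℕ} (n : D.Node) (r : Fin (m + 1)) (u : D.Jet m ν) :
    ev ν n r u = u (n, r) := rfl

theorem norm_ev_le {m : ℕ} (n : D.Node) (r : Fin (m + 1)) (u : D.Jet m ν) :
    ‖u (n, r)‖ ≤ ‖u‖ :=
  PiLp.norm_apply_le u (n, r)

/-- The part of the Laplacian without `z`-derivatives. -/
noncomputable def lapLow (ν : Measure K) (i : D.Inner) : D.Jet 2 ν →L[ℝ] Lp ℂ 2 (D.cylMeas ν) :=
  (D.h ^ 2)⁻¹ • (ev ν (xMinus i) 0 - (2 : ℝ) • ev ν (ctr i) 0 + ev ν (xPlus i) 0)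
    + (D.h ^ 2)⁻¹ • (ev ν (yMinus i) 0 - (2 : ℝ) • ev ν (ctr i) 0 + ev ν (yPlus i) 0)

/-- The discrete Laplacian as a bounded operator. -/
noncomputable def lapL (ν : Measure K) (i : D.Inner) : D.Jet 2 ν →L[ℝ] Lp ℂ 2 (D.cylMeas ν) :=
  ev ν (ctr i) 2 + lapLow ν i

/-- The discrete gradient as a bounded operator. -/
noncomputable def gradL (ν : Measure K) (i : D.Inner) :
    Fin 3 → (D.Jet 2 ν →L[ℝ] Lp ℂ 2 (D.cylMeas ν)) :=
  ![(2 * D.h)⁻¹ • (ev ν (xPlus i) 0 - ev ν (xMinus i) 0),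
    (2 * D.h)⁻¹ • (ev ν (yPlus i) 0 - ev ν (yMinus i) 0), ev ν (ctr i) 1]

/-- The `z`-derivative of the discrete gradient. -/
noncomputable def gradLz (ν : Measure K) (i : D.Inner) :
    Fin 3 → (D.Jet 2 ν →L[ℝ] Lp ℂ 2 (D.cylMeas ν)) :=
  ![(2 * D.h)⁻¹ • (ev ν (xPlus i) 1 - ev ν (xMinus i) 1),
    (2 * D.h)⁻¹ • (ev ν (yPlus i) 1 - ev ν (yMinus i) 1), ev ν (ctr i) 2]

theorem coe_diff (c : ℝ) (f g : Lp ℂ 2 (D.cylMeas ν)) :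
    ∀ᵐ w ∂D.cylMeas ν, (c • (f - g) : Lp ℂ 2 (D.cylMeas ν)) w = (f w - g w) * c := by
  filter_upwards [Lp.coeFn_smul c (f - g), Lp.coeFn_sub f g] with w h1 h2
  rw [h1, Pi.smul_apply, h2, Pi.sub_apply, Complex.real_smul, mul_comm]

theorem coe_second_diff (c : ℝ) (f g k : Lp ℂ 2 (D.cylMeas ν)) :
    ∀ᵐ w ∂D.cylMeas ν, (c • (f - (2 : ℝ) • g + k) : Lp ℂ 2 (D.cylMeas ν)) w
      = (f w - 2 * g w + k w) * c := by
  filter_upwards [Lp.coeFn_smul c (f - (2 : ℝ) • g + k), Lp.coeFn_add (f - (2 : ℝ) • g) k,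
    Lp.coeFn_sub f ((2 : ℝ) • g), Lp.coeFn_smul (2 : ℝ) g] with w h1 h2 h3 h4
  rw [h1, Pi.smul_apply, h2, Pi.add_apply, h3, Pi.sub_apply, h4, Pi.smul_apply, Complex.real_smul,
    Complex.real_smul, mul_comm]
  push_cast
  ring

theorem lapL_coe (i : D.Inner) (u : D.Jet 2 ν) :
    ∀ᵐ w ∂D.cylMeas ν, lapL ν i u w = lapH u i w := by
  have e : lapL ν i u = u (ctr i, 2) +
    ((D.h ^ 2)⁻¹ • (u (xMinus i, 0) - (2 : ℝ) • u (ctr i, 0) + u (xPlus i, 0))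
      + (D.h ^ 2)⁻¹ • (u (yMinus i, 0) - (2 : ℝ) • u (ctr i, 0) + u (yPlus i, 0))) := rfl
  rw [e]
  filter_upwards [Lp.coeFn_add (u (ctr i, 2))
    ((D.h ^ 2)⁻¹ • (u (xMinus i, 0) - (2 : ℝ) • u (ctr i, 0) + u (xPlus i, 0))
      + (D.h ^ 2)⁻¹ • (u (yMinus i, 0) - (2 : ℝ) • u (ctr i, 0) + u (yPlus i, 0))),
    Lp.coeFn_add ((D.h ^ 2)⁻¹ • (u (xMinus i, 0) - (2 : ℝ) • u (ctr i, 0) + u (xPlus i, 0)))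
      ((D.h ^ 2)⁻¹ • (u (yMinus i, 0) - (2 : ℝ) • u (ctr i, 0) + u (yPlus i, 0))),
    coe_second_diff (D.h ^ 2)⁻¹ (u (xMinus i, 0)) (u (ctr i, 0)) (u (xPlus i, 0)),
    coe_second_diff (D.h ^ 2)⁻¹ (u (yMinus i, 0)) (u (ctr i, 0)) (u (yPlus i, 0))]
    with w h1 h2 h3 h4
  rw [h1, Pi.add_apply, h2, Pi.add_apply, h3, h4, lapH]
  push_cast
  ring

theorem gradL_coe (i : D.Inner) (u : D.Jet 2 ν) (m : Fin 3) :
    ∀ᵐ w ∂D.cylMeas ν, gradL ν i m u w = gradH u i w m := by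
  fin_cases m
  · filter_upwards [coe_diff (2 * D.h)⁻¹ (u (xPlus i, 0)) (u (xMinus i, 0))] with w h1
    refine h1.trans ?_
    simp [gradH, div_eq_mul_inv]
  · filter_upwards [coe_diff (2 * D.h)⁻¹ (u (yPlus i, 0)) (u (yMinus i, 0))] with w h1
    refine h1.trans ?_
    simp [gradH, div_eq_mul_inv]
  · exact Filter.Eventually.of_forall fun w => rfl

/-- A bound for the coefficients of the difference operators. -/
noncomputable def gridC (D : Config) : ℝ := 1 + D.h⁻¹ + 8 * (D.h ^ 2)⁻¹

theorem one_le_gridC : 1 ≤ D.gridC := by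
  have := h_pos (D := D)
  have h1 : 0 < D.h⁻¹ := by positivity
  have h2 : 0 < (D.h ^ 2)⁻¹ := by positivity
  unfold gridC
  linarith

theorem norm_second_diff_le {E : Type*} [NormedAddCommGroup E] [NormedSpace ℝ E] {f g k : E}
    {M : ℝ} (hf : ‖f‖ ≤ M) (hg : ‖g‖ ≤ M) (hk : ‖k‖ ≤ M) :
    ‖(D.h ^ 2)⁻¹ • (f - (2 : ℝ) • g + k)‖ ≤ 4 * (D.h ^ 2)⁻¹ * M := by
  have := h_pos (D := D)
  rw [norm_smul, Real.norm_of_nonneg (by positivity)]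
  have h1 : ‖f - (2 : ℝ) • g + k‖ ≤ 4 * M := by
    have a1 := norm_add_le (f - (2 : ℝ) • g) k
    have a2 := norm_sub_le f ((2 : ℝ) • g)
    have a3 : ‖(2 : ℝ) • g‖ = 2 * ‖g‖ := by rw [norm_smul]; norm_num
    linarith
  calc _ ≤ (D.h ^ 2)⁻¹ * (4 * M) := by gcongr
    _ = _ := by ring

theorem norm_diff_le {E : Type*} [NormedAddCommGroup E] [NormedSpace ℝ E] {f g : E}
    {M : ℝ} (hf : ‖f‖ ≤ M) (hg : ‖g‖ ≤ M) :
    ‖(2 * D.h)⁻¹ • (f - g)‖ ≤ D.gridC * M := by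
  have hh := h_pos (D := D)
  have hM : 0 ≤ M := (norm_nonneg f).trans hf
  rw [norm_smul, Real.norm_of_nonneg (by positivity)]
  have h1 : ‖f - g‖ ≤ 2 * M := by
    have a2 := norm_sub_le f g
    linarith
  calc _ ≤ (2 * D.h)⁻¹ * (2 * M) := by gcongr
    _ = D.h⁻¹ * M := by field_simp
    _ ≤ _ := by
      refine mul_le_mul_of_nonneg_right ?_ hM
      have h2 : 0 < (D.h ^ 2)⁻¹ := by positivity
      unfold gridC
      linarith

/-- T will be the identity or multiplication by the weight. It acts on every node value separately,
so linearity alone carries nodewise bounds over to differences. -/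
theorem norm_lapLow_comp_le (T : Lp ℂ 2 (D.cylMeas ν) →L[ℝ] Lp ℂ 2 (D.cylMeas ν)) (i : D.Inner)
    {u : D.Jet 2 ν} {M : ℝ} (h : ∀ n, ‖T (u (n, 0))‖ ≤ M) :
    ‖T (lapLow ν i u)‖ ≤ 8 * (D.h ^ 2)⁻¹ * M := by
  have e : T (lapLow ν i u)
      = (D.h ^ 2)⁻¹ • (T (u (xMinus i, 0)) - (2 : ℝ) • T (u (ctr i, 0)) + T (u (xPlus i, 0)))
      + (D.h ^ 2)⁻¹ • (T (u (yMinus i, 0)) - (2 : ℝ) • T (u (ctr i, 0)) + T (u (yPlus i, 0))) := by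
    simp [lapLow]
  rw [e]
  refine (norm_add_le _ _).trans ?_
  have h1 := norm_second_diff_le (D := D) (h (xMinus i)) (h (ctr i)) (h (xPlus i))
  have h2 := norm_second_diff_le (D := D) (h (yMinus i)) (h (ctr i)) (h (yPlus i))
  linarith

theorem norm_gradL_comp_le (T : Lp ℂ 2 (D.cylMeas ν) →L[ℝ] Lp ℂ 2 (D.cylMeas ν)) (i : D.Inner)
    {u : D.Jet 2 ν} {M : ℝ} (h0 : ∀ n, ‖T (u (n, 0))‖ ≤ M) (h1 : ∀ n, ‖T (u (n, 1))‖ ≤ M)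
    (m : Fin 3) : ‖T (gradL ν i m u)‖ ≤ D.gridC * M := by
  have hM : 0 ≤ M := (norm_nonneg _).trans (h0 (ctr i))
  fin_cases m
  · have e : T (gradL ν i 0 u) = (2 * D.h)⁻¹ • (T (u (xPlus i, 0)) - T (u (xMinus i, 0))) := by
      simp [gradL]
    exact (congrArg norm e).trans_le (norm_diff_le (h0 _) (h0 _))
  · have e : T (gradL ν i 1 u) = (2 * D.h)⁻¹ • (T (u (yPlus i, 0)) - T (u (yMinus i, 0))) := by
      simp [gradL]
    exact (congrArg norm e).trans_le (norm_diff_le (h0 _) (h0 _))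
  · exact (h1 (ctr i)).trans (le_mul_of_one_le_left hM one_le_gridC)

theorem norm_gradLz_comp_le (T : Lp ℂ 2 (D.cylMeas ν) →L[ℝ] Lp ℂ 2 (D.cylMeas ν)) (i : D.Inner)
    {u : D.Jet 2 ν} {M : ℝ} (h1 : ∀ n, ‖T (u (n, 1))‖ ≤ M) (h2 : ∀ n, ‖T (u (n, 2))‖ ≤ M)
    (m : Fin 3) : ‖T (gradLz ν i m u)‖ ≤ D.gridC * M := by
  have hM : 0 ≤ M := (norm_nonneg _).trans (h1 (ctr i))
  fin_cases m
  · have e : T (gradLz ν i 0 u) = (2 * D.h)⁻¹ • (T (u (xPlus i, 1)) - T (u (xMinus i, 1))) := by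
      simp [gradLz]
    exact (congrArg norm e).trans_le (norm_diff_le (h1 _) (h1 _))
  · have e : T (gradLz ν i 1 u) = (2 * D.h)⁻¹ • (T (u (yPlus i, 1)) - T (u (yMinus i, 1))) := by
      simp [gradLz]
    exact (congrArg norm e).trans_le (norm_diff_le (h1 _) (h1 _))
  · exact (h2 (ctr i)).trans (le_mul_of_one_le_left hM one_le_gridC)

theorem norm_gradL_le (i : D.Inner) (m : Fin 3) (u : D.Jet 2 ν) :
    ‖gradL ν i m u‖ ≤ D.gridC * ‖u‖ :=
  norm_gradL_comp_le (ContinuousLinearMap.id ℝ _) i (fun n => norm_ev_le n 0 u)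
    (fun n => norm_ev_le n 1 u) m

theorem norm_gradLz_le (i : D.Inner) (m : Fin 3) (u : D.Jet 2 ν) :
    ‖gradLz ν i m u‖ ≤ D.gridC * ‖u‖ :=
  norm_gradLz_comp_le (ContinuousLinearMap.id ℝ _) i (fun n => norm_ev_le n 1 u)
    (fun n => norm_ev_le n 2 u) m

theorem norm_lapL_le (i : D.Inner) (u : D.Jet 2 ν) : ‖lapL ν i u‖ ≤ D.gridC * ‖u‖ := by
  have h1 : ‖lapLow ν i u‖ ≤ 8 * (D.h ^ 2)⁻¹ * ‖u‖ :=
    norm_lapLow_comp_le (ContinuousLinearMap.id ℝ _) i (fun n => norm_ev_le n 0 u)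
  have h2 : ‖lapL ν i u‖ ≤ ‖u (ctr i, 2)‖ + ‖lapLow ν i u‖ := norm_add_le _ _
  have h3 := norm_ev_le (ctr i) 2 u
  have h4 : 0 ≤ D.h⁻¹ * ‖u‖ := mul_nonneg (inv_nonneg.2 h_pos.le) (norm_nonneg _)
  unfold gridC
  linarith

/-! ### Traces of combinations -/

section Finite

variable [IsFiniteMeasure ν]

theorem HasTrace.sub {f g f' g' : Lp ℂ 2 (D.cylMeas ν)} {z₀ : ℝ}
    (h₀ : z₀ ∈ Set.Icc (-D.ξ) D.d) {a a' : K → ℂ}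
    (h1 : D.HasTrace ν f g z₀ a) (h2 : D.HasTrace ν f' g' z₀ a') :
    D.HasTrace ν (f - f' : Lp ℂ 2 (D.cylMeas ν)) (g - g' : Lp ℂ 2 (D.cylMeas ν)) z₀ (a - a') := by
  simpa [sub_eq_add_neg] using HasTrace.add h₀ h1 (HasTrace.smul h₀ (-1) h2)

theorem IsZDeriv.smul_sub {f g f' g' : Lp ℂ 2 (D.cylMeas ν)} (c : ℝ)
    (h1 : D.IsZDeriv ν f g) (h2 : D.IsZDeriv ν f' g') :
    D.IsZDeriv ν (c • (f - f') : Lp ℂ 2 (D.cylMeas ν)) (c • (g - g') : Lp ℂ 2 (D.cylMeas ν)) := by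
  obtain ⟨a, ha⟩ := h1
  obtain ⟨a', ha'⟩ := h2
  exact ⟨_, HasTrace.smul left_mem c (HasTrace.sub left_mem ha ha')⟩

theorem gradL_isZDeriv {u : D.Jet 2 ν} (hu : u ∈ D.H 2 ν) (i : D.Inner) (m : Fin 3) :
    D.IsZDeriv ν (gradL ν i m u) (gradLz ν i m u) := by
  fin_cases m
  · exact IsZDeriv.smul_sub _ (hu (xPlus i) 0) (hu (xMinus i) 0)
  · exact IsZDeriv.smul_sub _ (hu (yPlus i) 0) (hu (yMinus i) 0)
  · exact hu (ctr i) 1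

/-- The boundary condition prescribes only the value at lateral nodes; the z-derivatives vanish
because the derivative of the zero function is unique (`IsZDeriv.eq_zero`). -/
theorem H0_lateral {u : D.Jet 2 ν} (hu : u ∈ D.H0 ν) {n : D.Node} (hn : IsLateral n)
    (r : Fin 3) : u (n, r) = 0 := by
  have h0 : u (n, 0) = 0 := hu.2.lateral n hn
  have h1 : u (n, 1) = 0 := by
    have := hu.1 n 0
    refine IsZDeriv.eq_zero (D := D) (ν := ν) ?_
    rw [← h0]
    exact this
  have h2 : u (n, 2) = 0 := by
    have := hu.1 n 1
    refine IsZDeriv.eq_zero (D := D) (ν := ν) ?_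
    rw [← h1]
    exact this
  fin_cases r
  · exact h0
  · exact h1
  · exact h2

theorem H0_trace_zero {u : D.Jet 2 ν} (hu : u ∈ D.H0 ν) (n : D.Node) :
    D.HasTrace ν (u (n, 0)) (u (n, 1)) (-D.ξ) 0 := by
  rcases node_cases n with hn | ⟨i, rfl⟩
  · rw [H0_lateral hu hn, H0_lateral hu hn]
    exact HasTrace.zero _ left_mem
  · exact hu.2.bottom i

theorem H0_trace_one {u : D.Jet 2 ν} (hu : u ∈ D.H0 ν) (n : D.Node) :
    D.HasTrace ν (u (n, 1)) (u (n, 2)) (-D.ξ) 0 := by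
  rcases node_cases n with hn | ⟨i, rfl⟩
  · rw [H0_lateral hu hn, H0_lateral hu hn]
    exact HasTrace.zero _ left_mem
  · exact hu.2.bottom_z i

theorem HasTrace.smul_sub_zero {f g f' g' : Lp ℂ 2 (D.cylMeas ν)} (c : ℝ)
    (h1 : D.HasTrace ν f g (-D.ξ) 0) (h2 : D.HasTrace ν f' g' (-D.ξ) 0) :
    D.HasTrace ν (c • (f - f') : Lp ℂ 2 (D.cylMeas ν)) (c • (g - g') : Lp ℂ 2 (D.cylMeas ν))
      (-D.ξ) 0 := by
  simpa using HasTrace.smul left_mem c (HasTrace.sub left_mem h1 h2)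

theorem gradL_hasTrace {u : D.Jet 2 ν} (hu : u ∈ D.H0 ν) (i : D.Inner) (m : Fin 3) :
    D.HasTrace ν (gradL ν i m u) (gradLz ν i m u) (-D.ξ) 0 := by
  fin_cases m
  · exact HasTrace.smul_sub_zero _ (H0_trace_zero hu (xPlus i)) (H0_trace_zero hu (xMinus i))
  · exact HasTrace.smul_sub_zero _ (H0_trace_zero hu (yPlus i)) (H0_trace_zero hu (yMinus i))
  · exact H0_trace_one hu (ctr i)

/-- All conditions become equations between bounded operators, whose solution sets are closed. The
completeness of `H0` obtained this way is needed both for the Riesz representation of the derivative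
and for the existence of minimizers. -/
theorem mem_H0_iff {u : D.Jet 2 ν} : u ∈ D.H0 ν ↔
    (∀ n : D.Node, IsLateral n → ∀ r, ev ν n r u = 0) ∧
    (∀ i : D.Inner, volterra (-D.ξ) left_mem (ev ν (ctr i) 1 u) = ev ν (ctr i) 0 u) ∧
    (∀ i : D.Inner, volterra (-D.ξ) left_mem (ev ν (ctr i) 2 u) = ev ν (ctr i) 1 u) ∧
    ∀ i : D.Inner, volterra D.d right_mem (ev ν (ctr i) 1 u) = ev ν (ctr i) 0 u := by
  simp only [← hasTrace_zero_iff_volterra]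
  constructor
  · intro hu
    exact ⟨fun n hn r => H0_lateral hu hn r, hu.2.bottom, hu.2.bottom_z, hu.2.top⟩
  · rintro ⟨h1, h2, h3, h4⟩
    refine ⟨fun n r => ?_, ⟨fun n hn => h1 n hn 0, h2, h3, h4⟩⟩
    rcases node_cases n with hn | ⟨i, rfl⟩
    · have e1 : u (n, r.castSucc) = 0 := h1 n hn _
      have e2 : u (n, r.succ) = 0 := h1 n hn _
      rw [e1, e2]
      exact ⟨0, HasTrace.zero _ left_mem⟩
    · fin_cases r
      · exact ⟨0, h2 i⟩
      · exact ⟨0, h3 i⟩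

theorem isClosed_H0 : IsClosed (D.H0 ν : Set (D.Jet 2 ν)) := by
  have e : (D.H0 ν : Set (D.Jet 2 ν)) = {u |
    (∀ n : D.Node, IsLateral n → ∀ r, ev ν n r u = 0) ∧
    (∀ i : D.Inner, volterra (-D.ξ) left_mem (ev ν (ctr i) 1 u) = ev ν (ctr i) 0 u) ∧
    (∀ i : D.Inner, volterra (-D.ξ) left_mem (ev ν (ctr i) 2 u) = ev ν (ctr i) 1 u) ∧
    ∀ i : D.Inner, volterra D.d right_mem (ev ν (ctr i) 1 u) = ev ν (ctr i) 0 u} :=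
    Set.ext fun u => mem_H0_iff
  rw [e]
  simp only [Set.ofPred_and, Set.ofPred_forall]
  refine IsClosed.inter (isClosed_iInter fun n => isClosed_iInter fun _ => isClosed_iInter fun r =>
    isClosed_eq (by fun_prop) (by fun_prop)) (IsClosed.inter ?_ (IsClosed.inter ?_ ?_)) <;>
  exact isClosed_iInter fun i => isClosed_eq (by fun_prop) (by fun_prop)

instance : CompleteSpace (D.H0 ν) := isClosed_H0.completeSpace_coe

theorem H0_le_H : D.H0 ν ≤ D.H 2 ν := fun _ hu => hu.1

/-! ### Weighted estimates on `H0` -/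

/-- The weighted norm of `u_zz`. -/
noncomputable def topNorm (lam : ℝ) (u : D.Jet 2 ν) : ℝ :=
  √(∑ i : D.Inner, ‖D.carl ν 2 lam (u (ctr i, 2))‖ ^ 2)

theorem topNorm_nonneg (lam : ℝ) (u : D.Jet 2 ν) : 0 ≤ topNorm lam u := Real.sqrt_nonneg _

theorem topNorm_sq (lam : ℝ) (u : D.Jet 2 ν) :
    topNorm lam u ^ 2 = ∑ i : D.Inner, ‖D.carl ν 2 lam (u (ctr i, 2))‖ ^ 2 :=
  Real.sq_sqrt (by positivity)

/-- The small parameter `(|(-ξ, d)| / 2λ)^{1/2}`. -/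
noncomputable def eps (D : Config) (lam : ℝ) : ℝ := √(D.len / (2 * lam))

theorem eps_nonneg (lam : ℝ) : 0 ≤ D.eps lam := Real.sqrt_nonneg _

theorem eps_le_one {lam : ℝ} (hl : D.len ≤ lam) : D.eps lam ≤ 1 := by
  have := len_pos (D := D)
  rw [eps, Real.sqrt_le_one]
  rw [div_le_one (by linarith)]
  linarith

variable {u : D.Jet 2 ν} {lam : ℝ}

theorem norm_carl_two_le (hu : u ∈ D.H0 ν) (n : D.Node) :
    ‖D.carl ν 2 lam (u (n, 2))‖ ≤ topNorm lam u := by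
  rcases node_cases n with hn | ⟨i, rfl⟩
  · rw [H0_lateral hu hn, map_zero, norm_zero]
    exact topNorm_nonneg _ _
  · refine Real.le_sqrt_of_sq_le ?_
    exact Finset.single_le_sum (f := fun i : D.Inner => ‖D.carl ν 2 lam (u (ctr i, 2))‖ ^ 2)
      (fun i _ => by positivity) (Finset.mem_univ i)

theorem norm_carl_one_le (hu : u ∈ D.H0 ν) (hl : D.len ≤ lam) (n : D.Node) :
    ‖D.carl ν 2 lam (u (n, 1))‖ ≤ D.eps lam * topNorm lam u :=
  (norm_carl_le_of_hasTrace (H0_trace_one hu n) (len_pos.trans_le hl)).trans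
    (mul_le_mul_of_nonneg_left (norm_carl_two_le hu n) (eps_nonneg _))

theorem norm_carl_one_le_top (hu : u ∈ D.H0 ν) (hl : D.len ≤ lam) (n : D.Node) :
    ‖D.carl ν 2 lam (u (n, 1))‖ ≤ topNorm lam u :=
  (norm_carl_one_le hu hl n).trans (mul_le_of_le_one_left (topNorm_nonneg _ _) (eps_le_one hl))

/-- Two integrations would give eps². One factor is discarded, as eps ≤ 1, so that u and u_z share
the same bound. -/
theorem norm_carl_zero_le (hu : u ∈ D.H0 ν) (hl : D.len ≤ lam) (n : D.Node) :
    ‖D.carl ν 2 lam (u (n, 0))‖ ≤ D.eps lam * topNorm lam u :=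
  (norm_carl_le_of_hasTrace (H0_trace_zero hu n) (len_pos.trans_le hl)).trans
    (mul_le_mul_of_nonneg_left (norm_carl_one_le_top hu hl n) (eps_nonneg _))

theorem norm_carl_gradL_le (hu : u ∈ D.H0 ν) (hl : D.len ≤ lam) (i : D.Inner) (m : Fin 3) :
    ‖D.carl ν 2 lam (gradL ν i m u)‖ ≤ D.gridC * (D.eps lam * topNorm lam u) :=
  norm_gradL_comp_le _ i (norm_carl_zero_le hu hl) (norm_carl_one_le hu hl) m

theorem norm_carl_gradLz_le (hu : u ∈ D.H0 ν) (hl : D.len ≤ lam) (i : D.Inner) (m : Fin 3) :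
    ‖D.carl ν 2 lam (gradLz ν i m u)‖ ≤ D.gridC * topNorm lam u :=
  norm_gradLz_comp_le _ i (norm_carl_one_le_top hu hl) (norm_carl_two_le hu) m

theorem norm_carl_lapLow_le (hu : u ∈ D.H0 ν) (hl : D.len ≤ lam) (i : D.Inner) :
    ‖D.carl ν 2 lam (lapLow ν i u)‖ ≤ D.gridC * (D.eps lam * topNorm lam u) := by
  refine (norm_lapLow_comp_le _ i (norm_carl_zero_le hu hl)).trans
    (mul_le_mul_of_nonneg_right ?_ (mul_nonneg (eps_nonneg _) (topNorm_nonneg _ _)))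
  have := inv_nonneg.2 (h_pos (D := D)).le
  unfold gridC
  linarith

/-- The number of components of a jet. -/
noncomputable def cardC (D : Config) : ℝ := Fintype.card (D.Node × Fin 3)

theorem cardC_pos : 0 < D.cardC := by
  unfold cardC
  exact_mod_cast Fintype.card_pos

/-- Every component of the jet is zero or recovered from u_zz at an interior node by integrations
from z = -ξ. The constant is free of λ since the weight is at least 1. -/
theorem norm_sq_le_topNorm (hu : u ∈ D.H0 ν) (hl : D.len ≤ lam) :
    ‖u‖ ^ 2 ≤ D.cardC * topNorm lam u ^ 2 := by
  have hl0 : 0 ≤ lam := len_pos.le.trans hl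
  rw [PiLp.norm_sq_eq_of_L2]
  have h1 : ∀ p : D.Node × Fin 3, ‖u p‖ ^ 2 ≤ topNorm lam u ^ 2 := by
    rintro ⟨n, r⟩
    refine pow_le_pow_left₀ (norm_nonneg _) ((norm_le_norm_carl hl0 _).trans ?_) 2
    fin_cases r
    · exact (norm_carl_zero_le hu hl n).trans
        (mul_le_of_le_one_left (topNorm_nonneg _ _) (eps_le_one hl))
    · exact norm_carl_one_le_top hu hl n
    · exact norm_carl_two_le hu n
  calc _ ≤ ∑ _p : D.Node × Fin 3, topNorm lam u ^ 2 := Finset.sum_le_sum fun p _ => h1 p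
    _ = _ := by rw [Finset.sum_const, nsmul_eq_mul]; rfl

end Finite

end Config

end Convexification

namespace Convexification

open scoped ENNReal

/-! ### The gradient of v as a bounded function. -/

namespace Config

variable {D : Config}

theorem norm_Lp_top_le {α : Type*} [MeasurableSpace α] {μ : Measure α} {f : Lp ℂ ∞ μ} {C : ℝ}
    (hC : 0 ≤ C) (h : ∀ᵐ w ∂μ, ‖f w‖ ≤ C) : ‖f‖ ≤ C := by
  rw [Lp.norm_def, eLpNorm_exponent_top]
  exact ENNReal.toReal_le_of_le_ofReal hC (eLpNormEssSup_le_of_ae_bound h)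

theorem ae_cyl_of_ae_forall {p : ℝ → ℝ → Prop}
    (h : ∀ᵐ z ∂D.zMeas, ∀ k ∈ Set.Icc D.kmin D.kmax, p k z) :
    ∀ᵐ w ∂D.cylMeas D.kMeas, p w.1 w.2 := by
  have hk : ∀ᵐ k ∂D.kMeas, k ∈ Set.Ioo D.kmin D.kmax := ae_restrict_mem measurableSet_Ioo
  filter_upwards [ae_cyl_snd (ν := D.kMeas) h, ae_cyl_fst (D := D) hk] with w h1 h2
  exact h1 _ (Set.Ioo_subset_Icc_self h2)

theorem restrict_k_le {k : ℝ} (hk : k ∈ Set.Icc D.kmin D.kmax) :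
    volume.restrict (Set.uIoc k D.kmax) ≤ D.kMeas := by
  rw [kMeas, restrict_Ioo_eq_restrict_Ioc, Set.uIoc_of_le hk.2]
  exact Measure.restrict_mono (Set.Ioc_subset_Ioc_left hk.1) le_rfl

/-! ### The function `v` -/

/-- `f(z) - ∫_k^{kmax} g(κ, z) dκ`. -/
noncomputable def tailInt (f : Lp ℂ 2 (D.cylMeas unitMeas)) (g : Lp ℂ 2 (D.cylMeas D.kMeas))
    (k z : ℝ) : ℂ :=
  f ((), z) - ∫ κ in k..D.kmax, g (κ, z)

/-- The exceptional set of z is chosen before k. Integrals over the wave numbers are thus well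
defined on classes for each k, including both endpoints. -/
theorem integral_k_congr {f g : ℝ × ℝ → ℂ} (h : ∀ᵐ w ∂D.cylMeas D.kMeas, f w = g w) :
    ∀ᵐ z ∂D.zMeas, ∀ k ∈ Set.Icc D.kmin D.kmax,
      ∫ κ in k..D.kmax, f (κ, z) = ∫ κ in k..D.kmax, g (κ, z) := by
  filter_upwards [ae_slice_swap h] with z hz k hk
  exact intervalIntegral.integral_congr_ae_restrict (ae_mono (restrict_k_le hk) hz)

theorem ae_unit_slice {p : Unit × ℝ → Prop} (h : ∀ᵐ w ∂D.cylMeas unitMeas, p w) :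
    ∀ᵐ z ∂D.zMeas, p ((), z) :=
  ae_unit (p := fun κ => ∀ᵐ z ∂D.zMeas, p (κ, z)) (ae_slice h)

theorem gradV_eq_tailInt (V : D.Jet 2 unitMeas) (q : D.Jet 2 D.kMeas) (i : D.Inner) (m : Fin 3) :
    ∀ᵐ z ∂D.zMeas, ∀ k ∈ Set.Icc D.kmin D.kmax,
      gradV V q i k z m = tailInt (gradL unitMeas i m V) (gradL D.kMeas i m q) k z := by
  filter_upwards [ae_unit_slice (gradL_coe i V m), integral_k_congr (gradL_coe i q m)]
    with z h1 h2 k hk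
  rw [gradV, tailInt, h1, h2 k hk]

theorem lapV_eq_tailInt (V : D.Jet 2 unitMeas) (q : D.Jet 2 D.kMeas) (i : D.Inner) :
    ∀ᵐ z ∂D.zMeas, ∀ k ∈ Set.Icc D.kmin D.kmax,
      lapV V q i k z = tailInt (lapL unitMeas i V) (lapL D.kMeas i q) k z := by
  filter_upwards [ae_unit_slice (lapL_coe i V), integral_k_congr (lapL_coe i q)]
    with z h1 h2 k hk
  rw [lapV, tailInt, h1, h2 k hk]

theorem integrable_k (g : Lp ℂ 2 (D.cylMeas D.kMeas)) :
    ∀ᵐ z ∂D.zMeas, ∀ k ∈ Set.Icc D.kmin D.kmax,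
      IntervalIntegrable (fun κ => g (κ, z)) volume k D.kmax := by
  have h1 : Integrable g (D.cylMeas D.kMeas) := (Lp.memLp g).integrable (by norm_num)
  have h2 : Integrable g (D.kMeas.prod D.zMeas) :=
    (integrable_smul_measure h_sq_ne_zero ENNReal.ofReal_ne_top).1 h1
  filter_upwards [h2.prod_left_ae] with z hz k hk
  rw [intervalIntegrable_iff]
  exact hz.mono_measure (restrict_k_le hk)

theorem tailInt_add (f f' : Lp ℂ 2 (D.cylMeas unitMeas)) (g g' : Lp ℂ 2 (D.cylMeas D.kMeas)) :
    ∀ᵐ z ∂D.zMeas, ∀ k ∈ Set.Icc D.kmin D.kmax,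
      tailInt (f + f') (g + g') k z = tailInt f g k z + tailInt f' g' k z := by
  filter_upwards [ae_unit_slice (Lp.coeFn_add f f'), integral_k_congr (Lp.coeFn_add g g'),
    integrable_k g, integrable_k g'] with z h1 h2 h3 h4 k hk
  simp only [tailInt, h1, h2 k hk, Pi.add_apply]
  rw [intervalIntegral.integral_add (h3 k hk) (h4 k hk)]
  ring

theorem tailInt_smul (c : ℝ) (f : Lp ℂ 2 (D.cylMeas unitMeas))
    (g : Lp ℂ 2 (D.cylMeas D.kMeas)) :
    ∀ᵐ z ∂D.zMeas, ∀ k ∈ Set.Icc D.kmin D.kmax,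
      tailInt (c • f) (c • g) k z = c • tailInt f g k z := by
  filter_upwards [ae_unit_slice (Lp.coeFn_smul c f), integral_k_congr (Lp.coeFn_smul c g)]
    with z h1 h2 k hk
  simp only [tailInt, h1, h2 k hk, Pi.smul_apply]
  rw [intervalIntegral.integral_smul, smul_sub]

theorem tailInt_carl (lam : ℝ) (g : Lp ℂ 2 (D.cylMeas D.kMeas)) :
    ∀ᵐ z ∂D.zMeas, ∀ k ∈ Set.Icc D.kmin D.kmax,
      D.wt lam z * tailInt 0 g k z = -∫ κ in k..D.kmax, D.carl D.kMeas 2 lam g (κ, z) := by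
  filter_upwards [ae_unit_slice (Lp.coeFn_zero ℂ 2 (D.cylMeas unitMeas)),
    integral_k_congr (carl_coe lam g)] with z h1 h2 k hk
  rw [h2 k hk, intervalIntegral.integral_const_mul, tailInt, h1]
  simp

theorem norm_tailInt_le {f f' : Lp ℂ 2 (D.cylMeas unitMeas)} {g g' : Lp ℂ 2 (D.cylMeas D.kMeas)}
    (hf : D.IsZDeriv unitMeas f f') (hg : D.IsZDeriv D.kMeas g g') :
    ∀ᵐ z ∂D.zMeas, ∀ k ∈ Set.Icc D.kmin D.kmax,
      ‖tailInt f g k z‖ ≤ D.sobC * (‖f‖ + ‖f'‖) + D.sobC * (‖g‖ + ‖g'‖) := by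
  filter_upwards [norm_unit_le hf, norm_integral_k_le hg] with z h1 h2 k hk
  exact (norm_sub_le _ _).trans (add_le_add h1 (h2 k hk))

theorem stronglyMeasurable_tailInt (f : Lp ℂ 2 (D.cylMeas unitMeas))
    (g : Lp ℂ 2 (D.cylMeas D.kMeas)) :
    StronglyMeasurable fun w : ℝ × ℝ => tailInt f g w.1 w.2 := by
  refine ((Lp.stronglyMeasurable f).comp_measurable (by fun_prop)).sub
    (stronglyMeasurable_intervalIntegral (f := fun p : (ℝ × ℝ) × ℝ => g (p.2, p.1.2))
      ((Lp.stronglyMeasurable g).comp_measurable (by fun_prop)) measurable_fst measurable_const)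

variable (D) in
/-- The space of pairs `(V, q)`. -/
abbrev Pairs : Type := D.H 2 unitMeas × D.H 2 D.kMeas

/-- The constant in the bound for `∇^h v`. -/
noncomputable def gradC (D : Config) : ℝ := 4 * D.sobC * D.gridC

theorem gradC_nonneg : 0 ≤ D.gradC :=
  mul_nonneg (mul_nonneg zero_le_four sobC_nonneg) (zero_le_one.trans one_le_gridC)

/-- The components of the discrete gradient have at most one derivative in z, so one more is
available in L² and the Sobolev inequality applies. For Δ^h v, which contains v_zz, only L² bounds
are at hand. -/
theorem norm_tailInt_gradL_le (i : D.Inner) (m : Fin 3) (x : Pairs D) :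
    ∀ᵐ z ∂D.zMeas, ∀ k ∈ Set.Icc D.kmin D.kmax,
      ‖tailInt (gradL unitMeas i m x.1.1) (gradL D.kMeas i m x.2.1) k z‖ ≤ D.gradC * ‖x‖ := by
  filter_upwards [norm_tailInt_le (gradL_isZDeriv x.1.2 i m) (gradL_isZDeriv x.2.2 i m)]
    with z hz k hk
  refine (hz k hk).trans ?_
  have a1 := norm_gradL_le i m x.1.1
  have a2 := norm_gradLz_le i m x.1.1
  have a3 := norm_gradL_le i m x.2.1
  have a4 := norm_gradLz_le i m x.2.1
  have b1 : ‖x.1.1‖ ≤ ‖x‖ := norm_fst_le x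
  have b2 : ‖x.2.1‖ ≤ ‖x‖ := norm_snd_le x
  have hg : 0 ≤ D.gridC := zero_le_one.trans one_le_gridC
  have c1 := mul_le_mul_of_nonneg_left b1 hg
  have c2 := mul_le_mul_of_nonneg_left b2 hg
  calc _ ≤ D.sobC * (D.gridC * ‖x‖ + D.gridC * ‖x‖)
      + D.sobC * (D.gridC * ‖x‖ + D.gridC * ‖x‖) := by
        refine add_le_add (mul_le_mul_of_nonneg_left ?_ sobC_nonneg)
          (mul_le_mul_of_nonneg_left ?_ sobC_nonneg) <;> linarith
    _ = _ := by unfold gradC; ring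

theorem norm_gradV_le (i : D.Inner) (m : Fin 3) (x : Pairs D) :
    ∀ᵐ z ∂D.zMeas, ∀ k ∈ Set.Icc D.kmin D.kmax,
      ‖gradV x.1.1 x.2.1 i k z m‖ ≤ D.gradC * ‖x‖ := by
  filter_upwards [norm_tailInt_gradL_le i m x, gradV_eq_tailInt x.1.1 x.2.1 i m] with z h1 h2 k hk
  rw [h2 k hk]
  exact h1 k hk

theorem memLp_tailInt (i : D.Inner) (m : Fin 3) (x : Pairs D) :
    MemLp (fun w : ℝ × ℝ => tailInt (gradL unitMeas i m x.1.1) (gradL D.kMeas i m x.2.1) w.1 w.2)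
      ∞ (D.cylMeas D.kMeas) :=
  memLp_top_of_bound (stronglyMeasurable_tailInt _ _).aestronglyMeasurable _
    (ae_cyl_of_ae_forall (norm_tailInt_gradL_le i m x))

/-- The components of `∇^h v` as bounded functions. -/
noncomputable def gradVInf (i : D.Inner) (m : Fin 3) :
    Pairs D →L[ℝ] Lp ℂ ∞ (D.cylMeas D.kMeas) :=
  LinearMap.mkContinuous
    { toFun := fun x => (memLp_tailInt i m x).toLp
      map_add' := fun x y => by
        rw [← MemLp.toLp_add]
        refine MemLp.toLp_congr _ _ ?_
        have h := ae_cyl_of_ae_forall (tailInt_add (gradL unitMeas i m x.1.1)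
          (gradL unitMeas i m y.1.1) (gradL D.kMeas i m x.2.1) (gradL D.kMeas i m y.2.1))
        filter_upwards [h] with w hw
        simpa using hw
      map_smul' := fun c x => by
        rw [RingHom.id_apply, ← MemLp.toLp_const_smul]
        refine MemLp.toLp_congr _ _ ?_
        have h := ae_cyl_of_ae_forall (tailInt_smul c (gradL unitMeas i m x.1.1)
          (gradL D.kMeas i m x.2.1))
        filter_upwards [h] with w hw
        simpa using hw }
    D.gradC (fun x => norm_toLp_top_le (memLp_tailInt i m x) (mul_nonneg gradC_nonneg (norm_nonneg _))
      (ae_cyl_of_ae_forall (norm_tailInt_gradL_le i m x)))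

theorem gradVInf_apply (i : D.Inner) (m : Fin 3) (x : Pairs D) :
    gradVInf i m x = (memLp_tailInt i m x).toLp := rfl

theorem norm_gradVInf_le (i : D.Inner) (m : Fin 3) (x : Pairs D) :
    ‖gradVInf i m x‖ ≤ D.gradC * ‖x‖ := by
  rw [gradVInf_apply]
  exact norm_toLp_top_le _ (mul_nonneg gradC_nonneg (norm_nonneg _))
    (ae_cyl_of_ae_forall (norm_tailInt_gradL_le i m x))

theorem gradVInf_coe_tailInt (i : D.Inner) (m : Fin 3) (x : Pairs D) :
    ∀ᵐ w ∂D.cylMeas D.kMeas, gradVInf i m x w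
      = tailInt (gradL unitMeas i m x.1.1) (gradL D.kMeas i m x.2.1) w.1 w.2 := by
  rw [gradVInf_apply]
  exact (memLp_tailInt i m x).coeFn_toLp

theorem gradVInf_coe (i : D.Inner) (m : Fin 3) (x : Pairs D) :
    ∀ᵐ w ∂D.cylMeas D.kMeas, gradVInf i m x w = gradV x.1.1 x.2.1 i w.1 w.2 m := by
  filter_upwards [gradVInf_coe_tailInt i m x,
    ae_cyl_of_ae_forall (gradV_eq_tailInt x.1.1 x.2.1 i m)] with w h1 h2
  rw [h1, h2]

variable (D) in
/-- The inclusion of `H_{0,2}^h` into the space of pairs. -/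
noncomputable def incl : D.H0 D.kMeas →L[ℝ] Pairs D :=
  (0 : D.H0 D.kMeas →L[ℝ] D.H 2 unitMeas).prod
    ((Submodule.inclusion (H0_le_H (D := D) (ν := D.kMeas))).mkContinuous 1
      (fun r => by rw [one_mul]; rfl))

theorem incl_fst (r : D.H0 D.kMeas) : (incl D r).1 = 0 := rfl

theorem incl_snd (r : D.H0 D.kMeas) : ((incl D r).2 : D.Jet 2 D.kMeas) = r := rfl

theorem norm_incl (r : D.H0 D.kMeas) : ‖incl D r‖ = ‖r‖ := by
  rw [Prod.norm_def, incl_fst, norm_zero, max_eq_right (norm_nonneg _)]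
  rfl

/-- The ratio of the small parameters of the two Carleman estimates. -/
noncomputable def ratC (D : Config) : ℝ := √((D.kmax - D.kmin) / D.h ^ 2 / D.len)

theorem sqrt_eq_ratC_mul_eps {lam : ℝ} :
    √((D.kmax - D.kmin) / D.h ^ 2 / (2 * lam)) = D.ratC * D.eps lam := by
  have hlen := len_pos (D := D)
  have hK : 0 < D.kmax - D.kmin := sub_pos.2 D.k_lt
  rw [ratC, eps, ← Real.sqrt_mul (by positivity)]
  congr 1
  field_simp

/-- A perturbation of q alone changes v by an integral over κ only. The weight depends only on z and
passes under that integral, where the Carleman estimate acts on every slice. -/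
theorem norm_carl_gradVInf_le {lam : ℝ} (hl : D.len ≤ lam) (r : D.H0 D.kMeas) (i : D.Inner)
    (m : Fin 3) :
    ‖D.carl D.kMeas ∞ lam (gradVInf i m (incl D r))‖
      ≤ D.ratC * D.gridC * (D.eps lam * topNorm lam (r : D.Jet 2 D.kMeas)) := by
  have hg : 0 ≤ D.gridC := zero_le_one.trans one_le_gridC
  have hr : 0 ≤ D.ratC := Real.sqrt_nonneg _
  refine norm_Lp_top_le (mul_nonneg (mul_nonneg hr hg)
    (mul_nonneg (eps_nonneg _) (topNorm_nonneg _ _))) ?_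
  filter_upwards [carl_coe lam (gradVInf i m (incl D r)), gradVInf_coe_tailInt i m (incl D r),
    ae_cyl_of_ae_forall (tailInt_carl lam (gradL D.kMeas i m (r : D.Jet 2 D.kMeas))),
    ae_cyl_of_ae_forall (norm_integral_k_carl_le (gradL_hasTrace r.2 i m) (len_pos.trans_le hl))]
    with w h1 h2 h3 h4
  rw [h1, h2, incl_fst, incl_snd, Submodule.coe_zero, map_zero, h3, norm_neg]
  refine h4.trans ?_
  rw [sqrt_eq_ratC_mul_eps]
  calc _ ≤ D.ratC * D.eps lam * (D.gridC * topNorm lam (r : D.Jet 2 D.kMeas)) :=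
        mul_le_mul_of_nonneg_left (norm_carl_gradLz_le r.2 hl i m) (mul_nonneg hr (eps_nonneg _))
    _ = _ := by ring

end Config

end Convexification

namespace Convexification

open scoped ENNReal

namespace Config

variable {D : Config}

/-! ### The operator `L^h` as a quadratic polynomial -/

theorem k_bound : ∀ᵐ w ∂D.cylMeas D.kMeas, ‖((w.1 : ℝ) : ℂ)‖ ≤ D.kmax := by
  have h : ∀ᵐ z ∂D.zMeas, ∀ k ∈ Set.Icc D.kmin D.kmax, ‖(k : ℂ)‖ ≤ D.kmax :=
    Filter.Eventually.of_forall fun z k hk => by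
      rw [Complex.norm_real, Real.norm_of_nonneg (D.kmin_pos.le.trans hk.1)]
      exact hk.2
  exact ae_cyl_of_ae_forall h

theorem memLp_k : MemLp (fun w : ℝ × ℝ => (w.1 : ℂ)) ∞ (D.cylMeas D.kMeas) :=
  memLp_top_of_bound (by fun_prop) _ k_bound

/-- The wave number as a bounded function. -/
noncomputable def kInf (D : Config) : Lp ℂ ∞ (D.cylMeas D.kMeas) := memLp_k.toLp

theorem kmax_pos : 0 < D.kmax := D.kmin_pos.trans D.k_lt

theorem norm_kInf_le : ‖D.kInf‖ ≤ D.kmax := norm_toLp_top_le _ kmax_pos.le k_bound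

theorem kInf_coe : ∀ᵐ w ∂D.cylMeas D.kMeas, D.kInf w = (w.1 : ℂ) := memLp_k.coeFn_toLp

/-- A constant as a bounded function. -/
noncomputable def cInf (D : Config) (c : ℂ) : Lp ℂ ∞ (D.cylMeas D.kMeas) :=
  (memLp_const c).toLp

theorem norm_cInf_le (c : ℂ) : ‖D.cInf c‖ ≤ ‖c‖ :=
  norm_toLp_top_le _ (norm_nonneg _) (Filter.Eventually.of_forall fun _ => le_rfl)

theorem norm_cInf_two_le : ‖D.cInf 2‖ ≤ 2 := (norm_cInf_le 2).trans (by simp)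

theorem cInf_coe (c : ℂ) : ∀ᵐ w ∂D.cylMeas D.kMeas, D.cInf c w = c :=
  (memLp_const c).coeFn_toLp

/-- The constant function `1`. -/
noncomputable def oneL (D : Config) : Lp ℂ 2 (D.cylMeas D.kMeas) := (memLp_const 1).toLp

theorem oneL_coe : ∀ᵐ w ∂D.cylMeas D.kMeas, D.oneL w = 1 := (memLp_const 1).coeFn_toLp

/-- Multiplication of square integrable functions by a bounded one. -/
noncomputable abbrev mulK (D : Config) : Lp ℂ ∞ (D.cylMeas D.kMeas) →L[ℝ]
    Lp ℂ 2 (D.cylMeas D.kMeas) →L[ℝ] Lp ℂ 2 (D.cylMeas D.kMeas) :=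
  mulLp (D.cylMeas D.kMeas) 2

/-- The components of `∇^h v` as square integrable functions. -/
noncomputable def gradV2 (i : D.Inner) (m : Fin 3) : Pairs D →L[ℝ] Lp ℂ 2 (D.cylMeas D.kMeas) :=
  (D.mulK.flip D.oneL).comp (gradVInf i m)

theorem gradV2_apply (i : D.Inner) (m : Fin 3) (x : Pairs D) :
    gradV2 i m x = D.mulK (gradVInf i m x) D.oneL := rfl

/-- The components of `∇^h q`. -/
noncomputable def gradQ (i : D.Inner) (m : Fin 3) : Pairs D →L[ℝ] Lp ℂ 2 (D.cylMeas D.kMeas) :=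
  (gradL D.kMeas i m).comp ((D.H 2 D.kMeas).subtypeL.comp (ContinuousLinearMap.snd ℝ _ _))

/-- `k ∇^h q + ∇^h v`. -/
noncomputable def flux (i : D.Inner) (m : Fin 3) : Pairs D →L[ℝ] Lp ℂ 2 (D.cylMeas D.kMeas) :=
  (D.mulK D.kInf).comp (gradQ i m) + gradV2 i m

theorem flux_apply (i : D.Inner) (m : Fin 3) (x : Pairs D) :
    flux i m x = D.mulK D.kInf (gradL D.kMeas i m x.2.1) + gradV2 i m x := rfl

/-- `2k (k ∇^h q + ∇^h v)`. -/
noncomputable def kFlux (i : D.Inner) (m : Fin 3) : Pairs D →L[ℝ] Lp ℂ 2 (D.cylMeas D.kMeas) :=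
  (D.mulK (D.cInf 2)).comp ((D.mulK D.kInf).comp (flux i m))

theorem kFlux_apply (i : D.Inner) (m : Fin 3) (x : Pairs D) :
    kFlux i m x = D.mulK (D.cInf 2) (D.mulK D.kInf (flux i m x)) := rfl

/-- The quadratic part of `L^h`, as a bilinear map. -/
noncomputable def quad (i : D.Inner) :
    Pairs D →L[ℝ] Pairs D →L[ℝ] Lp ℂ 2 (D.cylMeas D.kMeas) :=
  ∑ m : Fin 3, D.mulK.bilinearComp (gradVInf i m) (kFlux i m)

theorem quad_apply (i : D.Inner) (x y : Pairs D) :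
    quad i x y = ∑ m : Fin 3, D.mulK (gradVInf i m x) (kFlux i m y) := by
  simp only [quad, _root_.sum_apply]
  rfl

/-- The linear part of `L^h` without `q_zz`. -/
noncomputable def linLow (i : D.Inner) : Pairs D →L[ℝ] Lp ℂ 2 (D.cylMeas D.kMeas) :=
  (lapLow D.kMeas i).comp ((D.H 2 D.kMeas).subtypeL.comp (ContinuousLinearMap.snd ℝ _ _))
    + (D.mulK (D.cInf (2 * Complex.I))).comp (flux i 2)

theorem linLow_apply (i : D.Inner) (x : Pairs D) :
    linLow i x = lapLow D.kMeas i x.2.1 + D.mulK (D.cInf (2 * Complex.I)) (flux i 2 x) := rfl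

/-- The linear part of `L^h`. -/
noncomputable def lin (i : D.Inner) : Pairs D →L[ℝ] Lp ℂ 2 (D.cylMeas D.kMeas) :=
  (ev D.kMeas (ctr i) 2).comp
    ((D.H 2 D.kMeas).subtypeL.comp (ContinuousLinearMap.snd ℝ _ _)) + linLow i

theorem lin_apply (i : D.Inner) (x : Pairs D) :
    lin i x = (x.2 : D.Jet 2 D.kMeas) (ctr i, 2) + linLow i x := rfl

/-- The operator `L^h` on pairs `(V, q)`. -/
noncomputable def opL (i : D.Inner) (x : Pairs D) : Lp ℂ 2 (D.cylMeas D.kMeas) :=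
  lin i x + quad i x x

theorem gradV2_coe (i : D.Inner) (m : Fin 3) (x : Pairs D) :
    ∀ᵐ w ∂D.cylMeas D.kMeas, gradV2 i m x w = gradV x.1.1 x.2.1 i w.1 w.2 m := by
  rw [gradV2_apply]
  filter_upwards [mulLp_coe (gradVInf i m x) D.oneL, gradVInf_coe i m x, oneL_coe] with w h1 h2 h3
  rw [h1, h2, h3, mul_one]

theorem flux_coe (i : D.Inner) (m : Fin 3) (x : Pairs D) :
    ∀ᵐ w ∂D.cylMeas D.kMeas, flux i m x w
      = (w.1 : ℂ) * gradH x.2.1 i w m + gradV x.1.1 x.2.1 i w.1 w.2 m := by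
  rw [flux_apply]
  filter_upwards [Lp.coeFn_add (D.mulK D.kInf (gradL D.kMeas i m x.2.1)) (gradV2 i m x),
    mulLp_coe D.kInf (gradL D.kMeas i m x.2.1), gradV2_coe i m x, kInf_coe,
    gradL_coe i x.2.1 m] with w h1 h2 h3 h4 h5
  rw [h1, Pi.add_apply, h2, h3, h4, h5]

theorem quad_term_coe (i : D.Inner) (m : Fin 3) (x : Pairs D) :
    ∀ᵐ w ∂D.cylMeas D.kMeas, D.mulK (gradVInf i m x) (kFlux i m x) w
      = gradV x.1.1 x.2.1 i w.1 w.2 m * (2 * ((w.1 : ℂ) *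
        ((w.1 : ℂ) * gradH x.2.1 i w m + gradV x.1.1 x.2.1 i w.1 w.2 m))) := by
  rw [kFlux_apply]
  filter_upwards [mulLp_coe (gradVInf i m x) (D.mulK (D.cInf 2) (D.mulK D.kInf (flux i m x))),
    mulLp_coe (D.cInf 2) (D.mulK D.kInf (flux i m x)), mulLp_coe D.kInf (flux i m x),
    flux_coe i m x, gradVInf_coe i m x, kInf_coe, cInf_coe (D := D) 2] with w h1 h2 h3 h4 h5 h6 h7
  rw [h1, h2, h3, h4, h5, h6, h7]

theorem coe_add_five (a b c d e : Lp ℂ 2 (D.cylMeas D.kMeas)) :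
    ∀ᵐ w ∂D.cylMeas D.kMeas, (a + b + (c + d + e) : Lp ℂ 2 (D.cylMeas D.kMeas)) w
      = a w + b w + (c w + d w + e w) := by
  filter_upwards [Lp.coeFn_add (a + b) (c + d + e), Lp.coeFn_add a b, Lp.coeFn_add (c + d) e,
    Lp.coeFn_add c d] with w h1 h2 h3 h4
  rw [h1, Pi.add_apply, h2, Pi.add_apply, h3, Pi.add_apply, h4, Pi.add_apply]

theorem opL_eq (i : D.Inner) (x : Pairs D) :
    opL i x = lapL D.kMeas i x.2.1 + D.mulK (D.cInf (2 * Complex.I)) (flux i 2 x)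
      + (D.mulK (gradVInf i 0 x) (kFlux i 0 x) + D.mulK (gradVInf i 1 x) (kFlux i 1 x)
        + D.mulK (gradVInf i 2 x) (kFlux i 2 x)) := by
  rw [opL, quad_apply, Fin.sum_univ_three, lin_apply, linLow_apply, lapL,
    _root_.add_apply, ev_apply, add_assoc ((x.2 : D.Jet 2 D.kMeas) (ctr i, 2)) (lapLow _ _ _)]

theorem opL_coe (i : D.Inner) (x : Pairs D) :
    ∀ᵐ w ∂D.cylMeas D.kMeas, opL i x w = Lh x.1.1 x.2.1 i w := by
  rw [opL_eq]
  filter_upwards [coe_add_five (lapL D.kMeas i x.2.1)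
      (D.mulK (D.cInf (2 * Complex.I)) (flux i 2 x)) (D.mulK (gradVInf i 0 x) (kFlux i 0 x))
      (D.mulK (gradVInf i 1 x) (kFlux i 1 x)) (D.mulK (gradVInf i 2 x) (kFlux i 2 x)),
    quad_term_coe i 0 x, quad_term_coe i 1 x, quad_term_coe i 2 x,
    mulLp_coe (D.cInf (2 * Complex.I)) (flux i 2 x), flux_coe i 2 x, lapL_coe i x.2.1,
    cInf_coe (D := D) (2 * Complex.I)] with w h1 q0 q1 q2 h5 h6 h7 h8
  refine h1.trans ?_
  rw [q0, q1, q2, h7, h5, h6, h8, Lh]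
  simp only [dotProduct, Fin.sum_univ_three, Pi.add_apply, Pi.smul_apply, smul_eq_mul]
  ring

/-! ### Estimates of the operators -/

section

variable {lam : ℝ}

theorem carl_mulK_left (f : Lp ℂ ∞ (D.cylMeas D.kMeas)) (u : Lp ℂ 2 (D.cylMeas D.kMeas)) :
    D.carl D.kMeas 2 lam (D.mulK f u) = D.mulK (D.carl D.kMeas ∞ lam f) u :=
  mulLp_mulLp _ _ _

theorem carl_mulK_right (f : Lp ℂ ∞ (D.cylMeas D.kMeas)) (u : Lp ℂ 2 (D.cylMeas D.kMeas)) :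
    D.carl D.kMeas 2 lam (D.mulK f u) = D.mulK f (D.carl D.kMeas 2 lam u) :=
  mulLp_comm _ _ _

theorem norm_mulK_le_of_le {f : Lp ℂ ∞ (D.cylMeas D.kMeas)} {u : Lp ℂ 2 (D.cylMeas D.kMeas)}
    {a b : ℝ} (hf : ‖f‖ ≤ a) (hu : ‖u‖ ≤ b) : ‖D.mulK f u‖ ≤ a * b :=
  (norm_mulLp_le f u).trans (mul_le_mul hf hu (norm_nonneg _) ((norm_nonneg _).trans hf))

/-- A common constant for the estimates of the operators. -/
noncomputable def opC (D : Config) : ℝ :=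
  1 + D.gridC + D.gradC + D.ratC * D.gridC
    + (2 + 2 * D.kmax) * (D.kmax * D.gridC + (D.gradC + D.ratC * D.gridC) * ‖D.oneL‖)

theorem gridC_nonneg : 0 ≤ D.gridC := zero_le_one.trans one_le_gridC

theorem ratC_nonneg : 0 ≤ D.ratC := Real.sqrt_nonneg _

theorem opC_bounds : 1 ≤ D.opC ∧ D.gradC ≤ D.opC ∧ D.ratC * D.gridC ≤ D.opC ∧
    D.gridC + 2 * (D.kmax * D.gridC + D.gradC * ‖D.oneL‖) ≤ D.opC ∧
    D.gridC + 2 * (D.kmax * D.gridC + D.ratC * D.gridC * ‖D.oneL‖) ≤ D.opC ∧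
    2 * (D.kmax * (D.kmax * D.gridC + D.gradC * ‖D.oneL‖)) ≤ D.opC ∧
    2 * (D.kmax * (D.kmax * D.gridC + D.ratC * D.gridC * ‖D.oneL‖)) ≤ D.opC := by
  have k0 := (kmax_pos (D := D)).le
  have g0 := gridC_nonneg (D := D)
  have g1 := gradC_nonneg (D := D)
  have r0 := mul_nonneg (ratC_nonneg (D := D)) g0
  have o0 := norm_nonneg D.oneL
  have a1 := mul_nonneg k0 g0
  have a2 := mul_nonneg g1 o0
  have a3 := mul_nonneg r0 o0
  have a4 := mul_nonneg k0 a1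
  have a5 := mul_nonneg k0 a2
  have a6 := mul_nonneg k0 a3
  have e : D.opC = 1 + D.gridC + D.gradC + D.ratC * D.gridC + 2 * (D.kmax * D.gridC)
    + 2 * (D.gradC * ‖D.oneL‖) + 2 * (D.ratC * D.gridC * ‖D.oneL‖)
    + 2 * (D.kmax * (D.kmax * D.gridC))
    + 2 * (D.kmax * (D.gradC * ‖D.oneL‖)) + 2 * (D.kmax * (D.ratC * D.gridC * ‖D.oneL‖)) := by
    unfold opC
    ring
  refine ⟨?_, ?_, ?_, ?_, ?_, ?_, ?_⟩ <;> rw [e] <;> linarith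

theorem opC_nonneg : 0 ≤ D.opC := zero_le_one.trans opC_bounds.1

theorem norm_flux_le (i : D.Inner) (m : Fin 3) (x : Pairs D) :
    ‖flux i m x‖ ≤ (D.kmax * D.gridC + D.gradC * ‖D.oneL‖) * ‖x‖ := by
  have b2 : ‖x.2.1‖ ≤ ‖x‖ := norm_snd_le x
  have h1 : ‖D.mulK D.kInf (gradL D.kMeas i m x.2.1)‖ ≤ D.kmax * (D.gridC * ‖x‖) :=
    norm_mulK_le_of_le norm_kInf_le ((norm_gradL_le i m x.2.1).trans
      (mul_le_mul_of_nonneg_left b2 gridC_nonneg))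
  have h2 : ‖D.mulK (gradVInf i m x) D.oneL‖ ≤ D.gradC * ‖x‖ * ‖D.oneL‖ :=
    norm_mulK_le_of_le (norm_gradVInf_le i m x) le_rfl
  rw [flux_apply, gradV2_apply]
  refine (norm_add_le _ _).trans ?_
  linarith

theorem norm_kFlux_le (i : D.Inner) (m : Fin 3) (x : Pairs D) :
    ‖kFlux i m x‖ ≤ D.opC * ‖x‖ := by
  rw [kFlux_apply]
  refine (norm_mulK_le_of_le norm_cInf_two_le
    (norm_mulK_le_of_le norm_kInf_le (norm_flux_le i m x))).trans ?_
  rw [← mul_assoc, ← mul_assoc, mul_assoc 2]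
  exact mul_le_mul_of_nonneg_right opC_bounds.2.2.2.2.2.1 (norm_nonneg _)

theorem norm_quad_le (i : D.Inner) (x y : Pairs D) :
    ‖quad i x y‖ ≤ 3 * D.opC ^ 2 * (‖x‖ * ‖y‖) := by
  rw [quad_apply]
  refine (norm_sum_le _ _).trans ?_
  calc _ ≤ ∑ _m : Fin 3, D.opC * ‖x‖ * (D.opC * ‖y‖) := by
        refine Finset.sum_le_sum fun m _ => norm_mulK_le_of_le ?_ (norm_kFlux_le i m y)
        exact (norm_gradVInf_le i m x).trans
          (mul_le_mul_of_nonneg_right opC_bounds.2.1 (norm_nonneg _))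
    _ = _ := by
        rw [Finset.sum_const]
        simp
        ring

theorem norm_lin_le (i : D.Inner) (x : Pairs D) : ‖lin i x‖ ≤ D.opC * ‖x‖ := by
  have b2 : ‖x.2.1‖ ≤ ‖x‖ := norm_snd_le x
  have e : lin i x = lapL D.kMeas i x.2.1 + D.mulK (D.cInf (2 * Complex.I)) (flux i 2 x) := by
    rw [lin_apply, linLow_apply, lapL, _root_.add_apply, ev_apply, add_assoc]
  rw [e]
  have h1 : ‖D.mulK (D.cInf (2 * Complex.I)) (flux i 2 x)‖
      ≤ 2 * ((D.kmax * D.gridC + D.gradC * ‖D.oneL‖) * ‖x‖) :=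
    norm_mulK_le_of_le ((norm_cInf_le _).trans (by simp)) (norm_flux_le i 2 x)
  have h2 : ‖lapL D.kMeas i x.2.1‖ ≤ D.gridC * ‖x‖ :=
    (norm_lapL_le i _).trans (mul_le_mul_of_nonneg_left b2 gridC_nonneg)
  calc _ ≤ _ := norm_add_le _ _
    _ ≤ (D.gridC + 2 * (D.kmax * D.gridC + D.gradC * ‖D.oneL‖)) * ‖x‖ := by linarith
    _ ≤ _ := mul_le_mul_of_nonneg_right opC_bounds.2.2.2.1 (norm_nonneg _)

variable (r : D.H0 D.kMeas)

/-- The size of the lower order terms. -/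
noncomputable def lowSize (lam : ℝ) (r : D.H0 D.kMeas) : ℝ :=
  D.eps lam * topNorm lam (r : D.Jet 2 D.kMeas)

theorem lowSize_nonneg : 0 ≤ lowSize lam r := mul_nonneg (eps_nonneg _) (topNorm_nonneg _ _)

theorem norm_carl_flux_le (hl : D.len ≤ lam) (i : D.Inner) (m : Fin 3) :
    ‖D.carl D.kMeas 2 lam (flux i m (incl D r))‖
      ≤ (D.kmax * D.gridC + D.ratC * D.gridC * ‖D.oneL‖) * lowSize lam r := by
  rw [flux_apply, gradV2_apply, map_add, carl_mulK_right, carl_mulK_left, incl_snd]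
  have h1 : ‖D.mulK D.kInf (D.carl D.kMeas 2 lam (gradL D.kMeas i m (r : D.Jet 2 D.kMeas)))‖
      ≤ D.kmax * (D.gridC * lowSize lam r) :=
    norm_mulK_le_of_le norm_kInf_le (norm_carl_gradL_le r.2 hl i m)
  have h2 : ‖D.mulK (D.carl D.kMeas ∞ lam (gradVInf i m (incl D r))) D.oneL‖
      ≤ D.ratC * D.gridC * lowSize lam r * ‖D.oneL‖ :=
    norm_mulK_le_of_le (norm_carl_gradVInf_le hl r i m) le_rfl
  refine (norm_add_le _ _).trans ?_
  linarith

theorem norm_carl_kFlux_le (hl : D.len ≤ lam) (i : D.Inner) (m : Fin 3) :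
    ‖D.carl D.kMeas 2 lam (kFlux i m (incl D r))‖ ≤ D.opC * lowSize lam r := by
  rw [kFlux_apply, carl_mulK_right, carl_mulK_right]
  refine (norm_mulK_le_of_le norm_cInf_two_le
    (norm_mulK_le_of_le norm_kInf_le (norm_carl_flux_le r hl i m))).trans ?_
  rw [← mul_assoc, ← mul_assoc, mul_assoc 2]
  exact mul_le_mul_of_nonneg_right opC_bounds.2.2.2.2.2.2 (lowSize_nonneg r)

theorem norm_carl_gradVInf_le' (hl : D.len ≤ lam) (i : D.Inner) (m : Fin 3) :
    ‖D.carl D.kMeas ∞ lam (gradVInf i m (incl D r))‖ ≤ D.opC * lowSize lam r :=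
  (norm_carl_gradVInf_le hl r i m).trans
    (mul_le_mul_of_nonneg_right opC_bounds.2.2.1 (lowSize_nonneg r))

theorem norm_carl_linLow_le (hl : D.len ≤ lam) (i : D.Inner) :
    ‖D.carl D.kMeas 2 lam (linLow i (incl D r))‖ ≤ D.opC * lowSize lam r := by
  rw [linLow_apply, map_add, carl_mulK_right, incl_snd]
  have h1 : ‖D.mulK (D.cInf (2 * Complex.I)) (D.carl D.kMeas 2 lam (flux i 2 (incl D r)))‖
      ≤ 2 * ((D.kmax * D.gridC + D.ratC * D.gridC * ‖D.oneL‖) * lowSize lam r) :=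
    norm_mulK_le_of_le ((norm_cInf_le _).trans (by simp)) (norm_carl_flux_le r hl i 2)
  have h2 : ‖D.carl D.kMeas 2 lam (lapLow D.kMeas i (r : D.Jet 2 D.kMeas))‖
      ≤ D.gridC * lowSize lam r := norm_carl_lapLow_le r.2 hl i
  calc _ ≤ _ := norm_add_le _ _
    _ ≤ (D.gridC + 2 * (D.kmax * D.gridC + D.ratC * D.gridC * ‖D.oneL‖)) * lowSize lam r := by
        linarith
    _ ≤ _ := mul_le_mul_of_nonneg_right opC_bounds.2.2.2.2.1 (lowSize_nonneg r)

/-- Here and in `norm_carl_quad_left_le` the weight is put on the factor that contains r. The other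
factor is bounded without weight, so no exponential of λ enters. -/
theorem norm_carl_quad_right_le (hl : D.len ≤ lam) (i : D.Inner) (x : Pairs D) :
    ‖D.carl D.kMeas 2 lam (quad i x (incl D r))‖ ≤ 3 * D.opC ^ 2 * (‖x‖ * lowSize lam r) := by
  rw [quad_apply, map_sum]
  refine (norm_sum_le _ _).trans ?_
  calc _ ≤ ∑ _m : Fin 3, D.opC * ‖x‖ * (D.opC * lowSize lam r) := by
        refine Finset.sum_le_sum fun m _ => ?_
        rw [carl_mulK_right]
        refine norm_mulK_le_of_le ?_ (norm_carl_kFlux_le r hl i m)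
        exact (norm_gradVInf_le i m x).trans
          (mul_le_mul_of_nonneg_right opC_bounds.2.1 (norm_nonneg _))
    _ = _ := by
        rw [Finset.sum_const]
        simp
        ring

theorem norm_carl_quad_left_le (hl : D.len ≤ lam) (i : D.Inner) (x : Pairs D) :
    ‖D.carl D.kMeas 2 lam (quad i (incl D r) x)‖ ≤ 3 * D.opC ^ 2 * (‖x‖ * lowSize lam r) := by
  rw [quad_apply, map_sum]
  refine (norm_sum_le _ _).trans ?_
  calc _ ≤ ∑ _m : Fin 3, D.opC * lowSize lam r * (D.opC * ‖x‖) := by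
        refine Finset.sum_le_sum fun m _ => ?_
        rw [carl_mulK_left]
        exact norm_mulK_le_of_le (norm_carl_gradVInf_le' r hl i m) (norm_kFlux_le i m x)
    _ = _ := by
        rw [Finset.sum_const]
        simp
        ring

/-- The product contains two weights and the quadratic term two factors depending on r, so each
factor receives one weight and gains one eps, while y stays unweighted. Keeping a weight on y would
cost an exponential of λ, which could not be absorbed. -/
theorem abs_inner_carl_quad_le (hl : D.len ≤ lam) (i : D.Inner)
    (y : Lp ℂ 2 (D.cylMeas D.kMeas)) :
    |inner ℝ (D.carl D.kMeas 2 lam y) (D.carl D.kMeas 2 lam (quad i (incl D r) (incl D r)))|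
      ≤ 3 * D.opC ^ 2 * (‖y‖ * lowSize lam r ^ 2) := by
  rw [inner_carl]
  refine (abs_real_inner_le_norm _ _).trans ?_
  have h : ‖D.carl D.kMeas 2 lam (D.carl D.kMeas 2 lam (quad i (incl D r) (incl D r)))‖
      ≤ 3 * D.opC ^ 2 * lowSize lam r ^ 2 := by
    rw [quad_apply, map_sum, map_sum]
    refine (norm_sum_le _ _).trans ?_
    calc _ ≤ ∑ _m : Fin 3, D.opC * lowSize lam r * (D.opC * lowSize lam r) := by
          refine Finset.sum_le_sum fun m _ => ?_
          rw [carl_mulK_left, carl_mulK_right]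
          exact norm_mulK_le_of_le (norm_carl_gradVInf_le' r hl i m) (norm_carl_kFlux_le r hl i m)
      _ = _ := by
          rw [Finset.sum_const]
          simp
          ring
  calc _ ≤ ‖y‖ * (3 * D.opC ^ 2 * lowSize lam r ^ 2) :=
        mul_le_mul_of_nonneg_left h (norm_nonneg _)
    _ = _ := by ring

end

end Config

end Convexification

namespace Convexification

open scoped ENNReal

/-! ### Minimization of uniformly convex functionals -/

section Minimization

open Filter Topology

variable {X : Type}

/-- A nonnegative continuous functional which is uniformly convex at midpoints has a unique minimizer
on a closed set. -/
theorem exists_isUniqueMinOn [NormedAddCommGroup X] [NormedSpace ℝ X] [CompleteSpace X] {S : Set X}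
    (hS : IsClosed S) (hne : S.Nonempty)
    (hconv : ∀ x ∈ S, ∀ y ∈ S, (1 / 2 : ℝ) • (x + y) ∈ S) {J : X → ℝ} (hJ : Continuous J)
    (h0 : ∀ x, 0 ≤ J x) {c : ℝ} (hc : 0 < c)
    (hmid : ∀ x ∈ S, ∀ y ∈ S, c * ‖x - y‖ ^ 2 ≤ J x + J y - 2 * J ((1 / 2 : ℝ) • (x + y))) :
    ∃ x, IsUniqueMinOn J S x ∧ ∀ y ∈ S, J x + c * ‖x - y‖ ^ 2 ≤ J y := by
  set m := sInf (J '' S) with hm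
  have hbdd : BddBelow (J '' S) := ⟨0, by rintro _ ⟨x, -, rfl⟩; exact h0 x⟩
  have hle : ∀ x ∈ S, m ≤ J x := fun x hx => csInf_le hbdd ⟨x, hx, rfl⟩
  -- The midpoint lies in S, so its value is at least the infimum. This one inequality makes
  -- minimizing sequences Cauchy and also yields the quadratic growth at the limit.
  have key : ∀ x ∈ S, ∀ y ∈ S, c * ‖x - y‖ ^ 2 ≤ J x + J y - 2 * m := fun x hx y hy => by
    have h1 := hmid x hx y hy
    have h2 := hle _ (hconv x hx y hy)
    linarith
  have hseq : ∀ n : ℕ, ∃ x ∈ S, J x < m + 1 / ((n : ℝ) + 1) := fun n => by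
    obtain ⟨_, ⟨x, hx, rfl⟩, hlt⟩ := exists_lt_of_csInf_lt (hne.image J)
      (lt_add_of_pos_right m (Nat.one_div_pos_of_nat (α := ℝ) (n := n)))
    exact ⟨x, hx, hlt⟩
  choose x hxS hx using hseq
  have hlim : Tendsto (fun n : ℕ => 1 / ((n : ℝ) + 1)) atTop (𝓝 0) :=
    tendsto_one_div_add_atTop_nhds_zero_nat
  have hcau : CauchySeq x := by
    refine cauchySeq_of_le_tendsto_0 (fun n : ℕ => √(2 / c * (1 / ((n : ℝ) + 1)))) ?_ ?_
    · intro n k N hn hk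
      rw [dist_eq_norm]
      refine Real.le_sqrt_of_sq_le ?_
      have h1 := key _ (hxS n) _ (hxS k)
      have h2 : 1 / ((n : ℝ) + 1) ≤ 1 / ((N : ℝ) + 1) := by gcongr
      have h3 : 1 / ((k : ℝ) + 1) ≤ 1 / ((N : ℝ) + 1) := by gcongr
      have h4 : c * ‖x n - x k‖ ^ 2 ≤ 2 * (1 / ((N : ℝ) + 1)) := by
        linarith [hx n, hx k]
      rw [div_mul_eq_mul_div, le_div_iff₀ hc]
      linarith
    · have := (hlim.const_mul (2 / c)).sqrt
      simpa using this
  obtain ⟨a, ha⟩ := cauchySeq_tendsto_of_complete hcau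
  have haS : a ∈ S := hS.mem_of_tendsto ha (Eventually.of_forall hxS)
  have hJa : J a ≤ m := by
    have h1 : Tendsto (fun n => J (x n)) atTop (𝓝 (J a)) := (hJ.tendsto a).comp ha
    have h2 : Tendsto (fun n : ℕ => m + 1 / ((n : ℝ) + 1)) atTop (𝓝 m) := by
      simpa using hlim.const_add m
    exact le_of_tendsto_of_tendsto' h1 h2 fun n => (hx n).le
  have hgrow : ∀ y ∈ S, J a + c * ‖a - y‖ ^ 2 ≤ J y := fun y hy => by
    have h1 := key a haS y hy
    have h2 := hle a haS
    linarith
  refine ⟨a, ⟨haS, fun y hy hne => ?_⟩, hgrow⟩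
  have h1 := hgrow y hy
  have h2 : 0 < c * ‖a - y‖ ^ 2 := by
    have : 0 < ‖a - y‖ := norm_pos_iff.2 (sub_ne_zero.2 hne.symm)
    positivity
  linarith

variable [NormedAddCommGroup X] [InnerProductSpace ℝ X]

theorem IsProjection.inner_le_zero {S : Set X} (hS : Convex ℝ S) {y x : X}
    (h : IsProjection S y x) {w : X} (hw : w ∈ S) : inner ℝ (y - x) (w - x) ≤ 0 := by
  have : Nonempty S := ⟨⟨x, h.1⟩⟩
  refine (norm_eq_iInf_iff_real_inner_le_zero hS h.1).1 (le_antisymm ?_ ?_) w hw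
  · exact le_ciInf fun w => h.2 w w.2
  · exact ciInf_le ⟨0, by rintro _ ⟨w, rfl⟩; exact norm_nonneg _⟩ (⟨x, h.1⟩ : S)

/-- One step of the gradient projection method. -/
theorem norm_sq_projection_step_le {S : Set X} (hS : Convex ℝ S) {J : X → ℝ} {x p p' g : X}
    {γ c M : ℝ} (hγ : 0 < γ) (hM : 2 * γ * M ≤ 1) (hx : x ∈ S)
    (hmin : ∀ y ∈ S, J x ≤ J y) (hproj : IsProjection S (p - γ • g) p')
    (hlow : c * ‖x - p‖ ^ 2 ≤ J x - J p - inner ℝ g (x - p))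
    (hup : J p' - J p - inner ℝ g (p' - p) ≤ M * ‖p' - p‖ ^ 2) :
    ‖x - p'‖ ^ 2 ≤ (1 - 2 * γ * c) * ‖x - p‖ ^ 2 := by
  have h1 := hproj.inner_le_zero hS hx
  have h2 := hmin p' hproj.1
  have e1 : inner ℝ (p - γ • g - p') (x - p')
      = inner ℝ (p - p') (x - p') - γ * inner ℝ g (x - p') := by
    rw [sub_right_comm, inner_sub_left, real_inner_smul_left]
  have e2 : ‖x - p‖ ^ 2 = ‖x - p'‖ ^ 2 - 2 * inner ℝ (x - p') (p - p') + ‖p - p'‖ ^ 2 := by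
    rw [← norm_sub_sq_real, sub_sub_sub_cancel_right]
  have e3 : inner ℝ g (x - p') = inner ℝ g (x - p) - inner ℝ g (p' - p) := by
    rw [← inner_sub_right, sub_sub_sub_cancel_right]
  rw [e1, real_inner_comm] at h1
  rw [norm_sub_rev p' p] at hup
  -- Lower Taylor bound towards x, upper one towards p', and J x ≤ J p'; no first order condition at
  -- x is used. With the projection inequality this leaves the term (2γM - 1)‖p - p'‖², which the
  -- step size makes nonpositive.
  have h3 : c * ‖x - p‖ ^ 2 + inner ℝ g (x - p') ≤ M * ‖p - p'‖ ^ 2 := by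
    rw [e3]
    linarith
  have h4 := mul_le_mul_of_nonneg_left h3 hγ.le
  have h5 := mul_le_mul_of_nonneg_right hM (sq_nonneg ‖p - p'‖)
  linarith

end Minimization

theorem hasFDerivAt_add_bilinear {E F : Type*} [NormedAddCommGroup E] [NormedSpace ℝ E]
    [NormedAddCommGroup F] [NormedSpace ℝ F] (A : E →L[ℝ] F) (B : E →L[ℝ] E →L[ℝ] F) (x : E) :
    HasFDerivAt (fun y => A y + B y y) (A + (B x + B.flip x)) x := by
  have h := (A.hasFDerivAt (x := x)).fun_add
    (B.hasFDerivAt_of_bilinear (hasFDerivAt_id x) (hasFDerivAt_id x))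
  refine h.congr_fderiv (ContinuousLinearMap.ext fun y => ?_)
  simp

namespace Config

variable {D : Config}

/-! ### Algebra of the quadratic operator -/

/-- The derivative of `opL`. -/
noncomputable def dOp (i : D.Inner) (x : Pairs D) :
    Pairs D →L[ℝ] Lp ℂ 2 (D.cylMeas D.kMeas) :=
  lin i + (quad i x + (quad i).flip x)

theorem hasFDerivAt_opL (i : D.Inner) (x : Pairs D) : HasFDerivAt (opL i) (dOp i x) x :=
  hasFDerivAt_add_bilinear (lin i) (quad i) x

theorem dOp_apply (i : D.Inner) (x y : Pairs D) :
    dOp i x y = lin i y + (quad i x y + quad i y x) := rfl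

theorem opL_add (i : D.Inner) (x y : Pairs D) :
    opL i (x + y) = opL i x + (dOp i x y + quad i y y) := by
  simp only [opL, dOp_apply, map_add, _root_.add_apply]
  abel

/-- B(x, x) - B(y, y) = B(x, x - y) + B(x - y, y), in this order because B is not symmetric. -/
theorem opL_sub (i : D.Inner) (x y : Pairs D) :
    opL i x - opL i y = lin i (x - y) + (quad i x (x - y) + quad i (x - y) y) := by
  simp only [opL, map_sub, _root_.sub_apply]
  abel

/-- The Lipschitz constant of `opL` on the ball of radius `ρ`. -/
noncomputable def lipC (D : Config) (ρ : ℝ) : ℝ := D.opC + 6 * D.opC ^ 2 * ρ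

theorem lipC_nonneg {ρ : ℝ} (hρ : 0 ≤ ρ) : 0 ≤ D.lipC ρ := by
  have := opC_nonneg (D := D)
  unfold lipC
  positivity

theorem norm_opL_sub_le (i : D.Inner) {ρ : ℝ} {x y : Pairs D} (hx : ‖x‖ ≤ ρ) (hy : ‖y‖ ≤ ρ) :
    ‖opL i x - opL i y‖ ≤ D.lipC ρ * ‖x - y‖ := by
  have hC := opC_nonneg (D := D)
  rw [opL_sub]
  have h1 := norm_lin_le i (x - y)
  have h2 := norm_quad_le i x (x - y)
  have h3 := norm_quad_le i (x - y) y
  have a1 : ‖x‖ * ‖x - y‖ ≤ ρ * ‖x - y‖ := by gcongr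
  have a2 : ‖x - y‖ * ‖y‖ ≤ ρ * ‖x - y‖ := by rw [mul_comm]; gcongr
  have a3 : 3 * D.opC ^ 2 * (‖x‖ * ‖x - y‖) ≤ 3 * D.opC ^ 2 * (ρ * ‖x - y‖) := by gcongr
  have a4 : 3 * D.opC ^ 2 * (‖x - y‖ * ‖y‖) ≤ 3 * D.opC ^ 2 * (ρ * ‖x - y‖) := by gcongr
  have b1 := norm_add_le (lin i (x - y)) (quad i x (x - y) + quad i (x - y) y)
  have b2 := norm_add_le (quad i x (x - y)) (quad i (x - y) y)
  unfold lipC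
  linarith

theorem norm_opL_le (i : D.Inner) {ρ : ℝ} {x : Pairs D} (hx : ‖x‖ ≤ ρ) :
    ‖opL i x‖ ≤ D.lipC ρ * ρ := by
  have hρ : 0 ≤ ρ := (norm_nonneg x).trans hx
  have h := norm_opL_sub_le i hx (y := 0) (by simpa using hρ)
  have h0 : opL i (0 : Pairs D) = 0 := by simp [opL]
  rw [h0, sub_zero, sub_zero] at h
  exact h.trans (mul_le_mul_of_nonneg_left hx (lipC_nonneg hρ))

/-- Isolates r_zz, the only term in the increment without a gain in λ. -/
theorem opL_sub_incl (i : D.Inner) (x : Pairs D) (r : D.H0 D.kMeas) :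
    opL i (x + incl D r) - opL i x = (r : D.Jet 2 D.kMeas) (ctr i, 2)
      + (linLow i (incl D r) + (quad i (x + incl D r) (incl D r) + quad i (incl D r) x)) := by
  rw [opL_sub, add_sub_cancel_left, lin_apply, incl_snd, add_assoc]

theorem norm_carl_low_le {lam : ℝ} (hl : D.len ≤ lam) (i : D.Inner) {ρ : ℝ} {x : Pairs D}
    {r : D.H0 D.kMeas} (hx : ‖x‖ ≤ ρ) (hy : ‖x + incl D r‖ ≤ ρ) :
    ‖D.carl D.kMeas 2 lam (linLow i (incl D r)
        + (quad i (x + incl D r) (incl D r) + quad i (incl D r) x))‖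
      ≤ D.lipC ρ * lowSize lam r := by
  have hC := opC_nonneg (D := D)
  have hs := lowSize_nonneg (lam := lam) r
  rw [map_add, map_add]
  have h1 := norm_carl_linLow_le r hl i
  have h2 := norm_carl_quad_right_le r hl i (x + incl D r)
  have h3 := norm_carl_quad_left_le r hl i x
  have a3 : 3 * D.opC ^ 2 * (‖x + incl D r‖ * lowSize lam r)
    ≤ 3 * D.opC ^ 2 * (ρ * lowSize lam r) := by gcongr
  have a4 : 3 * D.opC ^ 2 * (‖x‖ * lowSize lam r) ≤ 3 * D.opC ^ 2 * (ρ * lowSize lam r) := by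
    gcongr
  have b1 := norm_add_le (D.carl D.kMeas 2 lam (linLow i (incl D r)))
    (D.carl D.kMeas 2 lam (quad i (x + incl D r) (incl D r))
      + D.carl D.kMeas 2 lam (quad i (incl D r) x))
  have b2 := norm_add_le (D.carl D.kMeas 2 lam (quad i (x + incl D r) (incl D r)))
    (D.carl D.kMeas 2 lam (quad i (incl D r) x))
  unfold lipC
  linarith

/-! ### The functional -/

/-- The weighted functional on pairs. -/
noncomputable def costP (lam : ℝ) (x : Pairs D) : ℝ :=
  ∑ i : D.Inner, ‖D.carl D.kMeas 2 lam (opL i x)‖ ^ 2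

/-- The derivative of the weighted functional. -/
noncomputable def dCostP (lam : ℝ) (x : Pairs D) : Pairs D →L[ℝ] ℝ :=
  ∑ i : D.Inner, (2 : ℝ) • (innerSL ℝ (D.carl D.kMeas 2 lam (opL i x))).comp
    ((D.carl D.kMeas 2 lam).comp (dOp i x))

theorem dCostP_apply (lam : ℝ) (x y : Pairs D) :
    dCostP lam x y = ∑ i : D.Inner,
      2 * inner ℝ (D.carl D.kMeas 2 lam (opL i x)) (D.carl D.kMeas 2 lam (dOp i x y)) := by
  simp only [dCostP, _root_.sum_apply]
  rfl

theorem hasFDerivAt_costP (lam : ℝ) (x : Pairs D) : HasFDerivAt (costP lam) (dCostP lam x) x := by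
  refine HasFDerivAt.fun_sum fun i _ => ?_
  exact ((D.carl D.kMeas 2 lam).hasFDerivAt.comp x (hasFDerivAt_opL i x)).norm_sq.congr_fderiv
    (by rw [← Nat.cast_smul_eq_nsmul ℝ 2, Nat.cast_ofNat]; rfl)

/-- `opL` is a quadratic polynomial, so the identity is exact. The full increment b differs from the
derivative term by B(y, y), and ‖a + b‖² - ‖a‖² - 2⟨a, b - B(y, y)⟩ = ‖b‖² + 2⟨a, B(y, y)⟩. -/
theorem costP_add (lam : ℝ) (x y : Pairs D) :
    costP lam (x + y) - costP lam x - dCostP lam x y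
      = ∑ i : D.Inner, (‖D.carl D.kMeas 2 lam (opL i (x + y) - opL i x)‖ ^ 2
        + 2 * inner ℝ (D.carl D.kMeas 2 lam (opL i x)) (D.carl D.kMeas 2 lam (quad i y y))) := by
  rw [dCostP_apply, costP, costP, ← Finset.sum_sub_distrib, ← Finset.sum_sub_distrib]
  refine Finset.sum_congr rfl fun i _ => ?_
  rw [opL_add, add_sub_cancel_left, map_add (D.carl D.kMeas 2 lam) (opL i x), norm_add_sq_real,
    map_add (D.carl D.kMeas 2 lam) (dOp i x y), inner_add_right]
  ring

/-- The number of interior nodes. -/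
noncomputable def innerC (D : Config) : ℝ := Fintype.card D.Inner

theorem innerC_nonneg : 0 ≤ D.innerC := Nat.cast_nonneg _

/-- The constant in the two-sided estimate of the second order Taylor remainder. -/
noncomputable def remC (D : Config) (ρ : ℝ) : ℝ :=
  D.innerC * (D.lipC ρ ^ 2 + 2 * (3 * D.opC ^ 2 * (D.lipC ρ * ρ)))

theorem remC_nonneg {ρ : ℝ} (hρ : 0 ≤ ρ) : 0 ≤ D.remC ρ := by
  have h1 := lipC_nonneg (D := D) hρ
  have h2 := innerC_nonneg (D := D)
  unfold remC
  positivity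

theorem exp_sq (t : ℝ) : Real.exp t ^ 2 = Real.exp (2 * t) := by
  rw [← Real.exp_nat_mul]
  norm_num

theorem half_sq_sub_le {E : Type*} [NormedAddCommGroup E] (a b : E) :
    ‖a‖ ^ 2 / 2 - ‖b‖ ^ 2 ≤ ‖a + b‖ ^ 2 := by
  have h1 : ‖a‖ ≤ ‖a + b‖ + ‖b‖ := by simpa using norm_sub_le (a + b) b
  have h2 := pow_le_pow_left₀ (norm_nonneg a) h1 2
  nlinarith [sq_nonneg (‖a + b‖ - ‖b‖)]

/-- The weight is bounded by its supremum. The exponential loss in λ is harmless, since this bound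
only restricts the step size. -/
theorem costP_remainder_le (lam : ℝ) {ρ : ℝ} {x : Pairs D} {r : D.H0 D.kMeas} (hx : ‖x‖ ≤ ρ)
    (hy : ‖x + incl D r‖ ≤ ρ) :
    costP lam (x + incl D r) - costP lam x - dCostP lam x (incl D r)
      ≤ D.remC ρ * Real.exp (2 * (|lam| * D.len)) * ‖r‖ ^ 2 := by
  have hρ : 0 ≤ ρ := (norm_nonneg x).trans hx
  have hC := opC_nonneg (D := D)
  have hL := lipC_nonneg (D := D) hρ
  rw [costP_add]
  set W := Real.exp (|lam| * D.len) with hW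
  have hW0 : 0 < W := Real.exp_pos _
  calc _ ≤ ∑ _i : D.Inner, ((W * (D.lipC ρ * ‖r‖)) ^ 2
      + 2 * ((W * (D.lipC ρ * ρ)) * (W * (3 * D.opC ^ 2 * (‖r‖ * ‖r‖))))) := by
        refine Finset.sum_le_sum fun i _ => add_le_add ?_ ?_
        · refine pow_le_pow_left₀ (norm_nonneg _) ((norm_carl_le _ _).trans ?_) 2
          refine mul_le_mul_of_nonneg_left ?_ hW0.le
          have := norm_opL_sub_le i hy hx
          rwa [add_sub_cancel_left, norm_incl] at this
        · refine mul_le_mul_of_nonneg_left ((real_inner_le_norm _ _).trans ?_) zero_le_two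
          refine mul_le_mul ((norm_carl_le _ _).trans ?_) ((norm_carl_le _ _).trans ?_)
            (norm_nonneg _) (by positivity)
          · exact mul_le_mul_of_nonneg_left (norm_opL_le i hx) hW0.le
          · refine mul_le_mul_of_nonneg_left ?_ hW0.le
            have := norm_quad_le i (incl D r) (incl D r)
            rwa [norm_incl] at this
    _ = _ := by
        rw [Finset.sum_const, nsmul_eq_mul, ← exp_sq, ← hW, remC, innerC, Finset.card_univ]
        ring

theorem eps_sq {lam : ℝ} (hl : D.len ≤ lam) : D.eps lam ^ 2 = D.len / (2 * lam) := by
  have := len_pos (D := D)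
  exact Real.sq_sqrt (div_nonneg this.le (by linarith))

theorem le_node_remainder {lam : ℝ} (hl : D.len ≤ lam) {ρ : ℝ} {x : Pairs D}
    {r : D.H0 D.kMeas} (hx : ‖x‖ ≤ ρ) (hy : ‖x + incl D r‖ ≤ ρ) (i : D.Inner) :
    ‖D.carl D.kMeas 2 lam ((r : D.Jet 2 D.kMeas) (ctr i, 2))‖ ^ 2 / 2
        - ((D.lipC ρ * lowSize lam r) ^ 2
          + 2 * (3 * D.opC ^ 2 * (D.lipC ρ * ρ * lowSize lam r ^ 2)))
      ≤ ‖D.carl D.kMeas 2 lam (opL i (x + incl D r) - opL i x)‖ ^ 2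
        + 2 * inner ℝ (D.carl D.kMeas 2 lam (opL i x))
          (D.carl D.kMeas 2 lam (quad i (incl D r) (incl D r))) := by
  have hC := opC_nonneg (D := D)
  rw [opL_sub_incl, map_add]
  have a1 := half_sq_sub_le (D.carl D.kMeas 2 lam ((r : D.Jet 2 D.kMeas) (ctr i, 2)))
    (D.carl D.kMeas 2 lam (linLow i (incl D r)
      + (quad i (x + incl D r) (incl D r) + quad i (incl D r) x)))
  have a2 := pow_le_pow_left₀ (norm_nonneg _) (norm_carl_low_le hl i hx hy) 2
  have a3 := (abs_le.1 (abs_inner_carl_quad_le r hl i (opL i x))).1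
  have a4 : 3 * D.opC ^ 2 * (‖opL i x‖ * lowSize lam r ^ 2)
      ≤ 3 * D.opC ^ 2 * (D.lipC ρ * ρ * lowSize lam r ^ 2) := by
    have := norm_opL_le i hx
    gcongr
  linarith

/-- Strong convexity: half of the weighted square of r_zz survives by ‖a + b‖² ≥ ‖a‖²/2 - ‖b‖², and
the rest is eps² times that square with the constant `remC`, which does not involve λ. -/
theorem le_costP_remainder {lam : ℝ} (hl : D.len ≤ lam) {ρ : ℝ} (hl' : 2 * D.remC ρ * D.len ≤ lam)
    {x : Pairs D} {r : D.H0 D.kMeas} (hx : ‖x‖ ≤ ρ) (hy : ‖x + incl D r‖ ≤ ρ) :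
    1 / (4 * D.cardC) * ‖r‖ ^ 2
      ≤ costP lam (x + incl D r) - costP lam x - dCostP lam x (incl D r) := by
  have hlam : 0 < lam := len_pos.trans_le hl
  have hcard := cardC_pos (D := D)
  have h1 : topNorm lam (r : D.Jet 2 D.kMeas) ^ 2 / 2 - D.remC ρ * lowSize lam r ^ 2
      ≤ costP lam (x + incl D r) - costP lam x - dCostP lam x (incl D r) := by
    rw [costP_add]
    refine le_trans (le_of_eq ?_)
      (Finset.sum_le_sum fun i _ => le_node_remainder hl hx hy i)
    rw [Finset.sum_sub_distrib, ← Finset.sum_div, ← topNorm_sq, Finset.sum_const, nsmul_eq_mul,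
      remC, innerC, Finset.card_univ]
    ring
  have e : D.remC ρ * lowSize lam r ^ 2
      = (D.remC ρ * D.len / (2 * lam)) * topNorm lam (r : D.Jet 2 D.kMeas) ^ 2 := by
    rw [lowSize, mul_pow, eps_sq hl]
    ring
  have h3 : ‖r‖ ^ 2 ≤ D.cardC * topNorm lam (r : D.Jet 2 D.kMeas) ^ 2 :=
    norm_sq_le_topNorm r.2 hl
  rw [e] at h1
  refine le_trans ?_ h1
  generalize topNorm lam (r : D.Jet 2 D.kMeas) = T at h3
  -- The threshold for λ is chosen to absorb half of T²/2, leaving T²/4.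
  have h2 : D.remC ρ * D.len / (2 * lam) * T ^ 2 ≤ 1 / 4 * T ^ 2 := by
    refine mul_le_mul_of_nonneg_right ?_ (sq_nonneg T)
    rw [div_le_div_iff₀ (by positivity) (by norm_num)]
    linarith
  have h4 : 1 / (4 * D.cardC) * ‖r‖ ^ 2 ≤ T ^ 2 / 4 := by
    rw [div_mul_eq_mul_div, one_mul, div_le_div_iff₀ (by positivity) (by norm_num)]
    linarith
  linarith

end Config

end Convexification

namespace Convexification

open scoped ENNReal

namespace Config

variable {D : Config} {K : Type} [MeasurableSpace K] {ν : Measure K} [IsFiniteMeasure ν]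

/-! ### The functionals as sums of norms -/

theorem exp_mul_integral_eq (lam : ℝ) (f : Lp ℂ 2 (D.cylMeas ν)) {F : K × ℝ → ℂ}
    (h : ∀ᵐ w ∂D.cylMeas ν, f w = F w) :
    Real.exp (2 * lam * D.d) * ∫ w, ‖F w‖ ^ 2 * cwf lam w.2 ∂D.cylMeas ν
      = ‖D.carl ν 2 lam f‖ ^ 2 := by
  rw [← real_inner_self_eq_norm_sq, L2.inner_def, ← integral_const_mul]
  refine integral_congr_ae ?_
  filter_upwards [h, carl_coe lam f] with w h1 h2
  rw [real_inner_self_eq_norm_sq, h2, h1, norm_mul, norm_wt, mul_pow, exp_sq, cwf, mul_left_comm,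
    ← Real.exp_add, mul_comm]
  congr 2
  ring

theorem trunc_mem {F : D.Jet 3 ν} (hF : F ∈ D.H 3 ν) : trunc F ∈ D.H 2 ν :=
  fun n r => hF n r.castSucc

theorem trunc_sub {ν : Measure K} (F G : D.Jet 3 ν) : trunc F - trunc G = trunc (F - G) := rfl

theorem norm_trunc_le {ν : Measure K} (F : D.Jet 3 ν) : ‖trunc F‖ ≤ ‖F‖ := by
  refine (sq_le_sq₀ (norm_nonneg _) (norm_nonneg _)).1 ?_
  rw [PiLp.norm_sq_eq_of_L2, PiLp.norm_sq_eq_of_L2]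
  have h : ∀ n : D.Node, ∑ r : Fin 3, ‖trunc F (n, r)‖ ^ 2 ≤ ∑ r : Fin 4, ‖F (n, r)‖ ^ 2 := by
    intro n
    rw [Fin.sum_univ_castSucc (n := 3)]
    exact le_add_of_nonneg_right (sq_nonneg ‖F (n, Fin.last 3)‖)
  exact (Fintype.sum_prod_type fun p : D.Node × Fin 3 => ‖trunc F p‖ ^ 2).trans_le
    ((Finset.sum_le_sum fun n _ => h n).trans_eq
      (Fintype.sum_prod_type fun p : D.Node × Fin 4 => ‖F p‖ ^ 2).symm)

theorem sub_mem_H0 {f g : D.Jet 2 ν} {φ₀ φ₁ : D.Inner → K → ℂ} (hf : f ∈ D.H 2 ν)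
    (hg : g ∈ D.H 2 ν) (bf : HasBC f φ₀ φ₁) (bg : HasBC g φ₀ φ₁) : f - g ∈ D.H0 ν := by
  refine ⟨(D.H 2 ν).sub_mem hf hg, fun n hn => ?_, fun i => ?_, fun i => ?_, fun i => ?_⟩
  · rw [PiLp.sub_apply, bf.lateral n hn, bg.lateral n hn, sub_zero]
  · simpa using HasTrace.sub left_mem (bf.bottom i) (bg.bottom i)
  · simpa using HasTrace.sub left_mem (bf.bottom_z i) (bg.bottom_z i)
  · simpa using HasTrace.sub right_mem (bf.top i) (bg.top i)

theorem cost_eq (V : D.H 2 unitMeas) {F : D.Jet 3 D.kMeas} (hF : F ∈ D.H 3 D.kMeas) (lam : ℝ)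
    (p : D.H0 D.kMeas) :
    cost (V : D.Jet 2 unitMeas) F lam p
      = costP lam ((V, ⟨trunc F, trunc_mem hF⟩) + incl D p) := by
  rw [cost, costP, Finset.mul_sum]
  refine Finset.sum_congr rfl fun i _ => exp_mul_integral_eq lam _ ?_
  have h := opL_coe i ((V, ⟨trunc F, trunc_mem hF⟩) + incl D p)
  have e1 : ((((V, ⟨trunc F, trunc_mem hF⟩) + incl D p : Pairs D).1 : D.H 2 unitMeas) :
      D.Jet 2 unitMeas) = V := by
    rw [Prod.fst_add, incl_fst, add_zero]
  have e2 : ((((V, ⟨trunc F, trunc_mem hF⟩) + incl D p : Pairs D).2 : D.H 2 D.kMeas) :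
      D.Jet 2 D.kMeas) = p + trunc F := by
    rw [Prod.snd_add, Submodule.coe_add, incl_snd, add_comm]
  rwa [e1, e2] at h

/-! ### The tail function -/

theorem tailCost_eq (Q : D.Jet 2 unitMeas) (mu : ℝ) (W : D.H0 unitMeas) :
    tailCost Q mu W = ∑ i : D.Inner,
      ‖D.carl unitMeas 2 mu (lapL unitMeas i ((W : D.Jet 2 unitMeas) + Q))‖ ^ 2 := by
  rw [tailCost, Finset.mul_sum]
  exact Finset.sum_congr rfl fun i _ => exp_mul_integral_eq mu _ (lapL_coe i _)

/-- The Carleman estimate for the discrete Laplacian. -/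
theorem le_sum_carl_lapL {lam : ℝ} (hl : D.len ≤ lam)
    (hl' : 2 * (D.innerC * D.gridC ^ 2) * D.len ≤ lam) (r : D.H0 ν) :
    1 / (4 * D.cardC) * ‖r‖ ^ 2
      ≤ ∑ i : D.Inner, ‖D.carl ν 2 lam (lapL ν i (r : D.Jet 2 ν))‖ ^ 2 := by
  have hlam : 0 < lam := len_pos.trans_le hl
  have hcard := cardC_pos (D := D)
  have hnode : ∀ i : D.Inner, ‖D.carl ν 2 lam ((r : D.Jet 2 ν) (ctr i, 2))‖ ^ 2 / 2
      - (D.gridC * (D.eps lam * topNorm lam (r : D.Jet 2 ν))) ^ 2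
      ≤ ‖D.carl ν 2 lam (lapL ν i (r : D.Jet 2 ν))‖ ^ 2 := fun i => by
    have a1 := half_sq_sub_le (D.carl ν 2 lam ((r : D.Jet 2 ν) (ctr i, 2)))
      (D.carl ν 2 lam (lapLow ν i (r : D.Jet 2 ν)))
    have a2 := pow_le_pow_left₀ (norm_nonneg _) (norm_carl_lapLow_le r.2 hl i) 2
    have e : lapL ν i (r : D.Jet 2 ν)
      = (r : D.Jet 2 ν) (ctr i, 2) + lapLow ν i (r : D.Jet 2 ν) := rfl
    rw [e, map_add]
    linarith
  refine le_trans ?_ (Finset.sum_le_sum fun i _ => hnode i)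
  rw [Finset.sum_sub_distrib, ← Finset.sum_div, ← topNorm_sq, Finset.sum_const, nsmul_eq_mul,
    Finset.card_univ, mul_pow, mul_pow, eps_sq hl]
  have h3 : ‖r‖ ^ 2 ≤ D.cardC * topNorm lam (r : D.Jet 2 ν) ^ 2 := norm_sq_le_topNorm r.2 hl
  generalize topNorm lam (r : D.Jet 2 ν) = T at h3
  have e : (Fintype.card D.Inner : ℝ) * (D.gridC ^ 2 * (D.len / (2 * lam) * T ^ 2))
      = (D.innerC * D.gridC ^ 2 * D.len) / (2 * lam) * T ^ 2 := by
    rw [innerC]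
    ring
  have h2 : (D.innerC * D.gridC ^ 2 * D.len) / (2 * lam) * T ^ 2 ≤ 1 / 4 * T ^ 2 := by
    refine mul_le_mul_of_nonneg_right ?_ (sq_nonneg T)
    rw [div_le_div_iff₀ (by positivity) (by norm_num)]
    linarith
  have h4 : 1 / (4 * D.cardC) * ‖r‖ ^ 2 ≤ T ^ 2 / 4 := by
    rw [div_mul_eq_mul_div, one_mul, div_le_div_iff₀ (by positivity) (by norm_num)]
    linarith
  rw [e]
  linarith

theorem sq_add_sq_sub_midpoint {E : Type*} [NormedAddCommGroup E] [InnerProductSpace ℝ E]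
    (a b : E) : ‖a‖ ^ 2 + ‖b‖ ^ 2 - 2 * ‖(1 / 2 : ℝ) • (a + b)‖ ^ 2 = 1 / 2 * ‖a - b‖ ^ 2 := by
  rw [norm_smul, mul_pow, norm_add_sq_real, norm_sub_sq_real]
  norm_num
  ring

theorem continuous_tailCost (Q : D.Jet 2 unitMeas) (mu : ℝ) : Continuous (tailCost Q mu) := by
  have e : tailCost Q mu = fun W : D.H0 unitMeas => ∑ i : D.Inner,
      ‖D.carl unitMeas 2 mu (lapL unitMeas i ((W : D.Jet 2 unitMeas) + Q))‖ ^ 2 :=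
    funext (tailCost_eq Q mu)
  rw [e]
  fun_prop

/-- The parallelogram law for squared norms of affine maps; Q cancels in the difference, so the
Carleman estimate on `H0` applies. -/
theorem tailCost_midpoint (Q : D.Jet 2 unitMeas) (mu : ℝ) (W W' : D.H0 unitMeas) :
    tailCost Q mu W + tailCost Q mu W' - 2 * tailCost Q mu ((1 / 2 : ℝ) • (W + W'))
      = 1 / 2 * ∑ i : D.Inner, ‖D.carl unitMeas 2 mu
          (lapL unitMeas i ((W - W' : D.H0 unitMeas) : D.Jet 2 unitMeas))‖ ^ 2 := by
  simp only [tailCost_eq, Finset.mul_sum]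
  rw [← Finset.sum_add_distrib, ← Finset.sum_sub_distrib]
  refine Finset.sum_congr rfl fun i _ => ?_
  set T : D.Jet 2 unitMeas →L[ℝ] Lp ℂ 2 (D.cylMeas unitMeas) :=
    (D.carl unitMeas 2 mu).comp (lapL unitMeas i) with hT
  have hTa : ∀ u, D.carl unitMeas 2 mu (lapL unitMeas i u) = T u := fun u => rfl
  simp only [hTa]
  have e1 : T ((W - W' : D.H0 unitMeas) : D.Jet 2 unitMeas)
      = T ((W : D.Jet 2 unitMeas) + Q) - T ((W' : D.Jet 2 unitMeas) + Q) := by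
    rw [← map_sub, add_sub_add_right_eq_sub, Submodule.coe_sub]
  have e2 : T ((((1 / 2 : ℝ) • (W + W') : D.H0 unitMeas) : D.Jet 2 unitMeas) + Q)
      = (1 / 2 : ℝ) • (T ((W : D.Jet 2 unitMeas) + Q) + T ((W' : D.Jet 2 unitMeas) + Q)) := by
    rw [← map_add, ← map_smul, Submodule.coe_smul, Submodule.coe_add]
    congr 1
    module
  rw [e1, e2, sq_add_sq_sub_midpoint]

/-- The constant in the error estimate of the tail function. -/
noncomputable def tailC (D : Config) : ℝ := √(8 * D.cardC * (D.innerC * D.gridC ^ 2)) + 1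

theorem one_le_tailC : 1 ≤ D.tailC := by
  unfold tailC
  linarith [Real.sqrt_nonneg (8 * D.cardC * (D.innerC * D.gridC ^ 2))]

/-- The growth at the minimizer is tested with W_* = V_* - Q_*. Since Δ^h V_* = 0, its residual is
Δ^h(Q - Q_*), of size δ, and its cost is at most a constant times e^{2μ(d+ξ)} δ² = δ. -/
theorem exists_tail {mu δ : ℝ} (hδ : 0 < δ) (hδ1 : δ ≤ 1)
    (hexp : Real.exp (2 * (mu * D.len)) = 1 / δ) (hl : D.len ≤ mu)
    (hl' : 2 * (D.innerC * D.gridC ^ 2) * D.len ≤ mu)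
    {ψ₀ ψ₁ : D.Inner → Unit → ℂ} {Vs Qs Q : D.Jet 2 unitMeas} (hV : IsTail Vs ψ₀ ψ₁)
    (hQs : Qs ∈ D.H 2 unitMeas) (bQs : HasBC Qs ψ₀ ψ₁) (hQ : ‖Q - Qs‖ < δ) :
    ∃ W : D.H0 unitMeas, IsUniqueMinOn (tailCost Q mu) Set.univ W ∧
      ‖(W : D.Jet 2 unitMeas) + Q - Vs‖ ≤ D.tailC * √δ := by
  have hcard := cardC_pos (D := D)
  obtain ⟨W, hW, hgrow⟩ := exists_isUniqueMinOn (X := D.H0 unitMeas) isClosed_univ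
    Set.univ_nonempty (fun _ _ _ _ => Set.mem_univ _) (continuous_tailCost Q mu)
    (fun W => by rw [tailCost_eq]; positivity) (c := 1 / (8 * D.cardC)) (by positivity)
    (fun W _ W' _ => by
      rw [tailCost_midpoint]
      have h := le_sum_carl_lapL hl hl' (W - W')
      have e : 1 / (8 * D.cardC) * ‖W - W'‖ ^ 2
          = 1 / 2 * (1 / (4 * D.cardC) * ‖W - W'‖ ^ 2) := by
        field_simp
        ring
      rw [e]
      linarith)
  refine ⟨W, hW, ?_⟩
  have hmu : 0 < mu := len_pos.trans_le hl
  set Ws : D.H0 unitMeas := ⟨Vs - Qs, sub_mem_H0 hV.mem hQs hV.bc bQs⟩ with hWs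
  have h1 := hgrow Ws (Set.mem_univ _)
  have h0 : 0 ≤ tailCost Q mu W := by rw [tailCost_eq]; positivity
  have h2 : tailCost Q mu Ws ≤ D.innerC * D.gridC ^ 2 * δ := by
    rw [tailCost_eq]
    have hnode : ∀ i : D.Inner,
        ‖D.carl unitMeas 2 mu (lapL unitMeas i ((Ws : D.Jet 2 unitMeas) + Q))‖ ^ 2
        ≤ D.gridC ^ 2 * δ := fun i => by
      have hz : lapL unitMeas i Vs = 0 := by
        rw [Lp.ext_iff]
        filter_upwards [lapL_coe i Vs, hV.eq i, Lp.coeFn_zero ℂ 2 (D.cylMeas unitMeas)]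
          with w a1 a2 a3
        rw [a1, a2, a3, Pi.zero_apply]
      have e : (Ws : D.Jet 2 unitMeas) + Q = Vs + (Q - Qs) := by
        rw [hWs]
        module
      rw [e, map_add, hz, zero_add]
      have a1 := norm_carl_le mu (lapL unitMeas i (Q - Qs))
      have a2 : ‖lapL unitMeas i (Q - Qs)‖ ≤ D.gridC * δ :=
        (norm_lapL_le i _).trans (mul_le_mul_of_nonneg_left hQ.le gridC_nonneg)
      rw [abs_of_pos hmu] at a1
      have a3 := a1.trans (mul_le_mul_of_nonneg_left a2 (Real.exp_pos _).le)
      have a4 := pow_le_pow_left₀ (norm_nonneg _) a3 2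
      refine a4.trans (le_of_eq ?_)
      rw [mul_pow, exp_sq, hexp]
      field_simp
    refine (Finset.sum_le_sum fun i _ => hnode i).trans (le_of_eq ?_)
    rw [Finset.sum_const, nsmul_eq_mul, Finset.card_univ, innerC]
    ring
  have h3 : ‖W - Ws‖ ^ 2 ≤ 8 * D.cardC * (D.innerC * D.gridC ^ 2) * δ := by
    have a : 1 / (8 * D.cardC) * ‖W - Ws‖ ^ 2 ≤ D.innerC * D.gridC ^ 2 * δ := by linarith
    rw [div_mul_eq_mul_div, one_mul, div_le_iff₀ (by positivity)] at a
    linarith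
  have h4 : ‖W - Ws‖ ≤ √(8 * D.cardC * (D.innerC * D.gridC ^ 2)) * √δ := by
    rw [← Real.sqrt_mul' _ hδ.le]
    exact Real.le_sqrt_of_sq_le h3
  have h5 : δ ≤ √δ := Real.le_sqrt_of_sq_le (by nlinarith)
  have e : (W : D.Jet 2 unitMeas) + Q - Vs
      = ((W - Ws : D.H0 unitMeas) : D.Jet 2 unitMeas) + (Q - Qs) := by
    rw [Submodule.coe_sub, hWs]
    module
  rw [e, tailC, add_mul, one_mul]
  exact (norm_add_le _ _).trans (add_le_add h4 (hQ.le.trans h5))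

end Config

end Convexification

namespace Convexification

open scoped ENNReal

namespace Config

variable {D : Config}

/-! ### Reconstruction of the coefficient -/

theorem tailInt_sub (T : (D.Jet 2 unitMeas) →L[ℝ] Lp ℂ 2 (D.cylMeas unitMeas))
    (T' : (D.Jet 2 D.kMeas) →L[ℝ] Lp ℂ 2 (D.cylMeas D.kMeas)) (x y : Pairs D) :
    ∀ᵐ z ∂D.zMeas, ∀ k ∈ Set.Icc D.kmin D.kmax,
      tailInt (T x.1.1) (T' x.2.1) k z - tailInt (T y.1.1) (T' y.2.1) k z
        = tailInt (T (x - y).1.1) (T' (x - y).2.1) k z := by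
  filter_upwards [tailInt_add (T (x - y).1.1) (T y.1.1) (T' (x - y).2.1) (T' y.2.1)] with z hz k hk
  have h := hz k hk
  rw [← map_add, ← map_add] at h
  have e1 : ((x - y).1 : D.Jet 2 unitMeas) + y.1 = x.1 := by simp
  have e2 : ((x - y).2 : D.Jet 2 D.kMeas) + y.2 = x.2 := by simp
  rw [e1, e2] at h
  rw [h, add_sub_cancel_right]

theorem gradV_sub (i : D.Inner) (m : Fin 3) (x y : Pairs D) :
    ∀ᵐ z ∂D.zMeas, ∀ k ∈ Set.Icc D.kmin D.kmax,
      gradV x.1.1 x.2.1 i k z m - gradV y.1.1 y.2.1 i k z m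
        = gradV (x - y).1.1 (x - y).2.1 i k z m := by
  filter_upwards [tailInt_sub (gradL unitMeas i m) (gradL D.kMeas i m) x y,
    gradV_eq_tailInt x.1.1 x.2.1 i m, gradV_eq_tailInt y.1.1 y.2.1 i m,
    gradV_eq_tailInt (x - y).1.1 (x - y).2.1 i m] with z h h1 h2 h3 k hk
  rw [h1 k hk, h2 k hk, h3 k hk, h k hk]

theorem lapV_sub (i : D.Inner) (x y : Pairs D) :
    ∀ᵐ z ∂D.zMeas, ∀ k ∈ Set.Icc D.kmin D.kmax,
      lapV x.1.1 x.2.1 i k z - lapV y.1.1 y.2.1 i k z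
        = tailInt (lapL unitMeas i (x - y).1.1) (lapL D.kMeas i (x - y).2.1) k z := by
  filter_upwards [tailInt_sub (lapL unitMeas i) (lapL D.kMeas i) x y,
    lapV_eq_tailInt x.1.1 x.2.1 i, lapV_eq_tailInt y.1.1 y.2.1 i] with z h h1 h2 k hk
  rw [h1 k hk, h2 k hk, h k hk]

/-- The Lipschitz constant of the lower order terms of the coefficient. -/
noncomputable def coefLow (D : Config) (ρ : ℝ) : ℝ :=
  6 * D.kmax ^ 2 * D.gradC ^ 2 * ρ + 2 * D.kmax * D.gradC

theorem coefLow_nonneg {ρ : ℝ} (hρ : 0 ≤ ρ) : 0 ≤ D.coefLow ρ := by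
  have h1 := kmax_pos (D := D)
  have h2 := gradC_nonneg (D := D)
  unfold coefLow
  positivity

/-- Without complex conjugation the difference factors as (a + b)(a - b) in each of the three
components. -/
theorem norm_dotProduct_sub_le {a b c : Fin 3 → ℂ} {s t : ℝ} (ha : ∀ m, ‖a m‖ ≤ s)
    (hb : ∀ m, ‖b m‖ ≤ s) (hc : ∀ m, a m - b m = c m) (hct : ∀ m, ‖c m‖ ≤ t) :
    ‖a ⬝ᵥ a - b ⬝ᵥ b‖ ≤ 6 * s * t := by
  have e : a ⬝ᵥ a - b ⬝ᵥ b = ∑ m, (a m + b m) * c m := by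
    simp only [dotProduct, ← Finset.sum_sub_distrib]
    refine Finset.sum_congr rfl fun m _ => ?_
    rw [← hc m]
    ring
  rw [e]
  calc _ ≤ ∑ m : Fin 3, ‖(a m + b m) * c m‖ := norm_sum_le _ _
    _ ≤ ∑ _m : Fin 3, 2 * s * t := by
        refine Finset.sum_le_sum fun m _ => ?_
        rw [norm_mul]
        have h1 : ‖a m + b m‖ ≤ 2 * s := (norm_add_le _ _).trans (by linarith [ha m, hb m])
        exact mul_le_mul h1 (hct m) (norm_nonneg _) ((norm_nonneg _).trans h1)
    _ = _ := by
        rw [Finset.sum_const, Finset.card_univ, Fintype.card_fin, nsmul_eq_mul]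
        push_cast
        ring

/-- The gradient terms are Lipschitz uniformly in z and k; the Laplacian is kept apart, since it is
controlled only in L². -/
theorem norm_coeff_sub_le (i : D.Inner) {ρ : ℝ} {x y : Pairs D} (hx : ‖x‖ ≤ ρ) (hy : ‖y‖ ≤ ρ) :
    ∀ᵐ z ∂D.zMeas, ∀ k ∈ Set.Icc D.kmin D.kmax, ∀ rule : Rule,
      ‖coeff x.1.1 x.2.1 k i z rule - coeff y.1.1 y.2.1 k i z rule‖
        ≤ ‖tailInt (lapL unitMeas i (x - y).1.1) (lapL D.kMeas i (x - y).2.1) k z‖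
          + D.coefLow ρ * ‖x - y‖ := by
  have hG := gradC_nonneg (D := D)
  filter_upwards [lapV_sub i x y, ae_all_iff.2 fun m => gradV_sub i m x y,
    ae_all_iff.2 fun m => norm_gradV_le i m x, ae_all_iff.2 fun m => norm_gradV_le i m y,
    ae_all_iff.2 fun m => norm_gradV_le i m (x - y)] with z h1 h2 h3 h4 h5 k hk rule
  have hk0 : 0 ≤ k := D.kmin_pos.le.trans hk.1
  have hkn : ‖(k : ℂ)‖ ≤ D.kmax := by
    rw [Complex.norm_real, Real.norm_of_nonneg hk0]
    exact hk.2
  have hdot := norm_dotProduct_sub_le (a := gradV x.1.1 x.2.1 i k z)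
    (b := gradV y.1.1 y.2.1 i k z) (c := gradV (x - y).1.1 (x - y).2.1 i k z)
    (s := D.gradC * ρ) (t := D.gradC * ‖x - y‖)
    (fun m => (h3 m k hk).trans (mul_le_mul_of_nonneg_left hx hG))
    (fun m => (h4 m k hk).trans (mul_le_mul_of_nonneg_left hy hG)) (fun m => h2 m k hk)
    (fun m => h5 m k hk)
  have hz : ‖gradV x.1.1 x.2.1 i k z 2 - gradV y.1.1 y.2.1 i k z 2‖ ≤ D.gradC * ‖x - y‖ := by
    rw [h2 2 k hk]
    exact h5 2 k hk
  rw [← h1 k hk]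
  have hkm := (kmax_pos (D := D)).le
  generalize ha : gradV x.1.1 x.2.1 i k z = a at *
  generalize hb : gradV y.1.1 y.2.1 i k z = b at *
  generalize hl : lapV x.1.1 x.2.1 i k z = l at *
  generalize hl' : lapV y.1.1 y.2.1 i k z = l' at *
  have b1 : ‖(k : ℂ) ^ 2 * (a ⬝ᵥ a - b ⬝ᵥ b)‖
      ≤ D.kmax ^ 2 * (6 * (D.gradC * ρ) * (D.gradC * ‖x - y‖)) := by
    rw [norm_mul, norm_pow]
    gcongr
  have b2 : ‖2 * Complex.I * (k : ℂ) * (a 2 - b 2)‖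
      ≤ 2 * D.kmax * (D.gradC * ‖x - y‖) := by
    rw [norm_mul, norm_mul, norm_mul, Complex.norm_I, mul_one, Complex.norm_ofNat]
    gcongr
  have b3 : 0 ≤ 2 * D.kmax * (D.gradC * ‖x - y‖) := (norm_nonneg _).trans b2
  have e : D.coefLow ρ * ‖x - y‖ = D.kmax ^ 2 * (6 * (D.gradC * ρ) * (D.gradC * ‖x - y‖))
      + 2 * D.kmax * (D.gradC * ‖x - y‖) := by
    unfold coefLow
    ring
  rw [e]
  cases rule with
  | total =>
    have e2 : -(l + (k : ℂ) ^ 2 * (a ⬝ᵥ a)) - -(l' + (k : ℂ) ^ 2 * (b ⬝ᵥ b))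
        = -((l - l') + (k : ℂ) ^ 2 * (a ⬝ᵥ a - b ⬝ᵥ b)) := by ring
    have c1 := norm_add_le (l - l') ((k : ℂ) ^ 2 * (a ⬝ᵥ a - b ⬝ᵥ b))
    rw [← norm_neg, ← e2] at c1
    simp only [coeff, ha, hb, hl, hl']
    linarith
  | ratio =>
    have e2 : 1 - (l + (k : ℂ) ^ 2 * (a ⬝ᵥ a) + 2 * Complex.I * (k : ℂ) * a 2)
          - (1 - (l' + (k : ℂ) ^ 2 * (b ⬝ᵥ b) + 2 * Complex.I * (k : ℂ) * b 2))
        = -(((l - l') + (k : ℂ) ^ 2 * (a ⬝ᵥ a - b ⬝ᵥ b))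
          + 2 * Complex.I * (k : ℂ) * (a 2 - b 2)) := by ring
    have c1 := norm_add_le ((l - l') + (k : ℂ) ^ 2 * (a ⬝ᵥ a - b ⬝ᵥ b))
      (2 * Complex.I * (k : ℂ) * (a 2 - b 2))
    have c2 := norm_add_le (l - l') ((k : ℂ) ^ 2 * (a ⬝ᵥ a - b ⬝ᵥ b))
    rw [← norm_neg, ← e2] at c1
    simp only [coeff, ha, hb, hl, hl']
    linarith

/-- A fixed k is admissible because g enters only through its integral over κ, which Cauchy–Schwarz
bounds by the norm over the whole interval. -/
theorem lintegral_tailInt_le (f : Lp ℂ 2 (D.cylMeas unitMeas)) (g : Lp ℂ 2 (D.cylMeas D.kMeas))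
    {k : ℝ} (hk : k ∈ Set.Icc D.kmin D.kmax) :
    ENNReal.ofReal (D.h ^ 2) * ∫⁻ z, ‖tailInt f g k z‖ₑ ^ 2 ∂D.zMeas
      ≤ 2 * (‖f‖ₑ ^ 2 + ENNReal.ofReal (D.kmax - D.kmin) * ‖g‖ₑ ^ 2) := by
  have hm : Measurable fun z => ‖f ((), z)‖ₑ ^ 2 :=
    (stronglyMeasurable_slice f ()).enorm.pow_const 2
  have hg : Measurable fun z => ∫⁻ κ, ‖g (κ, z)‖ₑ ^ 2 ∂D.kMeas :=
    (measurable_enorm_sq g).lintegral_prod_left'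
  calc _ ≤ ENNReal.ofReal (D.h ^ 2) * ∫⁻ z, 2 * (‖f ((), z)‖ₑ ^ 2
        + ENNReal.ofReal (D.kmax - D.kmin) * ∫⁻ κ, ‖g (κ, z)‖ₑ ^ 2 ∂D.kMeas) ∂D.zMeas := by
        refine mul_le_mul' le_rfl (lintegral_mono fun z => ?_)
        have h1 : ‖tailInt f g k z‖ₑ ≤ ‖f ((), z)‖ₑ + ‖∫ κ in k..D.kmax, g (κ, z)‖ₑ :=
          enorm_sub_le
        calc _ ≤ (‖f ((), z)‖ₑ + ‖∫ κ in k..D.kmax, g (κ, z)‖ₑ) ^ 2 := by gcongr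
          _ ≤ _ := ENNReal_add_sq_le _ _
          _ ≤ _ := by
              gcongr
              exact enorm_integral_k_sq_le g hk z
    _ = _ := by
        rw [lintegral_const_mul' _ _ (by simp), lintegral_add_left hm,
          lintegral_const_mul _ hg,
          ← lintegral_lintegral_swap (measurable_enorm_sq g).aemeasurable, lintegral_unit,
          lintegral_lintegral_eq]
        have hc : ENNReal.ofReal (D.h ^ 2) * (ENNReal.ofReal (D.h ^ 2))⁻¹ = 1 :=
          ENNReal.mul_inv_cancel h_sq_ne_zero ENNReal.ofReal_ne_top
        calc _ = 2 * ((ENNReal.ofReal (D.h ^ 2) * (ENNReal.ofReal (D.h ^ 2))⁻¹) * ‖f‖ₑ ^ 2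
            + ENNReal.ofReal (D.kmax - D.kmin) *
              ((ENNReal.ofReal (D.h ^ 2) * (ENNReal.ofReal (D.h ^ 2))⁻¹) * ‖g‖ₑ ^ 2)) := by ring
          _ = _ := by rw [hc, one_mul, one_mul]

/-- The square of the Lipschitz constant of the reconstruction, for one node. -/
noncomputable def coefNode (D : Config) (ρ : ℝ) : ℝ :=
  4 * (1 + (D.kmax - D.kmin)) * D.gridC ^ 2 + 2 * D.h ^ 2 * D.len * D.coefLow ρ ^ 2

theorem coefNode_nonneg (ρ : ℝ) : 0 ≤ D.coefNode ρ := by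
  have hK : 0 < D.kmax - D.kmin := sub_pos.2 D.k_lt
  have := len_pos (D := D)
  unfold coefNode
  positivity

/-- The Lipschitz constant of the reconstruction. -/
noncomputable def coefC (D : Config) (ρ : ℝ) : ℝ := √(D.innerC * D.coefNode ρ)

theorem coefC_nonneg (ρ : ℝ) : 0 ≤ D.coefC ρ := Real.sqrt_nonneg _

theorem enorm_sq_eq_ofReal {E : Type*} [NormedAddCommGroup E] (u : E) :
    ‖u‖ₑ ^ 2 = ENNReal.ofReal (‖u‖ ^ 2) := by
  rw [← ofReal_norm, ENNReal.ofReal_pow (norm_nonneg _)]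

/-- At each node the Laplacian part contributes its L² norm and the uniformly bounded part the
length of the interval; summation over the nodes gives `coefC`. -/
theorem l2h_coeff_sub_le {ρ : ℝ} {x y : Pairs D} (hx : ‖x‖ ≤ ρ) (hy : ‖y‖ ≤ ρ) (rule : Rule)
    {k : ℝ} (hk : k ∈ Set.Icc D.kmin D.kmax) {cs : D.Inner → ℝ → ℂ}
    (hcs : ∀ i, ∀ᵐ z ∂D.zMeas, cs i z = coeff x.1.1 x.2.1 k i z rule) :
    l2h (fun i z => cs i z - coeff y.1.1 y.2.1 k i z rule)
      ≤ ENNReal.ofReal (D.coefC ρ * ‖x - y‖) := by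
  have hρ : 0 ≤ ρ := (norm_nonneg x).trans hx
  have hK : 0 < D.kmax - D.kmin := sub_pos.2 D.k_lt
  have hlen := len_pos (D := D)
  have hL := coefLow_nonneg (D := D) hρ
  have hgrid := gridC_nonneg (D := D)
  have hnode : ∀ i : D.Inner, ENNReal.ofReal (D.h ^ 2) *
      ∫⁻ z, ‖cs i z - coeff y.1.1 y.2.1 k i z rule‖ₑ ^ 2 ∂D.zMeas
      ≤ ENNReal.ofReal (D.coefNode ρ * ‖x - y‖ ^ 2) := fun i => by
    set f := lapL unitMeas i (x - y).1.1 with hf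
    set g := lapL D.kMeas i (x - y).2.1 with hg
    have b1 : ‖f‖ ≤ D.gridC * ‖x - y‖ := (norm_lapL_le i _).trans
      (mul_le_mul_of_nonneg_left (norm_fst_le (x - y)) hgrid)
    have b2 : ‖g‖ ≤ D.gridC * ‖x - y‖ := (norm_lapL_le i _).trans
      (mul_le_mul_of_nonneg_left (norm_snd_le (x - y)) hgrid)
    have hmeas : Measurable fun z => ‖tailInt f g k z‖ₑ ^ 2 :=
      ((stronglyMeasurable_tailInt f g).comp_measurable
        (measurable_prodMk_left (x := k))).enorm.pow_const 2
    calc _ ≤ ENNReal.ofReal (D.h ^ 2) * ∫⁻ z, 2 * (‖tailInt f g k z‖ₑ ^ 2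
          + ENNReal.ofReal ((D.coefLow ρ * ‖x - y‖) ^ 2)) ∂D.zMeas := by
          refine mul_le_mul' le_rfl (lintegral_mono_ae ?_)
          filter_upwards [hcs i, norm_coeff_sub_le i hx hy] with z h1 h2
          rw [h1]
          have h3 := h2 k hk rule
          have h4 : ‖coeff x.1.1 x.2.1 k i z rule - coeff y.1.1 y.2.1 k i z rule‖ₑ
              ≤ ‖tailInt f g k z‖ₑ + ENNReal.ofReal (D.coefLow ρ * ‖x - y‖) := by
            rw [← ofReal_norm, ← ofReal_norm, ← ENNReal.ofReal_add (norm_nonneg _) (by positivity)]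
            exact ENNReal.ofReal_le_ofReal h3
          rw [ENNReal.ofReal_pow (by positivity)]
          exact (pow_le_pow_left₀ (by simp) h4 2).trans (ENNReal_add_sq_le _ _)
      _ = 2 * (ENNReal.ofReal (D.h ^ 2) * ∫⁻ z, ‖tailInt f g k z‖ₑ ^ 2 ∂D.zMeas)
          + 2 * (ENNReal.ofReal (D.h ^ 2) * (ENNReal.ofReal ((D.coefLow ρ * ‖x - y‖) ^ 2)
            * ENNReal.ofReal D.len)) := by
          rw [lintegral_const_mul' _ _ (by simp), lintegral_add_left hmeas,
            lintegral_const, zMeas_univ]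
          ring
      _ ≤ 2 * (2 * (ENNReal.ofReal ((D.gridC * ‖x - y‖) ^ 2)
            + ENNReal.ofReal (D.kmax - D.kmin) * ENNReal.ofReal ((D.gridC * ‖x - y‖) ^ 2)))
          + 2 * (ENNReal.ofReal (D.h ^ 2) * (ENNReal.ofReal ((D.coefLow ρ * ‖x - y‖) ^ 2)
            * ENNReal.ofReal D.len)) := by
          have := lintegral_tailInt_le f g hk
          rw [enorm_sq_eq_ofReal, enorm_sq_eq_ofReal] at this
          refine add_le_add (mul_le_mul' le_rfl (this.trans (mul_le_mul' le_rfl ?_))) le_rfl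
          gcongr
      _ = _ := by
          have ht := norm_nonneg (x - y)
          generalize ‖x - y‖ = t at ht
          have h2 : (2 : ℝ≥0∞) = ENNReal.ofReal 2 := by simp
          rw [h2, ← ENNReal.ofReal_mul hK.le, ← ENNReal.ofReal_add (by positivity) (by positivity),
            ← ENNReal.ofReal_mul zero_le_two, ← ENNReal.ofReal_mul zero_le_two,
            ← ENNReal.ofReal_mul (by positivity), ← ENNReal.ofReal_mul (by positivity),
            ← ENNReal.ofReal_mul zero_le_two, ← ENNReal.ofReal_add (by positivity) (by positivity)]
          congr 1
          unfold coefNode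
          ring
  rw [l2h]
  calc _ ≤ (∑ _i : D.Inner, ENNReal.ofReal (D.coefNode ρ * ‖x - y‖ ^ 2)) ^ (1 / 2 : ℝ) :=
        ENNReal.rpow_le_rpow (Finset.sum_le_sum fun i _ => hnode i) (by norm_num)
    _ = ENNReal.ofReal (D.innerC * D.coefNode ρ * ‖x - y‖ ^ 2) ^ (1 / 2 : ℝ) := by
        rw [Finset.sum_const, nsmul_eq_mul, Finset.card_univ, mul_assoc,
          ENNReal.ofReal_mul innerC_nonneg, innerC, ENNReal.ofReal_natCast]
    _ = _ := by
        have h0 := mul_nonneg (innerC_nonneg (D := D)) (coefNode_nonneg (D := D) ρ)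
        rw [ENNReal.ofReal_rpow_of_nonneg (by positivity) (by norm_num), ← Real.sqrt_eq_rpow,
          Real.sqrt_mul h0, Real.sqrt_sq (norm_nonneg _), coefC]

end Config

end Convexification

namespace Convexification

open scoped ENNReal

namespace Config

variable {D : Config}

/-! ### The functional on the ball -/

/-- The gradient of `p ↦ costP lam (x + p)`. -/
noncomputable def grad (x : Pairs D) (lam : ℝ) (p : D.H0 D.kMeas) : D.H0 D.kMeas :=
  (InnerProductSpace.toDual ℝ (D.H0 D.kMeas)).symm ((dCostP lam (x + incl D p)).comp (incl D))

theorem inner_grad (x : Pairs D) (lam : ℝ) (p r : D.H0 D.kMeas) :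
    inner ℝ (grad x lam p) r = dCostP lam (x + incl D p) (incl D r) := by
  rw [grad, InnerProductSpace.toDual_symm_apply]
  rfl

theorem hasFDerivAt_costP_incl (x : Pairs D) (lam : ℝ) (p : D.H0 D.kMeas) :
    HasFDerivAt (fun p => costP lam (x + incl D p)) (innerSL ℝ (grad x lam p)) p := by
  have h := (hasFDerivAt_costP lam (x + incl D p)).comp p
    ((incl D).hasFDerivAt.const_add x)
  refine h.congr_fderiv (ContinuousLinearMap.ext fun r => ?_)
  rw [innerSL_apply_apply, inner_grad]
  rfl

variable {x : Pairs D} {lam R ρ : ℝ}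

theorem le_remainder_incl (hρ : ∀ p : D.H0 D.kMeas, ‖p‖ ≤ R → ‖x + incl D p‖ ≤ ρ)
    (hl : D.len ≤ lam) (hl' : 2 * D.remC ρ * D.len ≤ lam) {p r : D.H0 D.kMeas} (hp : ‖p‖ ≤ R)
    (hr : ‖p + r‖ ≤ R) :
    1 / (4 * D.cardC) * ‖r‖ ^ 2 ≤ costP lam (x + incl D (p + r)) - costP lam (x + incl D p)
      - inner ℝ (grad x lam p) r := by
  have h2 := hρ _ hr
  rw [map_add, ← add_assoc] at h2 ⊢
  rw [inner_grad]
  exact le_costP_remainder hl hl' (hρ p hp) h2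

theorem remainder_incl_le (hρ : ∀ p : D.H0 D.kMeas, ‖p‖ ≤ R → ‖x + incl D p‖ ≤ ρ)
    {p r : D.H0 D.kMeas} (hp : ‖p‖ ≤ R) (hr : ‖p + r‖ ≤ R) :
    costP lam (x + incl D (p + r)) - costP lam (x + incl D p) - inner ℝ (grad x lam p) r
      ≤ D.remC ρ * Real.exp (2 * (|lam| * D.len)) * ‖r‖ ^ 2 := by
  have h2 := hρ _ hr
  rw [map_add, ← add_assoc] at h2 ⊢
  rw [inner_grad]
  exact costP_remainder_le lam (hρ p hp) h2

theorem costP_nonneg (lam : ℝ) (y : Pairs D) : 0 ≤ costP lam y :=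
  Finset.sum_nonneg fun _ _ => sq_nonneg _

theorem half_add_mem_closedBall {E : Type*} [NormedAddCommGroup E] [NormedSpace ℝ E] {p q : E}
    (hp : p ∈ Metric.closedBall (0 : E) R) (hq : q ∈ Metric.closedBall (0 : E) R) :
    (1 / 2 : ℝ) • (p + q) ∈ Metric.closedBall (0 : E) R := by
  rw [mem_closedBall_zero_iff] at hp hq ⊢
  rw [norm_smul, Real.norm_of_nonneg (by norm_num)]
  linarith [norm_add_le p q]

theorem one_div_eight_mul (c t : ℝ) :
    1 / (8 * c) * t = 2 * (1 / (4 * c) * ((1 / 2) ^ 2 * t)) := by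
  simp only [one_div, mul_inv]
  ring

/-- Strong convexity is applied at the midpoint m with the two steps ±(p - q)/2. The gradient terms
cancel, and the constant is 2 · 1/(4 `cardC`) · 1/4 = 1/(8 `cardC`). -/
theorem exists_min_costP (hR : 0 < R)
    (hρ : ∀ p : D.H0 D.kMeas, ‖p‖ ≤ R → ‖x + incl D p‖ ≤ ρ)
    (hl : D.len ≤ lam) (hl' : 2 * D.remC ρ * D.len ≤ lam) :
    ∃ pmin : D.H0 D.kMeas,
      IsUniqueMinOn (fun p => costP lam (x + incl D p)) (Metric.closedBall 0 R) pmin ∧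
      ∀ q ∈ Metric.closedBall (0 : D.H0 D.kMeas) R,
        costP lam (x + incl D pmin) + 1 / (8 * D.cardC) * ‖pmin - q‖ ^ 2
          ≤ costP lam (x + incl D q) := by
  have hcard := cardC_pos (D := D)
  refine exists_isUniqueMinOn Metric.isClosed_closedBall ⟨0, by simpa using hR.le⟩
    (fun p hp q hq => half_add_mem_closedBall hp hq)
    (continuous_iff_continuousAt.2 fun p => (hasFDerivAt_costP_incl x lam p).continuousAt)
    (fun p => costP_nonneg _ _) (by positivity) (fun p hp q hq => ?_)
  have hm := half_add_mem_closedBall hp hq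
  rw [mem_closedBall_zero_iff] at hp hq hm
  obtain ⟨m, hmdef⟩ : ∃ m, m = (1 / 2 : ℝ) • (p + q) := ⟨_, rfl⟩
  rw [← hmdef] at hm ⊢
  have ep : m + (1 / 2 : ℝ) • (p - q) = p := by rw [hmdef]; module
  have eq : m + -((1 / 2 : ℝ) • (p - q)) = q := by rw [hmdef]; module
  have h1 := le_remainder_incl hρ hl hl' hm (r := (1 / 2 : ℝ) • (p - q)) (by rwa [ep])
  have h2 := le_remainder_incl hρ hl hl' hm (r := -((1 / 2 : ℝ) • (p - q))) (by rwa [eq])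
  rw [ep] at h1
  rw [eq, norm_neg, inner_neg_right] at h2
  rw [norm_smul, Real.norm_of_nonneg (by norm_num), mul_pow] at h1 h2
  rw [one_div_eight_mul]
  linarith

/-- Linear convergence of the gradient projection method. -/
theorem gradient_projection_le (hρ : ∀ p : D.H0 D.kMeas, ‖p‖ ≤ R → ‖x + incl D p‖ ≤ ρ)
    (hl : D.len ≤ lam) (hl' : 2 * D.remC ρ * D.len ≤ lam) {pmin : D.H0 D.kMeas}
    (hmin : IsUniqueMinOn (fun p => costP lam (x + incl D p)) (Metric.closedBall 0 R) pmin)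
    {γ : ℝ} (hγ : 0 < γ)
    (hM : 2 * γ * (D.remC ρ * Real.exp (2 * (|lam| * D.len))) ≤ 1)
    {p : ℕ → D.H0 D.kMeas} (hp0 : ‖p 0‖ < R)
    (hp : ∀ n, IsProjection (Metric.closedBall 0 R) (p n - γ • grad x lam (p n)) (p (n + 1)))
    (n : ℕ) :
    ‖p n‖ ≤ R ∧ ‖pmin - p n‖ ≤ √(1 - 2 * γ * (1 / (4 * D.cardC))) ^ n * ‖pmin - p 0‖ := by
  have hmin' : ∀ q ∈ Metric.closedBall (0 : D.H0 D.kMeas) R,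
      costP lam (x + incl D pmin) ≤ costP lam (x + incl D q) := fun q hq => by
    by_cases h : q = pmin
    · rw [h]
    · exact (hmin.2 q hq h).le
  induction n with
  | zero => exact ⟨hp0.le, by simp⟩
  | succ n ih =>
    have hR' := mem_closedBall_zero_iff.1 (hp n).1
    have hmR := mem_closedBall_zero_iff.1 hmin.1
    refine ⟨hR', ?_⟩
    have hlow := le_remainder_incl (p := p n) (r := pmin - p n) hρ hl hl' ih.1
      (by rwa [add_sub_cancel])
    have hup := remainder_incl_le (lam := lam) (p := p n) (r := p (n + 1) - p n) hρ ih.1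
      (by rwa [add_sub_cancel])
    rw [add_sub_cancel] at hlow hup
    have hstep := norm_sq_projection_step_le (J := fun p => costP lam (x + incl D p))
      (convex_closedBall _ _) hγ hM hmin.1 hmin' (hp n) hlow hup
    have h1 : ‖pmin - p (n + 1)‖ ≤ √(1 - 2 * γ * (1 / (4 * D.cardC))) * ‖pmin - p n‖ := by
      have := Real.le_sqrt_of_sq_le hstep
      rwa [Real.sqrt_mul' _ (sq_nonneg _), Real.sqrt_sq (norm_nonneg _)] at this
    calc _ ≤ _ := h1
      _ ≤ √(1 - 2 * γ * (1 / (4 * D.cardC))) *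
          (√(1 - 2 * γ * (1 / (4 * D.cardC))) ^ n * ‖pmin - p 0‖) :=
        mul_le_mul_of_nonneg_left ih.2 (Real.sqrt_nonneg _)
      _ = _ := by ring

/-- The functional is small at a point where `L^h` is close to an exact solution. -/
theorem costP_le_of_opL_eq_zero (hl : 0 ≤ lam) {y xs : Pairs D} (hy : ‖y‖ ≤ ρ) (hs : ‖xs‖ ≤ ρ)
    (h0 : ∀ i, opL i xs = 0) :
    costP lam y ≤ D.innerC * (Real.exp (2 * (lam * D.len)) * (D.lipC ρ * ‖y - xs‖) ^ 2) := by
  have hnode : ∀ i : D.Inner, ‖D.carl D.kMeas 2 lam (opL i y)‖ ^ 2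
      ≤ Real.exp (2 * (lam * D.len)) * (D.lipC ρ * ‖y - xs‖) ^ 2 := fun i => by
    have h1 := norm_opL_sub_le i hy hs
    rw [h0 i, sub_zero] at h1
    have h2 := (norm_carl_le lam (opL i y)).trans
      (mul_le_mul_of_nonneg_left h1 (Real.exp_pos _).le)
    rw [abs_of_nonneg hl] at h2
    refine (pow_le_pow_left₀ (norm_nonneg _) h2 2).trans (le_of_eq ?_)
    rw [mul_pow, exp_sq]
  refine (Finset.sum_le_sum fun i _ => hnode i).trans (le_of_eq ?_)
  rw [Finset.sum_const, nsmul_eq_mul, Finset.card_univ, innerC]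

theorem opL_eq_zero {Vs : D.H 2 unitMeas} {qs : D.H 2 D.kMeas} {φ₀ φ₁ : D.Inner → ℝ → ℂ}
    (h : IsField (Vs : D.Jet 2 unitMeas) (qs : D.Jet 2 D.kMeas) φ₀ φ₁) (i : D.Inner) :
    opL i ((Vs, qs) : Pairs D) = 0 := by
  rw [Lp.ext_iff]
  filter_upwards [opL_coe i ((Vs, qs) : Pairs D), h.eq i,
    Lp.coeFn_zero ℂ 2 (D.cylMeas D.kMeas)] with w a1 a2 a3
  rw [a1, a3, Pi.zero_apply]
  exact a2

end Config

/-! ### The dependence of the parameters on the noise level -/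

theorem log_rpow_neg_div {δ c s : ℝ} (hδ : 0 < δ) :
    Real.log (δ ^ (-(1 / (c * s)))) = -Real.log δ / (c * s) := by
  rw [Real.log_rpow hδ]
  ring

theorem rpow_quarter_sq {δ : ℝ} (hδ : 0 ≤ δ) : (δ ^ (1 / 4 : ℝ)) ^ 2 = √δ := by
  rw [← Real.rpow_natCast, ← Real.rpow_mul hδ, Real.sqrt_eq_rpow]
  norm_num

theorem exp_neg_half_log {δ : ℝ} (hδ : 0 < δ) : Real.exp (-Real.log δ / 2) = (√δ)⁻¹ := by
  rw [neg_div, Real.exp_neg, Real.sqrt_eq_rpow, Real.rpow_def_of_pos hδ]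
  congr 2
  ring

end Convexification

/-! ### Stability of the minimizer and the explicit constants. -/

namespace Convexification

namespace Config

variable {D : Config} {K : Type} [MeasurableSpace K]

/-- The constant in the stability estimate for the minimizer. -/
noncomputable def stabC (D : Config) (ρ : ℝ) : ℝ :=
  √(8 * D.cardC * D.innerC) * (D.lipC ρ * D.tailC)

theorem stabC_nonneg {ρ : ℝ} (hρ : 0 ≤ ρ) : 0 ≤ D.stabC ρ :=
  mul_nonneg (Real.sqrt_nonneg _)
    (mul_nonneg (lipC_nonneg hρ) (zero_le_one.trans one_le_tailC))

/-- Balance of exponents: s = δ^{1/2} is the data error, s⁻¹ the size of the squared weight and η =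
δ^{1/4}. One power of s is left for t². -/
theorem le_of_growth {c n L s t η : ℝ} (hc : 0 < c) (hn : 0 ≤ n) (hL : 0 ≤ L) (hη : 0 ≤ η)
    (hs : 0 < s) (hηs : η ^ 2 = s) (h : 1 / (8 * c) * t ^ 2 ≤ n * (s⁻¹ * (L * s) ^ 2)) :
    t ≤ √(8 * c * n) * L * η := by
  refine le_of_sq_le_sq ?_ (by positivity)
  rw [mul_pow, mul_pow, Real.sq_sqrt (by positivity), hηs]
  have e1 : t ^ 2 = 8 * c * (1 / (8 * c) * t ^ 2) := by field_simp
  have e2 : 8 * c * n * L ^ 2 * s = 8 * c * (n * (s⁻¹ * (L * s) ^ 2)) := by field_simp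
  rw [e1, e2]
  exact mul_le_mul_of_nonneg_left h (by positivity)

/-- The growth at the minimizer is tested with p_*, which lies in the ball. There L^h differs from
its zero value at the exact solution only through the errors of V and F. -/
theorem norm_sub_minimizer_le {x xs : Pairs D} {lam R ρ δ : ℝ} (hδ : 0 < δ) (hl : 0 ≤ lam)
    (hexp : Real.exp (2 * (lam * D.len)) = (√δ)⁻¹) {ps pmin : D.H0 D.kMeas} (hps : ‖ps‖ ≤ R)
    (hxρ : ‖x + incl D ps‖ ≤ ρ) (hsρ : ‖xs‖ ≤ ρ) (h0 : ∀ i, opL i xs = 0)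
    (hclose : ‖x + incl D ps - xs‖ ≤ D.tailC * √δ)
    (hgrow : ∀ q ∈ Metric.closedBall (0 : D.H0 D.kMeas) R,
      costP lam (x + incl D pmin) + 1 / (8 * D.cardC) * ‖pmin - q‖ ^ 2
        ≤ costP lam (x + incl D q)) :
    ‖ps - pmin‖ ≤ D.stabC ρ * δ ^ (1 / 4 : ℝ) := by
  have hρ : 0 ≤ ρ := (norm_nonneg _).trans hsρ
  have hL := lipC_nonneg (D := D) hρ
  have ht := zero_le_one.trans (one_le_tailC (D := D))
  have h1 := hgrow ps (mem_closedBall_zero_iff.2 hps)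
  have h2 := costP_nonneg lam (x + incl D pmin)
  have h3 := costP_le_of_opL_eq_zero hl hxρ hsρ h0
  rw [hexp] at h3
  rw [norm_sub_rev]
  refine le_of_growth cardC_pos innerC_nonneg (mul_nonneg hL ht) (Real.rpow_nonneg hδ.le _)
    (Real.sqrt_pos.2 hδ) (rpow_quarter_sq hδ.le) (le_trans (by linarith) (h3.trans ?_))
  refine mul_le_mul_of_nonneg_left (mul_le_mul_of_nonneg_left ?_ (by positivity)) innerC_nonneg
  refine pow_le_pow_left₀ (by positivity) ?_ 2
  rw [mul_assoc]
  exact mul_le_mul_of_nonneg_left hclose hL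

/-- The second component of the difference is (p_* - p) - (F - F_*), the first is V_* - V; the norm
of a pair is the larger of the two. -/
theorem norm_sub_add_incl_le {V Vs : D.Jet 2 unitMeas} (hV : V ∈ D.H 2 unitMeas)
    (hVs : Vs ∈ D.H 2 unitMeas) {f fs q : D.Jet 2 D.kMeas} (hf : f ∈ D.H 2 D.kMeas)
    (hq : q ∈ D.H 2 D.kMeas) {ε : ℝ} (hVε : ‖V - Vs‖ ≤ ε) (hfε : ‖f - fs‖ ≤ ε)
    {ps : D.H0 D.kMeas} (hps : (ps : D.Jet 2 D.kMeas) = q - fs) (p : D.H0 D.kMeas) :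
    ‖((⟨Vs, hVs⟩, ⟨q, hq⟩) : Pairs D) - (((⟨V, hV⟩, ⟨f, hf⟩) : Pairs D) + incl D p)‖
      ≤ ε + ‖ps - p‖ := by
  refine max_le ?_ ?_
  · have e : (((⟨Vs, hVs⟩, ⟨q, hq⟩) : Pairs D) - (((⟨V, hV⟩, ⟨f, hf⟩) : Pairs D) + incl D p)).1
        = (⟨Vs, hVs⟩ : D.H 2 unitMeas) - ⟨V, hV⟩ := by
      rw [Prod.fst_sub, Prod.fst_add, incl_fst, add_zero]
    rw [e, norm_sub_rev]
    exact LE.le.trans (b := ε) hVε (le_add_of_nonneg_right (norm_nonneg _))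
  · have e : ((((⟨Vs, hVs⟩, ⟨q, hq⟩) : Pairs D)
        - (((⟨V, hV⟩, ⟨f, hf⟩) : Pairs D) + incl D p)).2 : D.Jet 2 D.kMeas) = (ps - p : D.H0 D.kMeas) - (f - fs) := by
      rw [AddSubgroupClass.coe_sub, hps]
      change q - (f + p) = _
      abel
    have h := norm_sub_le ((ps - p : D.H0 D.kMeas) : D.Jet 2 D.kMeas) (f - fs)
    rw [← e] at h
    exact (h.trans (add_le_add_right hfε _)).trans (le_of_eq (add_comm _ _))

theorem norm_coe_sub {ν : Measure K} [IsFiniteMeasure ν] (p q : D.H0 ν) :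
    ‖(p : D.Jet 2 ν) - q‖ = ‖p - q‖ := rfl

theorem norm_pair_le {V : D.Jet 2 unitMeas} (hV : V ∈ D.H 2 unitMeas) {q : D.Jet 2 D.kMeas}
    (hq : q ∈ D.H 2 D.kMeas) {a : ℝ} (hVa : ‖V‖ ≤ a) (hqa : ‖q‖ ≤ a) :
    ‖((⟨V, hV⟩, ⟨q, hq⟩) : Pairs D)‖ ≤ a :=
  max_le hVa hqa

/-- A bound for the norms of all the pairs that occur in the convergence analysis. -/
noncomputable def radius (D : Config) (R A B : ℝ) : ℝ := |A| + |B| + R + D.tailC + 1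

/-- The threshold for the parameter of the Carleman weight function. -/
noncomputable def lamBound (D : Config) (ρ : ℝ) : ℝ :=
  -- The summands serve, in order, λ₁ > 1, eps ≤ 1, the convexity of the functional and the Carleman
  -- estimate for the tail.
  2 + D.len + 2 * D.remC ρ * D.len + 2 * (D.innerC * D.gridC ^ 2) * D.len

theorem lamBound_spec {ρ : ℝ} (hρ : 0 ≤ ρ) :
    1 < D.lamBound ρ ∧ D.len ≤ D.lamBound ρ ∧ 2 * D.remC ρ * D.len ≤ D.lamBound ρ ∧
      2 * (D.innerC * D.gridC ^ 2) * D.len ≤ D.lamBound ρ := by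
  have h1 := len_pos (D := D)
  have h2 := mul_nonneg (mul_nonneg zero_le_two (remC_nonneg (D := D) hρ)) h1.le
  have h3 : 0 ≤ 2 * (D.innerC * D.gridC ^ 2) * D.len :=
    mul_nonneg (mul_nonneg zero_le_two (mul_nonneg innerC_nonneg (sq_nonneg _))) h1.le
  unfold lamBound
  refine ⟨?_, ?_, ?_, ?_⟩ <;> linarith

/-- The largest step size of the gradient projection method. -/
noncomputable def stepBound (D : Config) (ρ lam : ℝ) : ℝ :=
  -- These bounds ensure in turn γ₀ < 1, the condition 2γM ≤ 1 of the projection step (the 1 keeps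
  -- the denominator positive), and a contraction factor that is strictly positive.
  min (1 / 2) (min (1 / (2 * (D.remC ρ * Real.exp (2 * (|lam| * D.len)) + 1))) D.cardC)

theorem stepBound_mem {ρ : ℝ} (hρ : 0 ≤ ρ) (lam : ℝ) : D.stepBound ρ lam ∈ Set.Ioo 0 1 := by
  have h1 := remC_nonneg (D := D) hρ
  have h2 := cardC_pos (D := D)
  refine ⟨lt_min (by norm_num) (lt_min (by positivity) h2), ?_⟩
  exact (min_le_left _ _).trans_lt (by norm_num)

theorem two_mul_step_le {ρ lam γ : ℝ} (hρ : 0 ≤ ρ) (hγ : γ ∈ Set.Ioo 0 (D.stepBound ρ lam)) :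
    2 * γ * (D.remC ρ * Real.exp (2 * (|lam| * D.len))) ≤ 1 := by
  have h1 := mul_nonneg (remC_nonneg (D := D) hρ) (Real.exp_pos (2 * (|lam| * D.len))).le
  have h2 := hγ.2.le.trans ((min_le_right _ _).trans (min_le_left _ _))
  rw [le_div_iff₀ (by positivity)] at h2
  linarith [hγ.1]

theorem sqrt_contraction_mem {ρ lam γ : ℝ} (hγ : γ ∈ Set.Ioo 0 (D.stepBound ρ lam)) :
    √(1 - 2 * γ * (1 / (4 * D.cardC))) ∈ Set.Ioo 0 1 := by
  have hc := cardC_pos (D := D)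
  have h2 := hγ.2.trans_le ((min_le_right _ _).trans (min_le_right _ _))
  have e : 2 * γ * (1 / (4 * D.cardC)) = 1 / 2 * (γ / D.cardC) := by
    field_simp
    ring
  have h3 : γ / D.cardC < 1 := (div_lt_one hc).2 h2
  have h4 : 0 < γ / D.cardC := div_pos hγ.1 hc
  rw [e]
  refine ⟨Real.sqrt_pos.2 (by linarith), (Real.sqrt_lt' one_pos).2 (by linarith)⟩

theorem sqrt_le_rpow_quarter {δ : ℝ} (hδ : 0 ≤ δ) (hδ1 : δ ≤ 1) : √δ ≤ δ ^ (1 / 4 : ℝ) := by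
  rw [← rpow_quarter_sq hδ]
  exact pow_le_of_le_one (Real.rpow_nonneg hδ _) (Real.rpow_le_one hδ hδ1 (by norm_num))
    two_ne_zero

theorem lt_neg_log_div {δ l s : ℝ} (hδ : 0 < δ) (hs : 0 < s) (h : δ < Real.exp (-4 * s * l)) :
    l < -Real.log δ / (4 * s) := by
  rw [lt_div_iff₀ (by positivity)]
  have := (Real.log_lt_iff_lt_exp hδ).2 h
  linarith

/-- The constant in the error estimates. -/
noncomputable def errC (D : Config) (ρ : ℝ) : ℝ :=
  1 + D.stabC ρ + D.coefC ρ * (D.tailC + D.stabC ρ) + D.coefC ρ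

theorem errC_spec {ρ : ℝ} (hρ : 0 ≤ ρ) :
    0 < D.errC ρ ∧ D.stabC ρ ≤ D.errC ρ ∧ D.coefC ρ ≤ D.errC ρ ∧
      D.coefC ρ * (D.tailC + D.stabC ρ) ≤ D.errC ρ := by
  have h1 := stabC_nonneg (D := D) hρ
  have h2 := coefC_nonneg (D := D) ρ
  have h3 := mul_nonneg h2 (add_nonneg (zero_le_one.trans (one_le_tailC (D := D))) h1)
  unfold errC
  refine ⟨?_, ?_, ?_, ?_⟩ <;> linarith

end Config

end Convexification


/-! ### Assembly of the theorem. -/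

set_option maxHeartbeats 1000000 in
open Convexification Convexification.Config in
theorem theorem7p6 (D : Config) (R A B : ℝ) (hR : 0 < R) :
    -- `lam₁`, `C₁`, `C₂`, `γ₀`, `θ` depend only on the geometry, `R`, `kmin`, `kmax` and on the
    -- bounds `A`, `B` for the norms of `F_*`, `V_*`
    ∃ (lam₁ C₁ C₂ : ℝ) (γ₀ : ℝ → ℝ) (θ : ℝ → ℝ → ℝ),
      1 < lam₁ ∧ 0 < C₁ ∧ 0 < C₂ ∧ (∀ lam, γ₀ lam ∈ Set.Ioo 0 1) ∧
      (∀ lam, ∀ γ ∈ Set.Ioo 0 (γ₀ lam), θ lam γ ∈ Set.Ioo 0 1) ∧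
      ∀ δ ∈ Set.Ioo 0 (Real.exp (-4 * (D.d + D.ξ) * lam₁)),
      -- the exact solution, its boundary data and their extensions
      ∀ (ψ₀s ψ₁s : D.Inner → Unit → ℂ) (Vs Qs : D.Jet 2 unitMeas),
        IsTail Vs ψ₀s ψ₁s → Qs ∈ D.H 2 unitMeas → HasBC Qs ψ₀s ψ₁s → ‖Vs‖ ≤ B →
      ∀ (φ₀s φ₁s : D.Inner → ℝ → ℂ) (qs : D.Jet 2 D.kMeas) (Fs : D.Jet 3 D.kMeas),
        IsField Vs qs φ₀s φ₁s → Fs ∈ D.H 3 D.kMeas → HasBC (trunc Fs) φ₀s φ₁s → ‖Fs‖ ≤ A →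
        ‖qs - trunc Fs‖ < R →
      -- the noisy data
      ∀ (ψ₀ ψ₁ : D.Inner → Unit → ℂ) (Q : D.Jet 2 unitMeas),
        Q ∈ D.H 2 unitMeas → HasBC Q ψ₀ ψ₁ → ‖Q - Qs‖ < δ →
      ∀ (φ₀ φ₁ : D.Inner → ℝ → ℂ) (F : D.Jet 3 D.kMeas),
        F ∈ D.H 3 D.kMeas → HasBC (trunc F) φ₀ φ₁ → ‖F - Fs‖ < δ →
      -- the tail function
      ∃ W : D.H0 unitMeas,
        IsUniqueMinOn (tailCost Q (Real.log (δ ^ (-(1 / (2 * (D.d + D.ξ))))))) Set.univ W ∧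
      ∀ V : D.Jet 2 unitMeas, V = (W : D.Jet 2 unitMeas) + Q →
      -- the Fréchet derivative `G lam p` of the functional, and its strict convexity on the ball
      ∃ G : ℝ → D.H0 D.kMeas → D.H0 D.kMeas,
        (∀ lam p, HasFDerivAt (cost V F lam) (innerSL ℝ (G lam p)) p) ∧
        (∀ lam, lam₁ ≤ lam → ∀ p r : D.H0 D.kMeas, ‖p‖ ≤ R → ‖p + r‖ ≤ R →
          C₁ * ‖r‖ ^ 2 ≤ cost V F lam (p + r) - cost V F lam p - inner ℝ (G lam p) r) ∧
      ∀ lam : ℝ, lam = Real.log (δ ^ (-(1 / (4 * (D.d + D.ξ))))) →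
        lam₁ < lam ∧
        ∃ pmin : D.H0 D.kMeas, IsUniqueMinOn (cost V F lam) (Metric.closedBall 0 R) pmin ∧
        ‖(qs - trunc Fs) - (pmin : D.Jet 2 D.kMeas)‖ ≤ C₂ * δ ^ (1 / 4 : ℝ) ∧
        -- reconstruction of the coefficient at a wave number `k`
        (∀ (ρ : Rule), ∀ k ∈ Set.Icc D.kmin D.kmax, ∀ cs : D.Inner → ℝ → ℂ,
          (∀ i, ∀ᵐ z ∂D.zMeas, cs i z = coeff Vs qs k i z ρ) →
          l2h (fun i z => cs i z - coeff V (pmin + trunc F) k i z ρ)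
            ≤ ENNReal.ofReal (C₂ * δ ^ (1 / 4 : ℝ))) ∧
        -- the gradient projection method
        ∀ γ ∈ Set.Ioo 0 (γ₀ lam), ∀ p : ℕ → D.H0 D.kMeas, ‖p 0‖ < R →
          (∀ n, IsProjection (Metric.closedBall 0 R) (p n - γ • G lam (p n)) (p (n + 1))) →
          ∀ n : ℕ, 1 ≤ n →
            ‖pmin - p n‖ ≤ θ lam γ ^ n * ‖pmin - p 0‖ ∧
            ‖(qs - trunc Fs) - (p n : D.Jet 2 D.kMeas)‖
              ≤ C₂ * δ ^ (1 / 4 : ℝ) + θ lam γ ^ n * ‖pmin - p 0‖ ∧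
            ∀ (ρ : Rule), ∀ k ∈ Set.Icc D.kmin D.kmax, ∀ cs : D.Inner → ℝ → ℂ,
              (∀ i, ∀ᵐ z ∂D.zMeas, cs i z = coeff Vs qs k i z ρ) →
              l2h (fun i z => cs i z - coeff V (p n + trunc F) k i z ρ)
                ≤ ENNReal.ofReal (C₂ * δ ^ (1 / 4 : ℝ)
                  + C₂ * (θ lam γ ^ n * ‖pmin - p 0‖)) := by
  -- One radius for the exact pair and for all pairs (V, p + F) with p in the ball, built only from
  -- A, B, R and the grid. Hence no constant below depends on the noise or on the exact solution.
  obtain ⟨ρ, hρdef⟩ : ∃ ρ, ρ = D.radius R A B := ⟨_, rfl⟩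
  have htail := one_le_tailC (D := D)
  have hlen := len_pos (D := D)
  have hρ : 0 ≤ ρ := by
    rw [hρdef, radius]
    linarith [abs_nonneg A, abs_nonneg B]
  obtain ⟨hl1, hl2, hl3, hl4⟩ := lamBound_spec (D := D) hρ
  obtain ⟨hE1, hE2, hE3, hE4⟩ := errC_spec (D := D) hρ
  have hcoef := coefC_nonneg (D := D) ρ
  refine ⟨D.lamBound ρ, 1 / (4 * D.cardC), D.errC ρ, D.stepBound ρ,
    fun _ γ => √(1 - 2 * γ * (1 / (4 * D.cardC))), hl1, by have := cardC_pos (D := D); positivity,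
    hE1, stepBound_mem hρ, fun lam γ hγ => sqrt_contraction_mem hγ, ?_⟩
  intro δ hδm ψ₀s ψ₁s Vs Qs hVs hQs bQs hB φ₀s φ₁s qs Fs hqs hFs bFs hA hps ψ₀ ψ₁ Q hQ bQ hQδ
    φ₀ φ₁ F hF bF hFδ
  obtain ⟨hδ, hδ2⟩ := hδm
  have hlam := lt_neg_log_div (l := D.lamBound ρ) (s := D.len) hδ hlen hδ2
  have hδ1 : δ ≤ 1 := hδ2.le.trans (Real.exp_le_one_iff.2 (by
    have : 0 < (D.d + D.ξ) * D.lamBound ρ := mul_pos hlen (zero_lt_one.trans hl1)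
    linarith))
  have hsqrt : √δ ≤ 1 := Real.sqrt_le_one.2 hδ1
  have hδs : δ ≤ √δ := Real.le_sqrt_of_sq_le (by nlinarith)
  -- μ = 2λ, so the lower bound for λ also provides the one required for the tail.
  have hmu : -Real.log δ / (2 * D.len) = 2 * (-Real.log δ / (4 * D.len)) := by
    field_simp
    norm_num
  have hs4 := sqrt_le_rpow_quarter hδ.le hδ1
  have hq0 : 0 ≤ δ ^ (1 / 4 : ℝ) := Real.rpow_nonneg hδ.le _
  rw [log_rpow_neg_div hδ, log_rpow_neg_div hδ, ← len]
  obtain ⟨W, hW, hWs⟩ := exists_tail (mu := -Real.log δ / (2 * D.len)) hδ hδ1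
    (by
      have e : 2 * (-Real.log δ / (2 * D.len) * D.len) = -Real.log δ := by field_simp
      rw [e, Real.exp_neg, Real.exp_log hδ, one_div])
    (by rw [hmu]; linarith) (by rw [hmu]; linarith) hVs hQs bQs hQδ
  refine ⟨W, hW, ?_⟩
  rintro V hV
  rw [← hV] at hWs
  have hVmem : V ∈ D.H 2 unitMeas := hV ▸ add_mem (H0_le_H W.2) hQ
  obtain ⟨x, hx⟩ : ∃ x : Pairs D, x = (⟨V, hVmem⟩, ⟨trunc F, trunc_mem hF⟩) := ⟨_, rfl⟩
  obtain ⟨xs, hxs⟩ : ∃ x : Pairs D, x = (⟨Vs, hVs.mem⟩, ⟨qs, hqs.mem⟩) := ⟨_, rfl⟩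
  obtain ⟨ps, hpsdef⟩ : ∃ p : D.H0 D.kMeas, (p : D.Jet 2 D.kMeas) = qs - trunc Fs :=
    ⟨⟨_, sub_mem_H0 hqs.mem (trunc_mem hFs) hqs.bc bFs⟩, rfl⟩
  have hpsR : ‖ps‖ ≤ R := by
    rw [← hpsdef] at hps
    exact hps.le
  have hcost : ∀ lam, cost V F lam = fun p => costP lam (x + incl D p) := fun lam =>
    funext fun p => by rw [hx]; exact cost_eq ⟨V, hVmem⟩ hF lam p
  have htF : ‖trunc F - trunc Fs‖ ≤ δ := by
    rw [trunc_sub]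
    exact (norm_trunc_le _).trans hFδ.le
  have hst : √δ ≤ D.tailC * √δ := le_mul_of_one_le_left (Real.sqrt_nonneg _) htail
  have hclose : ∀ p : D.H0 D.kMeas, ‖xs - (x + incl D p)‖ ≤ D.tailC * √δ + ‖ps - p‖ := by
    rw [hx, hxs]
    exact norm_sub_add_incl_le hVmem hVs.mem (trunc_mem hF) hqs.mem hWs
      (htF.trans (hδs.trans hst)) hpsdef
  -- With this the computed V stays within `tailC` of V_*, which explains that summand of the
  -- radius.
  have htt : D.tailC * √δ ≤ D.tailC := mul_le_of_le_one_right (zero_le_one.trans htail) hsqrt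
  have hxsρ : ‖xs‖ ≤ ρ := by
    rw [hxs, hρdef, radius]
    have h1 := norm_le_norm_add_norm_sub' qs (trunc Fs)
    refine norm_pair_le _ _ ?_ ?_
    · linarith [abs_nonneg A, le_abs_self B]
    · linarith [abs_nonneg B, le_abs_self A, norm_trunc_le Fs]
  have hxρ : ‖x‖ ≤ |A| + |B| + D.tailC + 1 := by
    rw [hx]
    have h1 := norm_le_norm_add_norm_sub' V Vs
    have h2 := norm_le_norm_add_norm_sub' (trunc F) (trunc Fs)
    refine norm_pair_le _ _ ?_ ?_
    · linarith [abs_nonneg A, le_abs_self B]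
    · linarith [abs_nonneg B, le_abs_self A, norm_trunc_le Fs]
  have hball : ∀ p : D.H0 D.kMeas, ‖p‖ ≤ R → ‖x + incl D p‖ ≤ ρ := fun p hp => by
    have h1 := norm_add_le x (incl D p)
    rw [norm_incl] at h1
    rw [hρdef, radius]
    linarith
  refine ⟨fun lam => grad x lam, fun lam p => ?_, fun lam hlam p r hp hr => ?_, ?_⟩
  · rw [hcost]
    exact hasFDerivAt_costP_incl x lam p
  · rw [hcost]
    exact le_remainder_incl hball (hl2.trans hlam) (hl3.trans hlam) hp hr
  rintro lam rfl
  refine ⟨hlam, ?_⟩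
  obtain ⟨lam, hlamdef⟩ : ∃ l, l = -Real.log δ / (4 * D.len) := ⟨_, rfl⟩
  rw [← hlamdef] at hlam ⊢
  have hl5 := hl2.trans hlam.le
  have hl6 := hl3.trans hlam.le
  obtain ⟨pmin, hmin, hgrow⟩ := exists_min_costP hR hball hl5 hl6
  have hstab : ‖ps - pmin‖ ≤ D.stabC ρ * δ ^ (1 / 4 : ℝ) := by
    refine norm_sub_minimizer_le hδ (hlen.le.trans hl5) ?_ hpsR (hball ps hpsR) hxsρ
      (fun i => by rw [hxs]; exact opL_eq_zero hqs i) ?_ hgrow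
    · rw [← exp_neg_half_log hδ, hlamdef]
      congr 1
      field_simp
      ring
    · have := hclose ps
      rwa [sub_self, norm_zero, add_zero, norm_sub_rev] at this
  have hx1 : ∀ p : D.H0 D.kMeas, ((x + incl D p).1 : D.Jet 2 unitMeas) = V := fun p => by
    rw [Prod.fst_add, incl_fst, add_zero, hx]
  have hx2 : ∀ p : D.H0 D.kMeas, ((x + incl D p).2 : D.Jet 2 D.kMeas) = p + trunc F := fun p => by
    rw [Prod.snd_add, Submodule.coe_add, incl_snd, add_comm, hx]
  -- Serves both coefficient estimates: t = 0 for the minimizer, and t equal to the iteration error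
  -- for p_n. The tail error √δ is absorbed into δ^{1/4}.
  have hcoeff : ∀ p : D.H0 D.kMeas, ‖p‖ ≤ R → ∀ t : ℝ, ‖ps - p‖ ≤ D.stabC ρ * δ ^ (1 / 4 : ℝ) + t →
      0 ≤ t → ∀ (rule : Rule), ∀ k ∈ Set.Icc D.kmin D.kmax, ∀ cs : D.Inner → ℝ → ℂ,
      (∀ i, ∀ᵐ z ∂D.zMeas, cs i z = coeff Vs qs k i z rule) →
      l2h (fun i z => cs i z - coeff V (p + trunc F) k i z rule)
        ≤ ENNReal.ofReal (D.errC ρ * δ ^ (1 / 4 : ℝ) + D.errC ρ * t) := by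
    intro p hp t ht ht0 rule k hk cs hcs
    have h1 := l2h_coeff_sub_le hxsρ (hball p hp) rule hk (cs := cs) (by rw [hxs]; exact hcs)
    rw [hx1, hx2] at h1
    refine h1.trans (ENNReal.ofReal_le_ofReal ?_)
    have h2 : ‖xs - (x + incl D p)‖ ≤ (D.tailC + D.stabC ρ) * δ ^ (1 / 4 : ℝ) + t := by
      have := mul_le_mul_of_nonneg_left hs4 (zero_le_one.trans htail)
      linarith [hclose p]
    refine (mul_le_mul_of_nonneg_left h2 hcoef).trans ?_
    rw [mul_add, ← mul_assoc]
    exact add_le_add (mul_le_mul_of_nonneg_right hE4 hq0) (mul_le_mul_of_nonneg_right hE3 ht0)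
  have hminR := mem_closedBall_zero_iff.1 hmin.1
  have hstab' : D.stabC ρ * δ ^ (1 / 4 : ℝ) ≤ D.errC ρ * δ ^ (1 / 4 : ℝ) :=
    mul_le_mul_of_nonneg_right hE2 hq0
  rw [← hpsdef, hcost]
  refine ⟨pmin, hmin, by rw [norm_coe_sub]; exact hstab.trans hstab', fun rule k hk cs hcs => ?_, ?_⟩
  · have := hcoeff pmin hminR 0 (by rwa [add_zero]) le_rfl rule k hk cs hcs
    rwa [mul_zero, add_zero] at this
  · intro γ hγ p hp0 hp n _
    obtain ⟨hpn, hconv⟩ := gradient_projection_le hball hl5 hl6 hmin hγ.1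
      (two_mul_step_le hρ hγ) hp0 hp n
    have hsum : ‖ps - p n‖ ≤ D.stabC ρ * δ ^ (1 / 4 : ℝ)
        + √(1 - 2 * γ * (1 / (4 * D.cardC))) ^ n * ‖pmin - p 0‖ :=
      (norm_sub_le_norm_sub_add_norm_sub ps pmin (p n)).trans (add_le_add hstab hconv)
    rw [norm_coe_sub]
    exact ⟨hconv, hsum.trans (add_le_add_left hstab' _),
      hcoeff (p n) hpn _ hsum (mul_nonneg (pow_nonneg (Real.sqrt_nonneg _) _) (norm_nonneg _))⟩
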